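/- **Setting.** Let $N\ge 1$, $m\ge 0$ be integers and $\alpha\in\mathbb R\setminus\{0\}$. The phase space has the real coordinates $b_k=a_k^{(0)}$ and $a_k^{(j)}$ ($1\le j\le m$), where in the *periodic case* $k\in\mathbb Z/N\mathbb Z$, and in the *open-end case* $1\le k\le N-j$; every symbol $a_k^{(j)}$ which is not such a coordinate denotes $0$. In the open-end case let $\mathfrak g=gl(N,\mathbb R)$, $\langle X,Y\rangle=\mathrm{tr}(XY)$, $\lambda=1$. In the periodic case let $\mathfrak g=\mathfrak g_\sigma$, $\sigma=\pm1$, be the algebra of matrices $X(\lambda)=\sum_p\lambda^p\sum_{j-k\equiv p\ (\mathrm{mod}\ N)}x^{(p)}_{jk}E_{jk}$ whose entries are formal Laurent series in $\lambda^{\sigma}$, with $\langle X,Y\rangle=\mathrm{tr}(XY)_0$, where $(\cdot)_0$ is the coefficient at $\lambda^0$. Let $R=\pi_+-\pi_-$, where $\pi_+$ and $\pi_-$ are the projections to the part with $p\ge0$ and with $p<0$ (open-end case: $p=j-k$, so these are the lower triangular part with the diagonal and the strictly upper triangular part). Put $\mathcal E=\lambda\sum_kE_{k+1,k}$, $\mathcal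 F=I-\alpha\mathcal E$ and $$T=\mathcal E+\sum_k b_kE_{kk}+\sum_{j=1}^m\lambda^{-j}\sum_k a_k^{(j)}E_{k,k+j}$$ (indices mod $N$ in the periodic case; $1\le k\le N-1$ in $\mathcal E$ in the open-end case). $\mathcal F$ is invertible in $\mathfrak g$. **The hierarchy $\mathrm{RTL}^{(-)}_{m+1}(\alpha)$** consists of the flows $$\dot T=T\,\mathcal C_2-\mathcal C_1T,\qquad \mathcal C_1=\tfrac12\mathcal F\,R\big(\mathcal F^{-1}f(T\mathcal F^{-1})\big),\qquad \mathcal C_2=\tfrac12R\big(f(\mathcal F^{-1}T)\,\mathcal F^{-1}\big)\mathcal F, \qquad (*)$$ where $f$ is one of the following Ad-covariant functions: 1. $f(X)=d\varphi(X)=X\,\nabla\varphi(X)$, where $\varphi$ is a smooth Ad-invariant function on an open conjugation-invariant set $U\subseteq\mathfrak g$: the gradient $\nabla\varphi(X)\in\mathfrak g$ is given by $\langle\nabla\varphi(X),M\rangle=\frac{d}{d\varepsilon}\varphi(X+\varepsilon M)|_{\varepsilon=0}$ for all $M\in\mathfrak g$, $\varphi(gXg^{-1})=\varphi(X)$ for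 invertible $g\in\mathfrak g$, and $[\nabla\varphi(X),X]=0$. (In the infinite-dimensional algebra, "open" and "smooth" refer to the restrictions to all finite-dimensional affine subspaces.) 2. (polynomial flows) $f(X)=\lambda^{qN}(I+\alpha X)^n$, $n\ge0$; 3. (rational flows) $f(X)=\lambda^{qN}(I+\alpha X)^{-n}$, $n\ge 0$, on the set where $1+\alpha b_k\ne0$ for all $k$, where in the periodic case $\sigma=-1$. Here $q\in\mathbb Z$ in the periodic case and $q=0$ in the open-end case. The "minus first" flow is the flow 3 with $f(X)=-\alpha^{-1}(I+\alpha X)^{-1}$. **Brackets.** Brackets are given by their values on the coordinates, $\{f,g\}=\sum\{x_\beta,x_\gamma\}\,\partial_\beta f\,\partial_\gamma g$, and these values by listing the nonvanishing ones, skew-symmetry being understood. (If on a short periodic lattice several listed relations, or a listed relation and the negative of one with the arguments exchanged, concern the same ordered pair of coordinates, the values are added.) The linear bracket $\{\cdot,\cdot\}_1$ is the one induced on the set of matrices $T$ by $\mathrm{PB}_1(R;\mathcal F)$, i.e. by $\{\varphi,\psi\}_1(L)=\frac12\langle[R\nabla\varphi,\nabla\psi]^{(\mathcal F)}+[\nabla\varphi,R\nabla\psi]^{(\mathcal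 F)},L\rangle$, $[X,Y]^{(\mathcal F)}=X\mathcal FY-Y\mathcal FX$. In coordinates ($i,j\ge1$): $$\{b_k,b_{k+1}\}_1=\alpha a_k^{(1)},\quad \{b_k,a_k^{(j)}\}_1=-a_k^{(j)},\quad \{a_k^{(j)},b_{k+j}\}_1=-a_k^{(j)},$$ $$\{b_k,a_{k+1}^{(j)}\}_1=\alpha a_k^{(j+1)},\quad \{a_k^{(j)},b_{k+j+1}\}_1=\alpha a_k^{(j+1)},\quad \{a_k^{(i)},a_{k+i}^{(j)}\}_1=-a_k^{(i+j)},\quad \{a_k^{(i)},a_{k+i+1}^{(j)}\}_1=\alpha a_k^{(i+j+1)}.$$ The quadratic bracket $\{\cdot,\cdot\}_2$ (that of the non-relativistic hierarchy $\mathrm{TL}_{m+1}$) is, with $a_k^{(0)}=b_k$ and $0\le i,j\le m$: $$\{a_k^{(i)},a_{k+i+1}^{(j)}\}_2=-a_k^{(i+j+1)};$$ $$\{a_k^{(i)},a_k^{(j)}\}_2=-a_k^{(i)}a_k^{(j)},\qquad \{a_k^{(j)},a_{k+j-i}^{(i)}\}_2=-a_k^{(j)}a_{k+j-i}^{(i)}\qquad(i<j);$$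 $$\{a_k^{(i)},a_{k+\ell}^{(j)}\}_2=-a_k^{(i)}a_{k+\ell}^{(j)}-a_k^{(j+\ell)}a_{k+\ell}^{(i-\ell)}\qquad(i\le j,\ 1\le\ell\le i);$$ $$\{a_k^{(j)},a_{k+\ell}^{(i)}\}_2=-a_k^{(j)}a_{k+\ell}^{(i)}-a_k^{(i+\ell)}a_{k+\ell}^{(j-\ell)}\qquad(i\le j,\ j-i+1\le\ell\le j)$$ (for $i=j$ the last two lines are the same relation, counted once). **Theorem.** In the periodic and in the open-end case: (a) $\{\cdot,\cdot\}_1$ and $\{\cdot,\cdot\}_2$ are compatible Poisson brackets: both, and all their linear combinations, are Poisson brackets on the smooth functions on the phase space; the coordinate formulas for $\{\cdot,\cdot\}_1$ are those of the bracket induced by $\mathrm{PB}_1(R;\mathcal F)$. (b) Every flow of the hierarchy $\mathrm{RTL}^{(-)}_{m+1}(\alpha)$ is Hamiltonian with respect to $\{\cdot,\cdot\}_2$: the right-hand side of $(*)$ is tangent to the set of the matrices $T$, and $(*)$ is the equation $\dot x=\{\mathrm H,x\}_2$ with a smooth function $\mathrm H$ (on the open set $\{T\mathcal F^{-1}\in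 U\}$ for flows 1, on the whole phase space for flows 2, on the set $\{1+\alpha b_k\neq0\ \forall k\}$ for flows 3). For the flows 1 one has $\mathrm H=\varphi(T\mathcal F^{-1})$. (c) In particular, on the set where all $1+\alpha b_k\ne0$, the "minus first" flow is $$\dot b_k=\frac{a_k^{(1)}}{1+\alpha b_{k+1}}-\frac{a_{k-1}^{(1)}}{1+\alpha b_{k-1}},$$ $$\dot a_k^{(j)}=a_k^{(j)}\Big(\frac{b_{k+j}}{1+\alpha b_{k+j}}-\frac{b_k}{1+\alpha b_k}\Big)+\Big(\frac{a_k^{(j+1)}}{1+\alpha b_{k+j+1}}-\frac{a_{k-1}^{(j+1)}}{1+\alpha b_{k-1}}\Big)\qquad(1\le j\le m),$$ and it is Hamiltonian with respect to $\{\cdot,\cdot\}_2$ with the Hamilton function $-\alpha\mathrm H_0=\alpha^{-1}\sum_{k=1}^N\log|1+\alpha b_k|$ (which is $\alpha^{-1}\sum_{k}\log(1+\alpha b_k)$ where all $1+\alpha b_k>0$). -/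

import Mathlib

open scoped ContDiff

namespace RTL

noncomputable section

/-! ### Brackets on a coordinate space `ι → ℝ` -/

section Brackets

variable {ι : Type} [Fintype ι] [DecidableEq ι]

/-- Partial derivative of `f` at `x` with respect to the coordinate `β`. -/
def pd (f : (ι → ℝ) → ℝ) (x : ι → ℝ) (β : ι) : ℝ := fderiv ℝ f x (Pi.single β 1)

/-- The bracket `{f, g} = ∑ {x_β, x_γ} ∂_β f ∂_γ g` whose values on the coordinate functions are
`{x_β, x_γ} = P β γ`. -/
def bracket (P : ι → ι → (ι → ℝ) → ℝ) (f g : (ι → ℝ) → ℝ) : (ι → ℝ) → ℝ :=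
  fun x => ∑ β, ∑ γ, P β γ x * pd f x β * pd g x γ

/-- `B` is a Poisson bracket on the smooth functions on `ι → ℝ`. -/
structure IsPoissonBracket
    (B : ((ι → ℝ) → ℝ) → ((ι → ℝ) → ℝ) → ((ι → ℝ) → ℝ)) : Prop where
  smooth : ∀ f g, ContDiff ℝ ∞ f → ContDiff ℝ ∞ g → ContDiff ℝ ∞ (B f g)
  skew : ∀ f g, ContDiff ℝ ∞ f → ContDiff ℝ ∞ g → ∀ x, B f g x = - B g f x
  linear : ∀ f g h, ContDiff ℝ ∞ f → ContDiff ℝ ∞ g → ContDiff ℝ ∞ h → ∀ (c : ℝ) (x : ι → ℝ),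
    B (fun y => c * f y + g y) h x = c * B f h x + B g h x
  leibniz : ∀ f g h, ContDiff ℝ ∞ f → ContDiff ℝ ∞ g → ContDiff ℝ ∞ h → ∀ x,
    B (fun y => f y * g y) h x = f x * B g h x + B f h x * g x
  jacobi : ∀ f g h, ContDiff ℝ ∞ f → ContDiff ℝ ∞ g → ContDiff ℝ ∞ h → ∀ x,
    B f (B g h) x + B g (B h f) x + B h (B f g) x = 0

/-- Two brackets are compatible if both are Poisson and so is each of their linear
combinations. -/
def AreCompatible (B₁ B₂ : ((ι → ℝ) → ℝ) → ((ι → ℝ) → ℝ) → ((ι → ℝ) → ℝ)) : Prop :=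
  IsPoissonBracket B₁ ∧ IsPoissonBracket B₂ ∧
    ∀ c₁ c₂ : ℝ, IsPoissonBracket (fun f g x => c₁ * B₁ f g x + c₂ * B₂ f g x)

/-- The vector field `v` is, on the open set `D`, the Hamiltonian vector field
`ẋ = {H, x}` of the smooth function `H`. -/
def IsHamiltonianOn (P : ι → ι → (ι → ℝ) → ℝ) (D : Set (ι → ℝ)) (H : (ι → ℝ) → ℝ)
    (v : (ι → ℝ) → (ι → ℝ)) : Prop :=
  IsOpen D ∧ ContDiffOn ℝ ∞ H D ∧
    ∀ x ∈ D, ∀ β, v x β = bracket P H (fun y => y β) x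

/-- The evolution equation `dT/dt = V` of an affine Lax matrix
`T(x) = T₀ + ∑ x_β • e_β` is, on the open set `D`, the Hamiltonian equation `ẋ = {H, x}`
of the smooth function `H`: the value of `V` at `x` is `∑ ẋ_β • e_β`. -/
def IsHamiltonianLaxOn {A : Type} [Ring A] [Algebra ℝ A] (P : ι → ι → (ι → ℝ) → ℝ) (e : ι → A)
    (D : Set (ι → ℝ)) (H : (ι → ℝ) → ℝ) (V : (ι → ℝ) → A) : Prop :=
  IsOpen D ∧ ContDiffOn ℝ ∞ H D ∧
    ∀ x ∈ D, V x = ∑ β, bracket P H (fun y => y β) x • e β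

end Brackets

/-! ### Fields on the lattice, the two brackets and the "minus first" flow -/

/-- A labelling of the coordinates: the coordinate `β` is `a_k^{(j)}` with `j = lev β`,
`k = site β`; level `0` is the field `b`. -/
structure Grid (ι K : Type) where
  lev : ι → ℕ
  site : ι → K

section Fields

variable {ι K : Type} [Fintype ι] [DecidableEq ι] [AddGroupWithOne K] [DecidableEq K]

/-- `a_k^{(j)}`, with `a_k^{(0)} = b_k`; it is `0` if there is no such coordinate
(for instance for `j > m`, or beyond the ends of an open lattice). -/
def Grid.field (G : Grid ι K) (x : ι → ℝ) (j : ℕ) (k : K) : ℝ :=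
  ∑ β, if G.lev β = j ∧ G.site β = k then x β else 0

/-- The listed value of the quadratic bracket `{a_k^{(i)}, a_{k+ℓ}^{(j)}}₂`, `ℓ ≥ 0`. -/
def quadTerm (a : ℕ → K → ℝ) (i : ℕ) (k : K) (j ℓ : ℕ) : ℝ :=
  (if ℓ = i + 1 then - a (i + j + 1) k else 0)
  + (if (i < j ∧ ℓ = 0) ∨ (j < i ∧ ℓ + j = i) then - (a i k * a j (k + ℓ)) else 0)
  + (if (i ≤ j ∧ 1 ≤ ℓ ∧ ℓ ≤ i) ∨ (j ≤ i ∧ i + 1 ≤ ℓ + j ∧ ℓ ≤ i) then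
      - (a i k * a j (k + ℓ)) - a (j + ℓ) k * a (i - ℓ) (k + ℓ) else 0)

/-- The listed value of the linear bracket `{a_k^{(i)}, a_{k+ℓ}^{(j)}}₁`, `ℓ ≥ 0`. -/
def linTerm (α : ℝ) (a : ℕ → K → ℝ) (i : ℕ) (k : K) (j ℓ : ℕ) : ℝ :=
  (if ℓ = i ∧ (i ≠ 0 ∨ j ≠ 0) then - a (i + j) k else 0)
  + (if ℓ = i + 1 then α * a (i + j + 1) k else 0)

/-- The bracket of the coordinates `β`, `γ`: the sum of all listed values for `(β, γ)` minus the
sum of all listed values for `(γ, β)`.  (On a short periodic lattice several listed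
relations may concern the same pair; their contributions add up.) -/
def Grid.structFn (G : Grid ι K) (m : ℕ) (t : (ℕ → K → ℝ) → ℕ → K → ℕ → ℕ → ℝ)
    (β γ : ι) (x : ι → ℝ) : ℝ :=
  ∑ ℓ ∈ Finset.range (m + 2),
    ((if G.site γ = G.site β + ℓ then t (G.field x) (G.lev β) (G.site β) (G.lev γ) ℓ else 0)
    - (if G.site β = G.site γ + ℓ then t (G.field x) (G.lev γ) (G.site γ) (G.lev β) ℓ else 0))

/-- The quadratic bracket `{·,·}₂` on coordinates. -/
def Grid.quad (G : Grid ι K) (m : ℕ) : ι → ι → (ι → ℝ) → ℝ := G.structFn m quadTerm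

/-- The linear bracket `{·,·}₁` on coordinates. -/
def Grid.lin (G : Grid ι K) (m : ℕ) (α : ℝ) : ι → ι → (ι → ℝ) → ℝ := G.structFn m (linTerm α)

/-- The set where no `1 + α b_k` vanishes. -/
def Grid.regular (G : Grid ι K) (α : ℝ) : Set (ι → ℝ) := {x | ∀ k, 1 + α * G.field x 0 k ≠ 0}

/-- The right-hand side of the "minus first" flow. -/
def Grid.minusFirst (G : Grid ι K) (α : ℝ) (x : ι → ℝ) (β : ι) : ℝ :=
  let a := G.field x
  let b := a 0
  let k := G.site β
  let j := G.lev β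
  if j = 0 then
    a 1 k / (1 + α * b (k + 1)) - a 1 (k - 1) / (1 + α * b (k - 1))
  else
    a j k * (b (k + j) / (1 + α * b (k + j)) - b k / (1 + α * b k))
      + (a (j + 1) k / (1 + α * b (k + j + 1)) - a (j + 1) (k - 1) / (1 + α * b (k - 1)))

/-- `-α H₀ = α⁻¹ ∑_k log (1 + α b_k)`. -/
def Grid.logHam (G : Grid ι K) (α : ℝ) (x : ι → ℝ) : ℝ :=
  α⁻¹ * ∑ β, if G.lev β = 0 then Real.log (1 + α * x β) else 0

end Fields

/-! ### Functions on an algebra, and the Lax equations -/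

section Algebra

variable {A : Type} [Ring A] [Algebra ℝ A]

/-- `U` meets every finite-dimensional affine subspace of `A` in an open set. -/
def FinOpen (U : Set A) : Prop :=
  ∀ (κ : Type) [Fintype κ] (c : A) (M : κ → A), IsOpen {s : κ → ℝ | c + ∑ i, s i • M i ∈ U}

/-- `φ` is smooth on the intersection of `U` with every finite-dimensional affine subspace. -/
def FinSmoothOn (φ : A → ℝ) (U : Set A) : Prop :=
  ∀ (κ : Type) [Fintype κ] (c : A) (M : κ → A),
    ContDiffOn ℝ ∞ (fun s : κ → ℝ => φ (c + ∑ i, s i • M i)) {s | c + ∑ i, s i • M i ∈ U}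

/-- `φ` is a smooth Ad-invariant function on the open conjugation-invariant set `U ⊆ A`, with
gradient `grad` relative to the scalar product `pair`. -/
structure IsAdInvariant (pair : A → A → ℝ) (U : Set A) (φ : A → ℝ) (grad : A → A) : Prop where
  isOpen : FinOpen U
  smooth : FinSmoothOn φ U
  gradient : ∀ X ∈ U, ∀ M, HasDerivAt (fun ε : ℝ => φ (X + ε • M)) (pair (grad X) M) 0
  conj_mem : ∀ (g : Aˣ), ∀ X ∈ U, ↑g * X * ↑g⁻¹ ∈ U
  conj_eq : ∀ (g : Aˣ), ∀ X ∈ U, φ (↑g * X * ↑g⁻¹) = φ X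
  commutes : ∀ X ∈ U, grad X * X = X * grad X

/-- The right-hand side of `dT/dt = T C₂ - C₁ T`, where
`C₁ = ½ F R(F⁻¹ f(T F⁻¹))` and `C₂ = ½ R(f(F⁻¹ T) F⁻¹) F`. -/
def relLax (R : A → A) (F : A) (f : A → A) (T : A) : A :=
  let C₁ := (1 / 2 : ℝ) • (F * R (Ring.inverse F * f (T * Ring.inverse F)))
  let C₂ := (1 / 2 : ℝ) • (R (f (Ring.inverse F * T) * Ring.inverse F) * F)
  T * C₂ - C₁ * T

/-- The Lie bracket `X F Y - Y F X`. -/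
def brF (F X Y : A) : A := X * F * Y - Y * F * X

/-- The value at `L` of the linear r-matrix bracket `PB₁(R; F)` of two functions whose gradients
at `L` are `X` and `Y`. -/
def rLin (pair : A → A → ℝ) (R : A → A) (F X Y L : A) : ℝ :=
  (1 / 2) * pair (brF F (R X) Y + brF F X (R Y)) L

end Algebra

/-! ### Open-end case: `gl(N)` -/

section OpenEnd

variable (N m : ℕ)

/-- Labels of the coordinates `a_k^{(j)}`, `0 ≤ j ≤ m`, `1 ≤ k ≤ N - j`; the second component of
a label is `k - 1`. -/
abbrev OpenIdx : Type := {p : Fin (m + 1) × Fin N // p.2.val + p.1.val < N}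

def openGrid : Grid (OpenIdx N m) ℤ where
  lev β := β.1.1.val
  site β := (β.1.2.val : ℤ) + 1

/-- `E = ∑ E_{k+1,k}`. -/
def openE : Matrix (Fin N) (Fin N) ℝ := Matrix.of fun j k => if j.val = k.val + 1 then 1 else 0

/-- `F = I - α E`. -/
def openF (α : ℝ) : Matrix (Fin N) (Fin N) ℝ := 1 - α • openE N

variable {N m}

/-- The matrix `E_{k,k+j}` at which `a_k^{(j)}` stands. -/
def openGen (β : OpenIdx N m) : Matrix (Fin N) (Fin N) ℝ :=
  Matrix.single β.1.2 ⟨β.1.2.val + β.1.1.val, β.2⟩ 1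

/-- The gradient `E_{k+j,k}` of the coordinate function `a_k^{(j)}`. -/
def openDual (β : OpenIdx N m) : Matrix (Fin N) (Fin N) ℝ :=
  Matrix.single ⟨β.1.2.val + β.1.1.val, β.2⟩ β.1.2 1

/-- The Lax matrix `T`. -/
def openT (x : OpenIdx N m → ℝ) : Matrix (Fin N) (Fin N) ℝ :=
  openE N + ∑ β, x β • openGen β

/-- The scalar product `tr (X Y)`. -/
def openPair (X Y : Matrix (Fin N) (Fin N) ℝ) : ℝ := (X * Y).trace

/-- `R = π₊ - π₋`, where `π₊` is the projection to the lower triangular matrices (with diagonal)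
and `π₋` the projection to the strictly upper triangular ones. -/
def openR (X : Matrix (Fin N) (Fin N) ℝ) : Matrix (Fin N) (Fin N) ℝ :=
  Matrix.of fun j k => if k ≤ j then X j k else - X j k

end OpenEnd

/-! ### Periodic case: the twisted loop algebra

For `σ = 1` loops are Laurent series in `λ`, for `σ = -1` they are Laurent series in `λ⁻¹`. The
formal variable is `t = λ ^ σ`, so that the coefficient at `t ^ n` is the coefficient at
`λ ^ (σ n)`. -/

section Periodic

/-- Laurent series as a real algebra, with coefficientwise scalar multiplication. -/
instance laurentAlgebra : Algebra ℝ (LaurentSeries ℝ) := HahnSeries.instAlgebra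

variable (N : ℕ) [NeZero N] (σ : ℤˣ)

/-- Matrices `X(λ) = ∑_p λ^p ∑_{j - k ≡ p (mod N)} x_{jk}^{(p)} E_{jk}`. -/
def loopAlg : Subalgebra ℝ (Matrix (ZMod N) (ZMod N) (LaurentSeries ℝ)) where
  carrier := {X | ∀ (n : ℤ) (j k : ZMod N), (X j k).coeff n ≠ 0 →
    (((σ : ℤ) * n : ℤ) : ZMod N) = j - k}
  mul_mem' := by
    intro X Y hX hY n j k h
    rw [Matrix.mul_apply, HahnSeries.coeff_sum] at h
    obtain ⟨l, -, hl⟩ := Finset.exists_ne_zero_of_sum_ne_zero h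
    rw [HahnSeries.coeff_mul] at hl
    obtain ⟨⟨p, q⟩, hpq, hne⟩ := Finset.exists_ne_zero_of_sum_ne_zero hl
    have h1 := hX p j l (left_ne_zero_of_mul hne)
    have h2 := hY q l k (right_ne_zero_of_mul hne)
    have h3 : p + q = n := (Finset.mem_antidiagonal.mp hpq).2.2
    rw [← h3, mul_add, Int.cast_add, h1, h2]
    ring
  add_mem' := by
    intro X Y hX hY n j k h
    by_cases hx : (X j k).coeff n = 0
    · refine hY n j k fun hy => h ?_
      simp [hx, hy]
    · exact hX n j k hx
  algebraMap_mem' := by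
    intro r n j k h
    rw [Matrix.algebraMap_matrix_apply] at h
    split_ifs at h with hjk
    · subst hjk
      rw [HahnSeries.algebraMap_apply, HahnSeries.C_apply] at h
      have hn : n = 0 := by
        by_contra hn
        exact h (HahnSeries.coeff_single_of_ne hn)
      simp [hn]
    · simp at h

variable {N}

/-- The loop `c λ^p E_{jk}`, `p ≡ j - k (mod N)`. -/
def loopUnit (p : ℤ) (j k : ZMod N) (h : (p : ZMod N) = j - k) : loopAlg N σ :=
  ⟨Matrix.single j k (HahnSeries.single ((σ : ℤ) * p) 1), by
    intro n j' k' hne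
    rw [Matrix.single_apply] at hne
    split_ifs at hne with hjk
    · obtain ⟨rfl, rfl⟩ := hjk
      have hn : n = (σ : ℤ) * p := by
        by_contra hn
        exact hne (HahnSeries.coeff_single_of_ne hn)
      rw [hn, ← mul_assoc, ← Units.val_mul, Int.units_mul_self, Units.val_one, one_mul, h]
    · simp at hne⟩

variable (N) in
/-- The central loop `λ^{qN} I`. -/
def loopShift (q : ℤ) : loopAlg N σ :=
  ∑ k : ZMod N, loopUnit σ (q * N) k k (by simp)

variable (N) in
/-- `E = λ ∑ E_{k+1,k}`. -/
def loopE : loopAlg N σ := ∑ k : ZMod N, loopUnit σ 1 (k + 1) k (by simp)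

variable (N) in
/-- `F = I - α E`. -/
def loopF (α : ℝ) : loopAlg N σ := 1 - α • loopE N σ

/-- The scalar product `tr (X(λ) Y(λ))₀`. -/
def loopPair (X Y : loopAlg N σ) : ℝ := ((X * Y).1.trace).coeff 0

/-- Change of sign of the coefficients at negative powers of `λ`. -/
def flipNeg (f : LaurentSeries ℝ) : LaurentSeries ℝ where
  coeff n := if 0 ≤ (σ : ℤ) * n then f.coeff n else - f.coeff n
  isPWO_support' := f.isPWO_support.mono (by
    intro n hn hf
    apply hn
    simp [hf])

/-- `R = π₊ - π₋`, where `π₊`, `π₋` are the projections to the nonnegative and to the negative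
powers of `λ`. -/
def loopR (X : loopAlg N σ) : loopAlg N σ :=
  ⟨Matrix.of fun j k => flipNeg σ (X.1 j k), by
    intro n j k h
    refine X.2 n j k fun h0 => h ?_
    simp [flipNeg, h0]⟩

variable {m : ℕ}

/-- Labels of the coordinates `a_k^{(j)}`, `0 ≤ j ≤ m`, `k` modulo `N`. -/
abbrev PerIdx (N m : ℕ) : Type := Fin (m + 1) × ZMod N

variable (N m) in
def perGrid : Grid (PerIdx N m) (ZMod N) where
  lev β := β.1.val
  site β := β.2

/-- The loop `λ^{-j} E_{k,k+j}` at which `a_k^{(j)}` stands. -/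
def loopGen (β : PerIdx N m) : loopAlg N σ :=
  loopUnit σ (-(β.1.val : ℤ)) β.2 (β.2 + (β.1.val : ZMod N)) (by push_cast; ring)

/-- The gradient `λ^j E_{k+j,k}` of the coordinate function `a_k^{(j)}`. -/
def loopDual (β : PerIdx N m) : loopAlg N σ :=
  loopUnit σ (β.1.val : ℤ) (β.2 + (β.1.val : ZMod N)) β.2 (by push_cast; ring)

/-- The Lax matrix `T`. -/
def loopT (x : PerIdx N m → ℝ) : loopAlg N σ := loopE N σ + ∑ β, x β • loopGen σ β

end Periodic

end

end RTL

set_option linter.unusedSectionVars false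

namespace RTL

noncomputable section

section

/-! ### Partial derivatives on a coordinate space. -/

section PartialDerivatives

variable {ι : Type} [Fintype ι] [DecidableEq ι] {f g : (ι → ℝ) → ℝ} {x : ι → ℝ}

/-! Both cases are unrolled to matrices with rows and columns in ℤ. The coordinate a_k^{(j)} becomes
the entry (k, k + j), and λ^p becomes the p-th diagonal below the main one. Periodic objects are the
matrices invariant under simultaneous translation of both indices by N, open-end objects those
supported on {1, …, N}². `Lattice` and `Model` record what is common, so that everything is proved
once.

Brackets. The quadratic bracket is the restriction of a bracket `quadBr` on all matrix entries, in
which {L_pq, L_rs} combines L_rq L_ps and L_pq L_rs with coefficients depending only on the order of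
the indices. Its Jacobi identity (`doubleBr_jacobi`) reduces to an identity between signs
(`halfSign_cyclic`), a scalar form of the modified Yang-Baxter equation. The brackets with all
entries of a band matrix that are not coordinates vanish, including those with the constant
subdiagonal (`IsBand.quadBr_eq_zero`), so the matrices T form a Poisson submanifold. Replacing T by
T + cF turns {·,·}₂ into {·,·}₂ + c{·,·}₁ (`quadBr_shift`), and T + cF is a band matrix of the same
kind. Hence the Jacobi identity holds along the whole pencil, and three values of c give both
Poisson properties and compatibility. In the periodic case a bracket is a sum over lifts to ℤ with
one lift kept fixed; translation invariance lets the three cyclic terms of the Jacobi identity be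
compared.

Flows. Suppose T X + S = F Y and X T + S = Y F, where S and its part of negative degree commute with
T. Then the Lax vector field built from Y is the Hamiltonian field of any H with differential ⟨X,
dT⟩ (`Model.lax_eq_sum`, resting on `Model.U_lax`). For an Ad-invariant φ take S = 0 and X =
F⁻¹∇φ(TF⁻¹). For the explicit flows put B = F + αT and Θ = BF⁻¹, and let S be the central loop
λ^{qN}. Then X = αF⁻¹SQ with (Θ - 1)Q = W - 1, where W is a power of Θ or of Θ⁻¹, and it remains to
integrate the covector X. Positive powers of Θ or Θ⁻¹ integrate to traces of powers. The term S B⁻¹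
needs a logarithm: for q = 0 it is ∑ log |1 + αb_k|, and for q ≠ 0 a primitive is supplied by the
derivation that multiplies each entry by its degree (`Model.exists_log`). B is upper triangular with
diagonal 1 + αb_k, which explains the domain of the rational flows and the choice σ = -1. -/

theorem pd_add (hf : DifferentiableAt ℝ f x) (hg : DifferentiableAt ℝ g x) (β : ι) :
    pd (fun y => f y + g y) x β = pd f x β + pd g x β := by
  simp only [pd]
  rw [fderiv_fun_add hf hg]
  rfl

theorem pd_mul (hf : DifferentiableAt ℝ f x) (hg : DifferentiableAt ℝ g x) (β : ι) :
    pd (fun y => f y * g y) x β = pd f x β * g x + f x * pd g x β := by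
  simp only [pd]
  rw [fderiv_fun_mul hf hg]
  simp only [add_apply, smul_apply, smul_eq_mul]
  ring

theorem pd_const (c : ℝ) (x : ι → ℝ) (β : ι) : pd (fun _ => c) x β = 0 := by
  simp [pd]

theorem pd_const_mul (hf : DifferentiableAt ℝ f x) (c : ℝ) (β : ι) :
    pd (fun y => c * f y) x β = c * pd f x β := by
  rw [pd_mul (differentiableAt_const c) hf, pd_const]
  ring

theorem pd_sum {κ : Type*} {s : Finset κ} {F : κ → (ι → ℝ) → ℝ}
    (h : ∀ i ∈ s, DifferentiableAt ℝ (F i) x) (β : ι) :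
    pd (fun y => ∑ i ∈ s, F i y) x β = ∑ i ∈ s, pd (F i) x β := by
  simp only [pd]
  rw [fderiv_fun_sum h, sum_apply]

theorem pd_congr (h : f =ᶠ[nhds x] g) (β : ι) : pd f x β = pd g x β := by
  simp only [pd, h.fderiv_eq]

theorem pd_coord (γ : ι) (x : ι → ℝ) (β : ι) :
    pd (fun y => y γ) x β = if β = γ then 1 else 0 := by
  have h : HasFDerivAt (fun y : ι → ℝ => y γ) (ContinuousLinearMap.proj (R := ℝ) (φ := fun _ => ℝ) γ) x :=
    (ContinuousLinearMap.proj (R := ℝ) (φ := fun _ : ι => ℝ) γ).hasFDerivAt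
  simp only [pd, h.fderiv, ContinuousLinearMap.proj_apply, Pi.single_apply, eq_comm]

/-- The gradient of an Ad-invariant function is given only through derivatives along lines. Since
differentiability is known separately, these determine the partial derivatives. -/
theorem pd_eq_of_hasDerivAt (hf : DifferentiableAt ℝ f x) {β : ι} {c : ℝ}
    (h : HasDerivAt (fun ε : ℝ => f (x + ε • Pi.single β 1)) c 0) : pd f x β = c := by
  have h1 : HasFDerivAt f (fderiv ℝ f x) (x + (0 : ℝ) • Pi.single β 1) := by
    simpa using hf.hasFDerivAt
  have h2 : HasDerivAt (fun ε : ℝ => x + ε • (Pi.single β 1 : ι → ℝ)) (Pi.single β 1) 0 := by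
    simpa using ((hasDerivAt_id (0 : ℝ)).smul_const (Pi.single β 1 : ι → ℝ)).const_add x
  exact (h1.comp_hasDerivAt 0 h2).unique h

theorem contDiff_pd (hf : ContDiff ℝ ∞ f) (β : ι) : ContDiff ℝ ∞ (fun x => pd f x β) :=
  (hf.fderiv_right (m := ∞) (by simp)).clm_apply contDiff_const

theorem pd_pd_comm (hf : ContDiff ℝ ∞ f) (x : ι → ℝ) (β γ : ι) :
    pd (fun y => pd f y β) x γ = pd (fun y => pd f y γ) x β := by
  have hd : DifferentiableAt ℝ (fderiv ℝ f) x :=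
    ((hf.fderiv_right (m := ∞) (by simp)).differentiable (by simp)) x
  have h : ∀ v w : ι → ℝ, fderiv ℝ (fun y => fderiv ℝ f y v) x w = fderiv ℝ (fderiv ℝ f) x w v := by
    intro v w
    rw [fderiv_clm_apply hd (differentiableAt_const v)]
    simp
  have hs : IsSymmSndFDerivAt ℝ f x := by
    refine hf.contDiffAt.isSymmSndFDerivAt ?_
    rw [minSmoothness_of_isRCLikeNormedField]
    exact WithTop.coe_le_coe.2 (le_top : (2 : ℕ∞) ≤ ⊤)
  simp only [pd]
  rw [h, h]
  exact hs _ _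

end PartialDerivatives

/-! ### The Jacobi identity of a bivector field from its values on coordinates. -/

section Jacobi

variable {ι : Type} [Fintype ι]

/-- The contribution of the second derivatives `G` of the middle function to `{f, {g, h}}`. -/
def hessianTerm (P : ι → ι → ℝ) (f : ι → ℝ) (G : ι → ι → ℝ) (h : ι → ℝ) : ℝ :=
  ∑ β, ∑ γ, ∑ δ, ∑ ε, P β γ * f β * P δ ε * G γ δ * h ε

/-- Reading the chain β, γ, δ, ε backwards changes the sign of both factors `P` and leaves the
symmetric Hessian unchanged. -/
theorem hessianTerm_symm {P : ι → ι → ℝ} (hP : ∀ β γ, P β γ = - P γ β) (f : ι → ℝ)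
    {G : ι → ι → ℝ} (hG : ∀ β γ, G β γ = G γ β) (h : ι → ℝ) :
    hessianTerm P f G h = hessianTerm P h G f := by
  unfold hessianTerm
  calc _ = ∑ γ, ∑ δ, ∑ β, ∑ ε, P β γ * f β * P δ ε * G γ δ * h ε := by
        rw [Finset.sum_comm]
        exact Finset.sum_congr rfl fun γ _ => Finset.sum_comm
    _ = ∑ δ, ∑ γ, ∑ ε, ∑ β, P β γ * f β * P δ ε * G γ δ * h ε := by
        rw [Finset.sum_comm]
        exact Finset.sum_congr rfl fun γ _ => Finset.sum_congr rfl fun δ _ => Finset.sum_comm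
    _ = ∑ δ, ∑ ε, ∑ γ, ∑ β, P β γ * f β * P δ ε * G γ δ * h ε :=
        Finset.sum_congr rfl fun δ _ => Finset.sum_comm
    _ = ∑ ε, ∑ δ, ∑ γ, ∑ β, P β γ * f β * P δ ε * G γ δ * h ε := Finset.sum_comm
    _ = _ := by
        refine Finset.sum_congr rfl fun ε _ => Finset.sum_congr rfl fun δ _ =>
          Finset.sum_congr rfl fun γ _ => Finset.sum_congr rfl fun β _ => ?_
        rw [hP β γ, hP δ ε, hG γ δ]
        ring

/-- Here `D γ δ ε` stands for ∂_γ P_δε. The terms with derivatives of P collect into the coordinate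
Jacobiator, and the six Hessian terms cancel in pairs by `hessianTerm_symm`. -/
theorem cyclic_sum_eq_zero {P : ι → ι → ℝ} (hP : ∀ β γ, P β γ = - P γ β) {D : ι → ι → ι → ℝ}
    (hJ : ∀ β γ ε, ∑ δ, (P β δ * D δ γ ε + P γ δ * D δ ε β + P ε δ * D δ β γ) = 0)
    (f g h : ι → ℝ) {F G H : ι → ι → ℝ} (hF : ∀ β γ, F β γ = F γ β)
    (hG : ∀ β γ, G β γ = G γ β) (hH : ∀ β γ, H β γ = H γ β) :
    (∑ β, ∑ γ, P β γ * f β * ∑ δ, ∑ ε, (D γ δ ε * g δ * h ε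
        + P δ ε * G γ δ * h ε + P δ ε * g δ * H γ ε))
    + (∑ β, ∑ γ, P β γ * g β * ∑ δ, ∑ ε, (D γ δ ε * h δ * f ε
        + P δ ε * H γ δ * f ε + P δ ε * h δ * F γ ε))
    + (∑ β, ∑ γ, P β γ * h β * ∑ δ, ∑ ε, (D γ δ ε * f δ * g ε
        + P δ ε * F γ δ * g ε + P δ ε * f δ * G γ ε)) = 0 := by
  have key : ∀ (f g h : ι → ℝ) (G H : ι → ι → ℝ),
      (∑ β, ∑ γ, P β γ * f β * ∑ δ, ∑ ε, (D γ δ ε * g δ * h ε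
        + P δ ε * G γ δ * h ε + P δ ε * g δ * H γ ε))
      = (∑ β, ∑ δ, ∑ ε, f β * g δ * h ε * ∑ γ, P β γ * D γ δ ε)
        + hessianTerm P f G h - hessianTerm P f H g := by
    intro f g h G H
    have e1 : (∑ β, ∑ δ, ∑ ε, f β * g δ * h ε * ∑ γ, P β γ * D γ δ ε)
        = ∑ β, ∑ γ, ∑ δ, ∑ ε, P β γ * f β * (D γ δ ε * g δ * h ε) := by
      refine Finset.sum_congr rfl fun β _ => ?_
      rw [Finset.sum_comm (f := fun γ δ => ∑ ε, P β γ * f β * (D γ δ ε * g δ * h ε))]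
      refine Finset.sum_congr rfl fun δ _ => ?_
      rw [Finset.sum_comm]
      refine Finset.sum_congr rfl fun ε _ => ?_
      rw [Finset.mul_sum]
      exact Finset.sum_congr rfl fun γ _ => by ring
    have e2 : hessianTerm P f H g
        = ∑ β, ∑ γ, ∑ δ, ∑ ε, - (P β γ * f β * (P δ ε * g δ * H γ ε)) := by
      refine Finset.sum_congr rfl fun β _ => Finset.sum_congr rfl fun γ _ => ?_
      rw [Finset.sum_comm]
      refine Finset.sum_congr rfl fun ε _ => Finset.sum_congr rfl fun δ _ => ?_
      rw [hP δ ε]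
      ring
    rw [e1, e2, hessianTerm]
    simp only [Finset.mul_sum, ← Finset.sum_add_distrib, ← Finset.sum_sub_distrib]
    refine Finset.sum_congr rfl fun β _ => Finset.sum_congr rfl fun γ _ =>
      Finset.sum_congr rfl fun δ _ => Finset.sum_congr rfl fun ε _ => ?_
    ring
  rw [key, key, key]
  have c1 : (∑ β, ∑ δ, ∑ ε, g β * h δ * f ε * ∑ γ, P β γ * D γ δ ε)
      = ∑ β, ∑ δ, ∑ ε, f β * g δ * h ε * ∑ γ, P δ γ * D γ ε β := by
    rw [show (∑ β, ∑ δ, ∑ ε, g β * h δ * f ε * ∑ γ, P β γ * D γ δ ε)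
      = ∑ β, ∑ ε, ∑ δ, g β * h δ * f ε * ∑ γ, P β γ * D γ δ ε from
      Finset.sum_congr rfl fun β _ => Finset.sum_comm, Finset.sum_comm]
    exact Finset.sum_congr rfl fun β _ => Finset.sum_congr rfl fun γ _ =>
      Finset.sum_congr rfl fun δ _ => by ring
  have c2 : (∑ β, ∑ δ, ∑ ε, h β * f δ * g ε * ∑ γ, P β γ * D γ δ ε)
      = ∑ β, ∑ δ, ∑ ε, f β * g δ * h ε * ∑ γ, P ε γ * D γ β δ := by
    rw [Finset.sum_comm]
    refine Finset.sum_congr rfl fun β _ => ?_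
    rw [Finset.sum_comm]
    exact Finset.sum_congr rfl fun γ _ => Finset.sum_congr rfl fun δ _ => by ring
  have c3 : (∑ β, ∑ δ, ∑ ε, f β * g δ * h ε * ∑ γ, P β γ * D γ δ ε)
      + (∑ β, ∑ δ, ∑ ε, f β * g δ * h ε * ∑ γ, P δ γ * D γ ε β)
      + (∑ β, ∑ δ, ∑ ε, f β * g δ * h ε * ∑ γ, P ε γ * D γ β δ) = 0 := by
    simp only [← Finset.sum_add_distrib, ← mul_add]
    refine Finset.sum_eq_zero fun β _ => Finset.sum_eq_zero fun δ _ =>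
      Finset.sum_eq_zero fun ε _ => ?_
    rw [hJ, mul_zero]
  rw [c1, c2]
  rw [hessianTerm_symm hP h hF, hessianTerm_symm hP h hG, hessianTerm_symm hP g hH]
  linarith

end Jacobi

section Poisson

variable {ι : Type} [Fintype ι] [DecidableEq ι]

/-- The coordinate Jacobiator of two bivector fields. -/
def jacobiator (P Q : ι → ι → (ι → ℝ) → ℝ) (β γ ε : ι) (x : ι → ℝ) : ℝ :=
  ∑ δ, (P β δ x * pd (Q γ ε) x δ + P γ δ x * pd (Q ε β) x δ + P ε δ x * pd (Q β γ) x δ)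

theorem isPoissonBracket_bracket {P : ι → ι → (ι → ℝ) → ℝ} (hs : ∀ β γ, ContDiff ℝ ∞ (P β γ))
    (hP : ∀ β γ x, P β γ x = - P γ β x) (hJ : ∀ β γ ε x, jacobiator P P β γ ε x = 0) :
    IsPoissonBracket (bracket P) := by
  have dif : ∀ {f : (ι → ℝ) → ℝ}, ContDiff ℝ ∞ f → ∀ x, DifferentiableAt ℝ f x :=
    fun hf x => hf.differentiable (by simp) x
  refine ⟨?_, ?_, ?_, ?_, ?_⟩
  · intro f g hf hg
    exact ContDiff.sum fun β _ => ContDiff.sum fun γ _ =>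
      ((hs β γ).mul (contDiff_pd hf β)).mul (contDiff_pd hg γ)
  · intro f g _ _ x
    simp only [bracket]
    rw [Finset.sum_comm, ← Finset.sum_neg_distrib]
    refine Finset.sum_congr rfl fun β _ => ?_
    rw [← Finset.sum_neg_distrib]
    refine Finset.sum_congr rfl fun γ _ => ?_
    rw [hP]
    ring
  · intro f g h hf hg hh c x
    simp only [bracket, Finset.mul_sum, ← Finset.sum_add_distrib]
    refine Finset.sum_congr rfl fun β _ => Finset.sum_congr rfl fun γ _ => ?_
    rw [pd_add ((dif hf x).const_mul c) (dif hg x), pd_const_mul (dif hf x)]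
    ring
  · intro f g h hf hg hh x
    simp only [bracket, Finset.mul_sum, Finset.sum_mul, ← Finset.sum_add_distrib]
    refine Finset.sum_congr rfl fun β _ => Finset.sum_congr rfl fun γ _ => ?_
    rw [pd_mul (dif hf x) (dif hg x)]
    ring
  · intro f g h hf hg hh x
    have key : ∀ {f g h : (ι → ℝ) → ℝ}, ContDiff ℝ ∞ f → ContDiff ℝ ∞ g → ContDiff ℝ ∞ h →
        bracket P f (bracket P g h) x = ∑ β, ∑ γ, P β γ x * pd f x β * ∑ δ, ∑ ε,
          (pd (P δ ε) x γ * pd g x δ * pd h x ε + P δ ε x * pd (fun y => pd g y δ) x γ * pd h x ε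
            + P δ ε x * pd g x δ * pd (fun y => pd h y ε) x γ) := by
      intro f g h hf hg hh
      rw [bracket]
      refine Finset.sum_congr rfl fun β _ => Finset.sum_congr rfl fun γ _ => ?_
      congr 1
      have d1 : ∀ δ ε, ContDiff ℝ ∞ (fun y => P δ ε y * pd g y δ) := fun δ ε =>
        (hs δ ε).mul (contDiff_pd hg δ)
      have d2 : ∀ δ ε, ContDiff ℝ ∞ (fun y => P δ ε y * pd g y δ * pd h y ε) := fun δ ε =>
        (d1 δ ε).mul (contDiff_pd hh ε)
      rw [show bracket P g h = fun y => ∑ δ, ∑ ε, P δ ε y * pd g y δ * pd h y ε from rfl,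
        pd_sum fun δ _ => dif (ContDiff.sum fun ε _ => d2 δ ε) x]
      refine Finset.sum_congr rfl fun δ _ => ?_
      rw [pd_sum fun ε _ => dif (d2 δ ε) x]
      refine Finset.sum_congr rfl fun ε _ => ?_
      rw [pd_mul (dif (d1 δ ε) x) (dif (contDiff_pd hh ε) x),
        pd_mul (dif (hs δ ε) x) (dif (contDiff_pd hg δ) x)]
      ring
    rw [key hf hg hh, key hg hh hf, key hh hf hg]
    exact cyclic_sum_eq_zero (P := fun β γ => P β γ x) (D := fun γ δ ε => pd (P δ ε) x γ)
      (fun β γ => hP β γ x) (fun β γ ε => hJ β γ ε x) (pd f x) (pd g x) (pd h x)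
      (F := fun γ δ => pd (fun y => pd f y δ) x γ) (G := fun γ δ => pd (fun y => pd g y δ) x γ)
      (H := fun γ δ => pd (fun y => pd h y δ) x γ)
      (fun β γ => pd_pd_comm hf x γ β) (fun β γ => pd_pd_comm hg x γ β)
      (fun β γ => pd_pd_comm hh x γ β)

theorem jacobiator_pencil {P Q : ι → ι → (ι → ℝ) → ℝ} (hP : ∀ β γ, ContDiff ℝ ∞ (P β γ))
    (hQ : ∀ β γ, ContDiff ℝ ∞ (Q β γ)) (a b : ℝ) (β γ ε : ι) (x : ι → ℝ) :
    jacobiator (fun β γ x => a * P β γ x + b * Q β γ x) (fun β γ x => a * P β γ x + b * Q β γ x)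
      β γ ε x = a ^ 2 * jacobiator P P β γ ε x
        + a * b * (jacobiator P Q β γ ε x + jacobiator Q P β γ ε x)
        + b ^ 2 * jacobiator Q Q β γ ε x := by
  have dP : ∀ β γ, DifferentiableAt ℝ (P β γ) x := fun β γ => (hP β γ).differentiable (by simp) x
  have dQ : ∀ β γ, DifferentiableAt ℝ (Q β γ) x := fun β γ => (hQ β γ).differentiable (by simp) x
  have hpd : ∀ β γ δ, pd (fun y => a * P β γ y + b * Q β γ y) x δ
      = a * pd (P β γ) x δ + b * pd (Q β γ) x δ := by
    intro β γ δ
    rw [pd_add ((dP β γ).const_mul a) ((dQ β γ).const_mul b), pd_const_mul (dP β γ),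
      pd_const_mul (dQ β γ)]
  simp only [jacobiator, hpd, Finset.mul_sum, ← Finset.sum_add_distrib]
  exact Finset.sum_congr rfl fun δ _ => by ring

/-- Two skew bivector fields are compatible Poisson structures as soon as the Jacobi identity
holds along the affine pencil `P + c Q`. -/
theorem areCompatible_of_pencil {P Q : ι → ι → (ι → ℝ) → ℝ} (hP : ∀ β γ, ContDiff ℝ ∞ (P β γ))
    (hQ : ∀ β γ, ContDiff ℝ ∞ (Q β γ)) (sP : ∀ β γ x, P β γ x = - P γ β x)
    (sQ : ∀ β γ x, Q β γ x = - Q γ β x)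
    (hJ : ∀ (c : ℝ) β γ ε x, jacobiator (fun β γ x => 1 * P β γ x + c * Q β γ x)
      (fun β γ x => 1 * P β γ x + c * Q β γ x) β γ ε x = 0) :
    AreCompatible (bracket Q) (bracket P) := by
  have all : ∀ a b : ℝ, IsPoissonBracket (bracket fun β γ x => a * P β γ x + b * Q β γ x) := by
    intro a b
    refine isPoissonBracket_bracket ?_ ?_ ?_
    · exact fun β γ => (contDiff_const.mul (hP β γ)).add (contDiff_const.mul (hQ β γ))
    · intro β γ x
      rw [sP β γ, sQ β γ]
      ring
    · intro β γ ε x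
      -- The Jacobiator of P + cQ is a quadratic polynomial in c, so its values at 0, 1, -1
      -- determine all three coefficients.
      have h0 := hJ 0 β γ ε x
      have h1 := hJ 1 β γ ε x
      have h2 := hJ (-1) β γ ε x
      rw [jacobiator_pencil hP hQ] at h0 h1 h2 ⊢
      have e0 : jacobiator P P β γ ε x = 0 := by linarith
      have e1 : jacobiator Q Q β γ ε x = 0 := by linarith
      have e2 : jacobiator P Q β γ ε x + jacobiator Q P β γ ε x = 0 := by linarith
      rw [e0, e1, e2]
      ring
  have comb : ∀ a b : ℝ, IsPoissonBracket (fun f g x => a * bracket Q f g x + b * bracket P f g x) := by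
    intro a b
    convert all b a using 4 with f g x
    simp only [bracket, Finset.mul_sum, ← Finset.sum_add_distrib]
    exact Finset.sum_congr rfl fun _ _ => Finset.sum_congr rfl fun _ _ => by ring
  refine ⟨?_, ?_, comb⟩
  · simpa using comb 1 0
  · simpa using comb 0 1

end Poisson

end

section

/-! ### The quadratic bracket on matrices indexed by ℤ × ℤ. -/

section QuadraticBracket

/-- Half of the sign of `a - b`. -/
def halfSign (a b : ℤ) : ℝ := if b < a then 1 / 2 else if a < b then -1 / 2 else 0

theorem halfSign_swap (a b : ℤ) : halfSign b a = - halfSign a b := by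
  unfold halfSign
  split_ifs <;> first | omega | norm_num

/-- The coefficient of `L_{rq} L_{ps}` in `{L_{pq}, L_{rs}}`. -/
def swapCoef (p q r s : ℤ) : ℝ := halfSign p r + halfSign q s

/-- The coefficient of `L_{pq} L_{rs}` in `{L_{pq}, L_{rs}}`. -/
def diagCoef (p q r s : ℤ) : ℝ :=
  halfSign p r + halfSign q s + (if p ≤ s then 1 else 0) - (if r ≤ q then 1 else 0)

/-- A quadratic bracket `{L_{pq}, L_{rs}}` on matrices with rows and columns in `ℤ`. -/
def quadBr (L : ℤ → ℤ → ℝ) (p q r s : ℤ) : ℝ :=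
  swapCoef p q r s * (L r q * L p s) + diagCoef p q r s * (L p q * L r s)

/-- The double bracket `{L_{tu}, {L_{pq}, L_{rs}}}`. -/
def doubleBr (L : ℤ → ℤ → ℝ) (t u p q r s : ℤ) : ℝ :=
  swapCoef p q r s * (quadBr L t u r q * L p s + L r q * quadBr L t u p s)
    + diagCoef p q r s * (quadBr L t u p q * L r s + L p q * quadBr L t u r s)

theorem swapCoef_swap (p q r s : ℤ) : swapCoef r s p q = - swapCoef p q r s := by
  rw [swapCoef, swapCoef, halfSign_swap p r, halfSign_swap q s]
  ring

theorem diagCoef_swap (p q r s : ℤ) : diagCoef r s p q = - diagCoef p q r s := by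
  rw [diagCoef, diagCoef, halfSign_swap p r, halfSign_swap q s]
  ring

theorem quadBr_swap (L : ℤ → ℤ → ℝ) (p q r s : ℤ) : quadBr L r s p q = - quadBr L p q r s := by
  rw [quadBr, quadBr, swapCoef_swap p q r s, diagCoef_swap p q r s]
  ring

/-- If p = r or q = s, the two monomials coincide and half-weights can be moved from one to the
other. This leaves one-sided indicators, the form that matches triangular projections and the
splitting in the Lax equation. -/
theorem quadBr_eq (L : ℤ → ℤ → ℝ) (p q r s : ℤ) : quadBr L p q r s
    = ((if r < p then 1 else 0) - (if q < s then 1 else 0)) * (L r q * L p s)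
      + ((if p ≤ s then 1 else 0) - (if q ≤ s then 1 else 0) - (if p < r then 1 else 0)
        + (if q < r then 1 else 0)) * (L p q * L r s) := by
  have e1 : (if r ≤ q then (1 : ℝ) else 0) = 1 - (if q < r then 1 else 0) := by
    split_ifs <;> first | omega | norm_num
  rw [quadBr, swapCoef, diagCoef, e1]
  generalize (if p ≤ s then (1 : ℝ) else 0) = a
  generalize (if q < r then (1 : ℝ) else 0) = b
  rcases lt_trichotomy p r with h1 | rfl | h1 <;> rcases lt_trichotomy q s with h2 | rfl | h2 <;>
  (simp only [halfSign]; split_ifs <;> first | omega | ring)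

/-- For three distinct integers the cyclic differences do not all have one sign, so one product is
1/4 and two are -1/4. If exactly two integers coincide, a single product survives and equals -1/4.
-/
theorem halfSign_cyclic (p r t : ℤ) :
    halfSign p r * halfSign r t + halfSign r t * halfSign t p + halfSign t p * halfSign p r = -1 / 4
      ∨ (p = r ∧ r = t) := by
  rcases lt_trichotomy p r with h1 | h1 | h1 <;> rcases lt_trichotomy r t with h2 | h2 | h2 <;>
  rcases lt_trichotomy t p with h3 | h3 | h3 <;> first
  | omega
  | exact Or.inr ⟨h1, h2⟩
  | (left
     simp only [halfSign, h1, h2, h3, not_lt_of_gt, lt_irrefl, if_true, if_false]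
     norm_num)

theorem doubleBr_jacobi (L : ℤ → ℤ → ℝ) (t u p q r s : ℤ) :
    doubleBr L t u p q r s + doubleBr L p q r s t u + doubleBr L r s t u p q = 0 := by
  -- Everything else in the cyclic sum cancels identically. The row and the column sign sums both
  -- equal -1/4, unless all rows or all columns agree; then the cubic factor is zero.
  have h : ((halfSign p r * halfSign r t + halfSign r t * halfSign t p + halfSign t p * halfSign p r)
      - (halfSign q s * halfSign s u + halfSign s u * halfSign u q + halfSign u q * halfSign q s))
      * (L p s * L r u * L t q - L p u * L r q * L t s) = 0 := by
    rcases halfSign_cyclic p r t with h1 | ⟨rfl, rfl⟩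
    · rcases halfSign_cyclic q s u with h2 | ⟨rfl, rfl⟩
      · rw [h1, h2]; ring
      · ring
    · ring
  unfold doubleBr quadBr swapCoef diagCoef
  rw [halfSign_swap p r, halfSign_swap r t, halfSign_swap t p, halfSign_swap q s,
    halfSign_swap s u, halfSign_swap u q]
  linear_combination -h

theorem halfSign_add (a b n : ℤ) : halfSign (a + n) (b + n) = halfSign a b := by
  simp [halfSign]

theorem swapCoef_add (p q r s n : ℤ) :
    swapCoef (p + n) (q + n) (r + n) (s + n) = swapCoef p q r s := by
  simp [swapCoef, halfSign_add]

theorem diagCoef_add (p q r s n : ℤ) :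
    diagCoef (p + n) (q + n) (r + n) (s + n) = diagCoef p q r s := by
  simp [diagCoef, halfSign_add]

theorem quadBr_add {L : ℤ → ℤ → ℝ} {n : ℤ} (hL : ∀ p q, L (p + n) (q + n) = L p q)
    (p q r s : ℤ) : quadBr L (p + n) (q + n) (r + n) (s + n) = quadBr L p q r s := by
  simp only [quadBr, hL, swapCoef_add, diagCoef_add]

theorem doubleBr_add {L : ℤ → ℤ → ℝ} {n : ℤ} (hL : ∀ p q, L (p + n) (q + n) = L p q)
    (t u p q r s : ℤ) :
    doubleBr L (t + n) (u + n) (p + n) (q + n) (r + n) (s + n) = doubleBr L t u p q r s := by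
  simp only [doubleBr, hL, quadBr_add hL, swapCoef_add, diagCoef_add]

/-- Matrices supported on `V × V` and on the diagonals `-1, …, m`, with the constant `e` below
the main diagonal. -/
structure IsBand (V : Set ℤ) (m : ℕ) (e : ℝ) (L : ℤ → ℤ → ℝ) : Prop where
  row : ∀ p q, p ∉ V → L p q = 0
  col : ∀ p q, q ∉ V → L p q = 0
  lower : ∀ p q, q < p - 1 → L p q = 0
  upper : ∀ p q : ℤ, p + m < q → L p q = 0
  sub : ∀ p, p ∈ V → p - 1 ∈ V → L p (p - 1) = e

variable {V : Set ℤ} {m : ℕ} {e : ℝ} {L : ℤ → ℤ → ℝ}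

/-- The positions `(r, s)` of the coordinates. -/
def IsCoord (V : Set ℤ) (m : ℕ) (r s : ℤ) : Prop := r ∈ V ∧ s ∈ V ∧ r ≤ s ∧ s ≤ r + m

/-- Band matrices with constant subdiagonal form a Poisson submanifold. Outside V × V both monomials
contain a zero factor; outside the band the signs in `swapCoef` cancel whenever the swapped product
can be nonzero. The value of `e` is irrelevant, only its constancy along the subdiagonal matters. -/
theorem IsBand.quadBr_eq_zero (hL : IsBand V m e L) {r s : ℤ} (h : ¬ IsCoord V m r s) (p q : ℤ) :
    quadBr L p q r s = 0 := by
  by_cases hr : r ∈ V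
  swap
  · simp [quadBr, hL.row r _ hr]
  by_cases hs : s ∈ V
  swap
  · simp [quadBr, hL.col _ s hs]
  by_cases hp : p ∈ V
  swap
  · simp [quadBr, hL.row p _ hp]
  by_cases hq : q ∈ V
  swap
  · simp [quadBr, hL.col _ q hq]
  by_cases h1 : q < p - 1
  · rw [quadBr, hL.lower p q h1]
    by_cases h2 : q < r - 1
    · rw [hL.lower r q h2]; ring
    by_cases h3 : s < p - 1
    · rw [hL.lower p s h3]; ring
    -- Both swapped entries being in the band forces r < p and q < s, so the two half-signs are
    -- opposite.
    have : swapCoef p q r s = 0 := by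
      unfold swapCoef halfSign
      split_ifs <;> first | omega | norm_num
    rw [this]; ring
  by_cases h2 : p + m < q
  · rw [quadBr, hL.upper p q h2]
    by_cases h2 : r + m < q
    · rw [hL.upper r q h2]; ring
    by_cases h3 : p + m < s
    · rw [hL.upper p s h3]; ring
    have : swapCoef p q r s = 0 := by
      unfold swapCoef halfSign
      split_ifs <;> first | omega | norm_num
    rw [this]; ring
  simp only [IsCoord, hr, hs, true_and, not_and, not_le] at h
  have hsm : s < r - 1 ∨ s = r - 1 ∨ r + m < s := by omega
  rcases hsm with h3 | h3 | h3
  · rw [quadBr, hL.lower r s h3]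
    by_cases h2 : q < r - 1
    · rw [hL.lower r q h2]; ring
    by_cases h3 : s < p - 1
    · rw [hL.lower p s h3]; ring
    have : swapCoef p q r s = 0 := by
      unfold swapCoef halfSign
      split_ifs <;> first | omega | norm_num
    rw [this]; ring
  · subst h3
    -- For the constant entry (r, r - 1) the indicator terms in `diagCoef` are decisive: they either
    -- cancel the half-signs or make the coefficient of the second monomial opposite to that of the
    -- first when both monomials coincide.
    have key : ∀ hs1 : p < r ∨ p = r ∨ r < p, ∀ hs2 : q < r - 1 ∨ q = r - 1 ∨ r - 1 < q,
        quadBr L p q r (r - 1) = 0 := by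
      rintro (hs1 | rfl | hs1) (hs2 | rfl | hs2)
      all_goals
        first
        | (rw [quadBr, hL.lower r q hs2]
           have : diagCoef p q r (r - 1) = 0 := by
             unfold diagCoef halfSign
             split_ifs <;> first | omega | norm_num
           rw [this]; ring)
        | (rw [quadBr, hL.lower p (r - 1) (by omega)]
           have : diagCoef p q r (r - 1) = 0 := by
             unfold diagCoef halfSign
             split_ifs <;> first | omega | norm_num
           rw [this]; ring)
        | (have h5 := hL.sub _ hr hs
           unfold quadBr swapCoef diagCoef halfSign
           rw [h5]
           split_ifs <;> first | omega | ring)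
    exact key (by omega) (by omega)
  · rw [quadBr, hL.upper r s h3]
    by_cases h2 : r + m < q
    · rw [hL.upper r q h2]; ring
    by_cases h3 : p + m < s
    · rw [hL.upper p s h3]; ring
    have : swapCoef p q r s = 0 := by
      unfold swapCoef halfSign
      split_ifs <;> first | omega | norm_num
    rw [this]; ring

theorem IsBand.quadBr_eq_zero' (hL : IsBand V m e L) {p q : ℤ} (h : ¬ IsCoord V m p q) (r s : ℤ) :
    quadBr L p q r s = 0 := by
  rw [quadBr_swap, hL.quadBr_eq_zero h, neg_zero]

theorem IsBand.isCoord_of_ne_zero (hL : IsBand V m e L) {p q r s : ℤ}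
    (h : quadBr L p q r s ≠ 0) : IsCoord V m p q ∧ IsCoord V m r s :=
  ⟨by_contra fun h' => h (hL.quadBr_eq_zero' h' r s), by_contra fun h' => h (hL.quadBr_eq_zero h' p q)⟩

/-- For disjoint intervals the two half-signs add up to -1, which the indicator of p ≤ s
compensates. This makes the bracket local. -/
theorem diagCoef_eq_zero_of_lt {p q r s : ℤ} (h1 : p ≤ q) (h2 : r ≤ s) (h : q < r) :
    diagCoef p q r s = 0 := by
  unfold diagCoef halfSign
  split_ifs <;> first | omega | norm_num

theorem IsBand.dist_le_of_ne_zero (hL : IsBand V m e L) {p q r s : ℤ}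
    (h : quadBr L p q r s ≠ 0) : r ≤ p + m + 1 ∧ p ≤ r + m + 1 := by
  obtain ⟨⟨-, -, h1, h2⟩, ⟨-, -, h3, h4⟩⟩ := hL.isCoord_of_ne_zero h
  constructor
  · by_contra h5
    refine h ?_
    rw [quadBr, hL.lower r q (by omega), diagCoef_eq_zero_of_lt h1 h3 (by omega)]
    ring
  · by_contra h5
    refine h ?_
    have := diagCoef_swap p q r s
    rw [diagCoef_eq_zero_of_lt h3 h1 (by omega)] at this
    rw [quadBr, hL.lower p s (by omega), show diagCoef p q r s = 0 by linarith]
    ring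

/-- Every term contains a bracket with L_tu, which bounds one distance, and a factor that ties the
remaining row to it. The bound, which is generous, is what makes the later sums over translations
finite. -/
theorem IsBand.dist_le_of_doubleBr_ne_zero (hL : IsBand V m e L) {t u p q r s : ℤ}
    (hpq : p ≤ q ∧ q ≤ p + m) (hrs : r ≤ s ∧ s ≤ r + m)
    (h : doubleBr L t u p q r s ≠ 0) :
    (p ≤ t + (4 * m + 4) ∧ t ≤ p + (4 * m + 4)) ∧ (r ≤ t + (4 * m + 4) ∧ t ≤ r + (4 * m + 4)) := by
  have hne : ∀ a b, L a b ≠ 0 → a - 1 ≤ b ∧ b ≤ a + m := fun a b hab =>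
    ⟨by_contra fun h' => hab (hL.lower a b (by omega)),
      by_contra fun h' => hab (hL.upper a b (by omega))⟩
  by_contra hcon
  apply h
  have z1 : quadBr L t u r q * L p s = 0 := by
    by_contra hz
    have h1 := hL.dist_le_of_ne_zero (left_ne_zero_of_mul hz)
    have h2 := (hL.isCoord_of_ne_zero (left_ne_zero_of_mul hz)).2.2.2
    have h3 := hne _ _ (right_ne_zero_of_mul hz)
    omega
  have z2 : L r q * quadBr L t u p s = 0 := by
    by_contra hz
    have h1 := hL.dist_le_of_ne_zero (right_ne_zero_of_mul hz)
    have h2 := (hL.isCoord_of_ne_zero (right_ne_zero_of_mul hz)).2.2.2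
    have h3 := hne _ _ (left_ne_zero_of_mul hz)
    omega
  have z3 : diagCoef p q r s * (quadBr L t u p q * L r s + L p q * quadBr L t u r s) = 0 := by
    by_contra hz
    have h0 : ¬ (q < r) ∧ ¬ (s < p) := by
      refine ⟨fun h' => left_ne_zero_of_mul hz (diagCoef_eq_zero_of_lt hpq.1 hrs.1 h'), fun h' => ?_⟩
      have := diagCoef_swap p q r s
      rw [diagCoef_eq_zero_of_lt hrs.1 hpq.1 h'] at this
      exact left_ne_zero_of_mul hz (by linarith)
    have hz' := right_ne_zero_of_mul hz
    by_cases h1 : quadBr L t u p q = 0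
    · by_cases h2 : quadBr L t u r s = 0
      · rw [h1, h2] at hz'
        simp at hz'
      · have := hL.dist_le_of_ne_zero h2
        omega
    · have := hL.dist_le_of_ne_zero h1
      omega
  rw [doubleBr, z1, z2, z3]
  ring

end QuadraticBracket

end

/-! ### Unrolled lattices, and the listed relations as values of `quadBr`. -/

section

open Classical in
/-- The entries `(p, p - 1)` inside `V × V`. -/
def subDiag (V : Set ℤ) (p q : ℤ) : ℝ := if p ∈ V ∧ q ∈ V ∧ q = p - 1 then 1 else 0

open Classical in
/-- The identity matrix on `V`. -/
def diagMat (V : Set ℤ) (p q : ℤ) : ℝ := if p ∈ V ∧ q = p then 1 else 0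

/-- The matrix `I - α E` on `V`. -/
def relMat (V : Set ℤ) (α : ℝ) (p q : ℤ) : ℝ := diagMat V p q - α * subDiag V p q

section Lattice

variable {ι K : Type} [Fintype ι] [DecidableEq ι] [AddGroupWithOne K] [DecidableEq K]

/-- A description of the labels of a grid by integral positions `(p, p + j)`, where `p` is
determined up to the kernel of `ℤ → K` and both `p` and `p + j` lie in an interval `V`. -/
structure Lattice (G : Grid ι K) (m : ℕ) where
  V : Set ℤ
  row : ι → ℤ
  row_cast : ∀ β, (row β : K) = G.site β
  lev_le : ∀ β, G.lev β ≤ m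
  mem_V : ∀ β, row β ∈ V ∧ row β + G.lev β ∈ V
  mem_congr : ∀ p q : ℤ, (p : K) = q → p ∈ V → q ∈ V
  exists_label : ∀ (p : ℤ) (j : ℕ), j ≤ m → p ∈ V → p + j ∈ V → ∃ β, G.lev β = j ∧ G.site β = p
  label_inj : ∀ β γ, G.lev β = G.lev γ → G.site β = G.site γ → β = γ
  interval : ∀ p q r, p ∈ V → r ∈ V → p ≤ q → q ≤ r → q ∈ V

/-- The matrix units at the positions of the coordinate `β`. -/
def Grid.genMat (G : Grid ι K) (β : ι) (p q : ℤ) : ℝ :=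
  if G.site β = (p : K) ∧ q = p + G.lev β then 1 else 0

variable {G : Grid ι K} {m : ℕ} (Λ : Lattice G m)

/-- The Lax matrix `T`, unrolled. -/
def Lattice.laxMat (x : ι → ℝ) (p q : ℤ) : ℝ := subDiag Λ.V p q + ∑ β, x β * G.genMat β p q

/-- The pencil `T + c (I - α E)`. -/
def Lattice.pencil (α c : ℝ) (x : ι → ℝ) (p q : ℤ) : ℝ :=
  Λ.laxMat x p q + c * relMat Λ.V α p q

theorem Lattice.mem_iff {p q : ℤ} (h : (p : K) = q) : p ∈ Λ.V ↔ q ∈ Λ.V :=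
  ⟨Λ.mem_congr p q h, Λ.mem_congr q p h.symm⟩

theorem Lattice.mem_add_iff {n : ℤ} (h : (n : K) = 0) (p : ℤ) : p + n ∈ Λ.V ↔ p ∈ Λ.V :=
  Λ.mem_iff (by push_cast; rw [h, add_zero])

theorem Lattice.cast_add_eq {p q : ℤ} (h : (p : K) = q) (n : ℤ) :
    ((p + n : ℤ) : K) = ((q + n : ℤ) : K) := by
  push_cast
  rw [h]

theorem Lattice.mem_of_site {β : ι} {p : ℤ} (h : G.site β = (p : K)) :
    p ∈ Λ.V ∧ p + G.lev β ∈ Λ.V :=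
  have h' : (Λ.row β : K) = (p : K) := (Λ.row_cast β).trans h
  ⟨(Λ.mem_iff h').1 (Λ.mem_V β).1, (Λ.mem_iff (Lattice.cast_add_eq h' _)).1 (Λ.mem_V β).2⟩

theorem Lattice.isCoord_of_genMat_ne_zero {β : ι} {p q : ℤ} (h : G.genMat β p q ≠ 0) :
    IsCoord Λ.V m p q := by
  unfold Grid.genMat at h
  split_ifs at h with h1
  · obtain ⟨h1, rfl⟩ := h1
    have := Λ.lev_le β
    exact ⟨(Λ.mem_of_site h1).1, (Λ.mem_of_site h1).2, by omega, by omega⟩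
  · exact absurd rfl h

theorem Lattice.genMat_eq_zero {p q : ℤ} (h : ¬ IsCoord Λ.V m p q) (β : ι) : G.genMat β p q = 0 :=
  by_contra fun h' => h (Λ.isCoord_of_genMat_ne_zero h')

theorem Lattice.sum_genMat_eq_zero {p q : ℤ} (h : ¬ IsCoord Λ.V m p q) (x : ι → ℝ) :
    ∑ β, x β * G.genMat β p q = 0 :=
  Finset.sum_eq_zero fun β _ => by rw [Λ.genMat_eq_zero h, mul_zero]

/-- F has -α on the subdiagonal and T has 1, so the shift by cF changes only the main diagonal and
the subdiagonal constant. For this reason `IsBand` allows an arbitrary constant. -/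
theorem Lattice.isBand_pencil (α c : ℝ) (x : ι → ℝ) :
    IsBand Λ.V m (1 - c * α) (Λ.pencil α c x) := by
  constructor
  · intro p q hp
    rw [pencil, laxMat, Λ.sum_genMat_eq_zero (fun h => hp h.1)]
    simp [relMat, diagMat, subDiag, hp]
  · intro p q hq
    rw [pencil, laxMat, Λ.sum_genMat_eq_zero (fun h => hq h.2.1)]
    have : ¬ (p ∈ Λ.V ∧ q = p) := fun h => hq (h.2 ▸ h.1)
    simp [relMat, diagMat, subDiag, hq, this]
  · intro p q hpq
    rw [pencil, laxMat, Λ.sum_genMat_eq_zero (fun h => by have := h.2.2.1; omega)]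
    have h1 : q ≠ p := by omega
    have h2 : q ≠ p - 1 := by omega
    simp [relMat, diagMat, subDiag, h1, h2]
  · intro p q hpq
    rw [pencil, laxMat, Λ.sum_genMat_eq_zero (fun h => by have := h.2.2.2; omega)]
    have h1 : q ≠ p := by omega
    have h2 : q ≠ p - 1 := by omega
    simp [relMat, diagMat, subDiag, h1, h2]
  · intro p hp hp'
    rw [pencil, laxMat, Λ.sum_genMat_eq_zero (fun h => by have := h.2.2.1; omega)]
    simp [relMat, diagMat, subDiag, hp, hp']
    ring

theorem Lattice.isBand_laxMat (x : ι → ℝ) : IsBand Λ.V m 1 (Λ.laxMat x) := by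
  have h := Λ.isBand_pencil 0 0 x
  have e : Λ.pencil 0 0 x = Λ.laxMat x := by
    funext p q
    simp [pencil]
  rw [e] at h
  simpa using h

theorem Grid.genMat_add {n : ℤ} (h : (n : K) = 0) (β : ι) (p q : ℤ) :
    G.genMat β (p + n) (q + n) = G.genMat β p q := by
  unfold Grid.genMat
  have : (q + n = p + n + G.lev β) ↔ (q = p + G.lev β) := by constructor <;> intro <;> omega
  simp [h, this]

theorem Lattice.subDiag_add {n : ℤ} (h : (n : K) = 0) (p q : ℤ) :
    subDiag Λ.V (p + n) (q + n) = subDiag Λ.V p q := by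
  unfold subDiag
  have : (q + n = p + n - 1) ↔ (q = p - 1) := by constructor <;> intro <;> omega
  classical
  exact if_congr (and_congr (Λ.mem_add_iff h p) (and_congr (Λ.mem_add_iff h q) this)) rfl rfl

theorem Lattice.diagMat_add {n : ℤ} (h : (n : K) = 0) (p q : ℤ) :
    diagMat Λ.V (p + n) (q + n) = diagMat Λ.V p q := by
  unfold diagMat
  classical
  exact if_congr (and_congr (Λ.mem_add_iff h p) (add_left_inj n)) rfl rfl

theorem Lattice.laxMat_add (x : ι → ℝ) {n : ℤ} (h : (n : K) = 0) (p q : ℤ) :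
    Λ.laxMat x (p + n) (q + n) = Λ.laxMat x p q := by
  simp only [laxMat, Λ.subDiag_add h, Grid.genMat_add h]

theorem Lattice.pencil_add (α c : ℝ) (x : ι → ℝ) {n : ℤ} (h : (n : K) = 0) (p q : ℤ) :
    Λ.pencil α c x (p + n) (q + n) = Λ.pencil α c x p q := by
  simp only [pencil, relMat, Λ.laxMat_add x h, Λ.diagMat_add h, Λ.subDiag_add h]

theorem Lattice.laxMat_field (x : ι → ℝ) (p : ℤ) (j : ℕ) :
    Λ.laxMat x p (p + j) = G.field x j (p : K) := by
  have h : ¬ ((p + j : ℤ) = p - 1) := by omega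
  simp only [laxMat, subDiag, h, and_false, if_false, zero_add, Grid.field, Grid.genMat]
  refine Finset.sum_congr rfl fun β _ => ?_
  by_cases h1 : G.lev β = j ∧ G.site β = (p : K)
  · rw [if_pos h1, if_pos ⟨h1.2, by rw [h1.1]⟩, mul_one]
  · rw [if_neg h1, if_neg, mul_zero]
    rintro ⟨h2, h3⟩
    exact h1 ⟨by omega, h2⟩

/-- With a lift p of the site of β fixed, the distances ℓ of the two lists become the displacements
from p to the lifts r of the site of γ. Several r in the window may be congruent, which is how
listed values add up on short periodic lattices. -/
theorem Grid.structFn_eq_sum (G : Grid ι K) (m : ℕ) (t : (ℕ → K → ℝ) → ℕ → K → ℕ → ℕ → ℝ)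
    (β γ : ι) (x : ι → ℝ) {p : ℤ} (hp : G.site β = (p : K)) :
    G.structFn m t β γ x = ∑ r ∈ Finset.Icc (p - (m + 1)) (p + (m + 1)), if G.site γ = (r : K) then
      (if p ≤ r then t (G.field x) (G.lev β) (p : K) (G.lev γ) (r - p).toNat else 0)
      - (if r ≤ p then t (G.field x) (G.lev γ) (r : K) (G.lev β) (p - r).toNat else 0) else 0 := by
  have h1 : ∀ f : ℤ → ℝ, ∑ r ∈ Finset.Icc (p - (m + 1)) (p + (m + 1)), (if p ≤ r then f r else 0)
      = ∑ ℓ ∈ Finset.range (m + 2), f (p + ℓ) := by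
    intro f
    rw [← Finset.sum_filter]
    refine Finset.sum_nbij' (fun r => (r - p).toNat) (fun ℓ => p + ℓ) ?_ ?_ ?_ ?_ ?_
    · intro r hr
      simp only [Finset.mem_filter, Finset.mem_Icc, Finset.mem_range] at hr ⊢
      omega
    · intro r hr
      simp only [Finset.mem_filter, Finset.mem_Icc, Finset.mem_range] at hr ⊢
      omega
    · intro r hr
      simp only [Finset.mem_filter, Finset.mem_Icc] at hr
      omega
    · intro r hr
      omega
    · intro r hr
      simp only [Finset.mem_filter, Finset.mem_Icc] at hr
      congr 1
      omega
  have h2 : ∀ f : ℤ → ℝ, ∑ r ∈ Finset.Icc (p - (m + 1)) (p + (m + 1)), (if r ≤ p then f r else 0)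
      = ∑ ℓ ∈ Finset.range (m + 2), f (p - ℓ) := by
    intro f
    rw [← Finset.sum_filter]
    refine Finset.sum_nbij' (fun r => (p - r).toNat) (fun ℓ => p - ℓ) ?_ ?_ ?_ ?_ ?_
    · intro r hr
      simp only [Finset.mem_filter, Finset.mem_Icc, Finset.mem_range] at hr ⊢
      omega
    · intro r hr
      simp only [Finset.mem_filter, Finset.mem_Icc, Finset.mem_range] at hr ⊢
      omega
    · intro r hr
      simp only [Finset.mem_filter, Finset.mem_Icc] at hr
      omega
    · intro r hr
      omega
    · intro r hr
      simp only [Finset.mem_filter, Finset.mem_Icc] at hr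
      congr 1
      omega
  have h3 := h1 fun r => if G.site γ = (r : K) then
      t (G.field x) (G.lev β) (p : K) (G.lev γ) (r - p).toNat else 0
  have h4 := h2 fun r => if G.site γ = (r : K) then
      t (G.field x) (G.lev γ) (r : K) (G.lev β) (p - r).toNat else 0
  rw [Grid.structFn, Finset.sum_sub_distrib]
  trans (∑ ℓ ∈ Finset.range (m + 2), if G.site γ = ((p + ℓ : ℤ) : K) then
      t (G.field x) (G.lev β) (p : K) (G.lev γ) (p + ℓ - p).toNat else 0)
    - ∑ ℓ ∈ Finset.range (m + 2), if G.site γ = ((p - ℓ : ℤ) : K) then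
      t (G.field x) (G.lev γ) ((p - ℓ : ℤ) : K) (G.lev β) (p - (p - ℓ)).toNat else 0
  · congr 1
    · refine Finset.sum_congr rfl fun ℓ _ => ?_
      have : (p + ℓ - p).toNat = ℓ := by omega
      rw [this, hp]
      push_cast
      rfl
    · refine Finset.sum_congr rfl fun ℓ _ => ?_
      have e : (p - (p - ℓ)).toNat = ℓ := by omega
      have e2 : (G.site β = G.site γ + (ℓ : K)) ↔ G.site γ = ((p - ℓ : ℤ) : K) := by
        rw [hp]
        push_cast
        rw [eq_sub_iff_add_eq, eq_comm]
      rw [e]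
      by_cases h : G.site γ = ((p - ℓ : ℤ) : K)
      · rw [if_pos h, if_pos (e2.2 h), h]
      · rw [if_neg h, if_neg (fun h' => h (e2.1 h'))]
  · rw [← h3, ← h4, ← Finset.sum_sub_distrib]
    refine Finset.sum_congr rfl fun r _ => ?_
    split_ifs <;> simp

/-- The entry L_{p+ℓ, p+i} of the swapped product decides which relation applies: it is a coordinate
or a diagonal entry for ℓ ≤ i, the constant 1 for ℓ = i + 1, and 0 beyond. -/
theorem Lattice.quadTerm_eq (x : ι → ℝ) {p : ℤ} {i j ℓ : ℕ} (hℓ : 1 ≤ ℓ)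
    (hV : p + i ∈ Λ.V ∧ p + ℓ ∈ Λ.V) :
    quadTerm (G.field x) i (p : K) j ℓ = quadBr (Λ.laxMat x) p (p + i) (p + ℓ) (p + ℓ + j) := by
  have hb := Λ.isBand_laxMat x
  have e1 : Λ.laxMat x p (p + i) = G.field x i (p : K) := Λ.laxMat_field x p i
  have e2 : Λ.laxMat x (p + ℓ) (p + ℓ + j) = G.field x j ((p : K) + (ℓ : K)) := by
    rw [Λ.laxMat_field x (p + ℓ) j]
    push_cast
    rfl
  have e3 : Λ.laxMat x p (p + ℓ + j) = G.field x (j + ℓ) (p : K) := by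
    rw [← Λ.laxMat_field x p (j + ℓ)]
    congr 1
    omega
  rw [quadBr, e1, e2, e3]
  rcases lt_trichotomy ℓ (i + 1) with h | h | h
  · have e4 : Λ.laxMat x (p + ℓ) (p + i) = G.field x (i - ℓ) ((p : K) + (ℓ : K)) := by
      have := Λ.laxMat_field x (p + ℓ) (i - ℓ)
      push_cast at this
      rw [← this]
      congr 1
      omega
    rw [e4]
    rcases lt_trichotomy i (j + ℓ) with h' | h' | h'
    · have c1 : swapCoef p (p + i) (p + ℓ) (p + ℓ + j) = -1 := by
        unfold swapCoef halfSign
        split_ifs <;> first | omega | norm_num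
      have c2 : diagCoef p (p + i) (p + ℓ) (p + ℓ + j) = -1 := by
        unfold diagCoef halfSign
        split_ifs <;> first | omega | norm_num
      rw [c1, c2, quadTerm, if_neg (by omega), if_neg (by omega), if_pos (by omega)]
      ring
    -- The two columns coincide here, hence so do the two monomials, and the halves add up to the
    -- single listed term.
    · have c1 : swapCoef p (p + i) (p + ℓ) (p + ℓ + j) = -1 / 2 := by
        unfold swapCoef halfSign
        split_ifs <;> first | omega | norm_num
      have c2 : diagCoef p (p + i) (p + ℓ) (p + ℓ + j) = -1 / 2 := by
        unfold diagCoef halfSign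
        split_ifs <;> first | omega | norm_num
      rw [c1, c2, quadTerm, if_neg (by omega), if_pos (by omega), if_neg (by omega)]
      rw [show i - ℓ = j by omega, ← h']
      ring
    · have c1 : swapCoef p (p + i) (p + ℓ) (p + ℓ + j) = 0 := by
        unfold swapCoef halfSign
        split_ifs <;> first | omega | norm_num
      have c2 : diagCoef p (p + i) (p + ℓ) (p + ℓ + j) = 0 := by
        unfold diagCoef halfSign
        split_ifs <;> first | omega | norm_num
      rw [c1, c2, quadTerm, if_neg (by omega), if_neg (by omega), if_neg (by omega)]
      ring
  -- The subdiagonal constant turns the swapped product into the linear term of the list. The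
  -- membership `hV` is needed so that the entry lies inside V × V.
  · have e4 : Λ.laxMat x (p + ℓ) (p + i) = 1 := by
      have : (p + i : ℤ) = p + ℓ - 1 := by omega
      rw [this] at hV ⊢
      exact hb.sub _ hV.2 hV.1
    have c1 : swapCoef p (p + i) (p + ℓ) (p + ℓ + j) = -1 := by
      unfold swapCoef halfSign
      split_ifs <;> first | omega | norm_num
    have c2 : diagCoef p (p + i) (p + ℓ) (p + ℓ + j) = 0 := by
      unfold diagCoef halfSign
      split_ifs <;> first | omega | norm_num
    rw [e4, c1, c2, quadTerm, if_pos h, if_neg (by omega), if_neg (by omega),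
      show i + j + 1 = j + ℓ by omega]
    ring
  · have e4 : Λ.laxMat x (p + ℓ) (p + i) = 0 := hb.lower _ _ (by omega)
    have c2 : diagCoef p (p + i) (p + ℓ) (p + ℓ + j) = 0 := by
      unfold diagCoef halfSign
      split_ifs <;> first | omega | norm_num
    rw [e4, c2, quadTerm, if_neg (by omega), if_neg (by omega), if_neg (by omega)]
    ring

theorem Lattice.quadTerm_zero (x : ι → ℝ) {p : ℤ} {i j : ℕ} :
    quadTerm (G.field x) i (p : K) j 0 - quadTerm (G.field x) j (p : K) i 0
      = quadBr (Λ.laxMat x) p (p + i) p (p + j) := by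
  rw [quadBr, Λ.laxMat_field, Λ.laxMat_field]
  have z : ∀ i j : ℕ, i ≤ j → quadTerm (G.field x) j (p : K) i 0 = 0 := by
    intro i j h
    rw [quadTerm, if_neg (by omega), if_neg (by omega), if_neg (by omega)]
    ring
  have n : ∀ i j : ℕ, i < j → quadTerm (G.field x) i (p : K) j 0
      = - (G.field x i (p : K) * G.field x j (p : K)) := by
    intro i j h
    rw [quadTerm, if_neg (by omega), if_pos (by omega), if_neg (by omega)]
    simp
  rcases lt_trichotomy i j with h | rfl | h
  · have c1 : swapCoef p (p + i) p (p + j) = -1 / 2 := by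
      unfold swapCoef halfSign
      split_ifs <;> first | omega | norm_num
    have c2 : diagCoef p (p + i) p (p + j) = -1 / 2 := by
      unfold diagCoef halfSign
      split_ifs <;> first | omega | norm_num
    rw [n i j h, z i j h.le, c1, c2]
    ring
  · simp [swapCoef, diagCoef, halfSign]
  · have c1 : swapCoef p (p + i) p (p + j) = 1 / 2 := by
      unfold swapCoef halfSign
      split_ifs <;> first | omega | norm_num
    have c2 : diagCoef p (p + i) p (p + j) = 1 / 2 := by
      unfold diagCoef halfSign
      split_ifs <;> first | omega | norm_num
    rw [n j i h, z j i h.le, c1, c2]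
    ring

theorem Lattice.quad_kernel (x : ι → ℝ) {p r : ℤ} {i j : ℕ} (hp : p ∈ Λ.V) (hpi : p + i ∈ Λ.V)
    (hr : r ∈ Λ.V) (hrj : r + j ∈ Λ.V) :
    (if p ≤ r then quadTerm (G.field x) i (p : K) j (r - p).toNat else 0)
      - (if r ≤ p then quadTerm (G.field x) j (r : K) i (p - r).toNat else 0)
      = quadBr (Λ.laxMat x) p (p + i) r (r + j) := by
  rcases lt_trichotomy p r with h | rfl | h
  · obtain ⟨ℓ, rfl⟩ : ∃ ℓ : ℕ, r = p + ℓ := ⟨(r - p).toNat, by omega⟩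
    rw [if_pos h.le, if_neg (by omega), sub_zero, show (p + ℓ - p).toNat = ℓ by omega]
    exact Λ.quadTerm_eq x (by omega) ⟨hpi, hr⟩
  · simpa using Λ.quadTerm_zero (G := G) x
  · obtain ⟨ℓ, rfl⟩ : ∃ ℓ : ℕ, p = r + ℓ := ⟨(p - r).toNat, by omega⟩
    rw [if_neg (by omega), if_pos h.le, zero_sub, show (r + ℓ - r).toNat = ℓ by omega,
      Λ.quadTerm_eq x (by omega) ⟨hrj, hp⟩, ← quadBr_swap]

end Lattice

end

/-! ### The linear bracket as the derivative of the quadratic one along F. -/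

section

section Lattice

variable {ι K : Type} [Fintype ι] [DecidableEq ι] [AddGroupWithOne K] [DecidableEq K]
variable {G : Grid ι K} {m : ℕ} (Λ : Lattice G m)

/-- The linear bracket of `L_{pq}` and `L_{rs}`. -/
def linBr (L : ℤ → ℤ → ℝ) (α : ℝ) (p q r s : ℤ) : ℝ :=
  (if r = q then - L p s else 0) + (if r = q + 1 then α * L p s else 0)
    + (if p = s then L r q else 0) - (if p = s + 1 then α * L r q else 0)

theorem relMat_self {V : Set ℤ} {p : ℤ} (α : ℝ) (hp : p ∈ V) : relMat V α p p = 1 := by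
  have h : p ≠ p - 1 := by omega
  simp [relMat, diagMat, subDiag, hp, h]

theorem relMat_sub {V : Set ℤ} {p : ℤ} (α : ℝ) (hp : p ∈ V) (hp' : p - 1 ∈ V) :
    relMat V α p (p - 1) = - α := by
  simp [relMat, diagMat, subDiag, hp, hp']

theorem relMat_of_ne {V : Set ℤ} {p q : ℤ} (α : ℝ) (h1 : q ≠ p) (h2 : q ≠ p - 1) :
    relMat V α p q = 0 := by
  simp [relMat, diagMat, subDiag, h1, h2]

/-- Polarization: F has only two diagonals, on which the one-sided indicators of `quadBr_eq` are
easy to evaluate. The coefficient at c² vanishes, and the coefficient at c is the linear bracket.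
Both positions must lie on or above the diagonal. -/
theorem quadBr_shift {V : Set ℤ} {L : ℤ → ℤ → ℝ} (α c : ℝ) {p q r s : ℤ} (hp : p ∈ V) (hq : q ∈ V)
    (hr : r ∈ V) (hs : s ∈ V) (hpq : p ≤ q) (hrs : r ≤ s) :
    quadBr (fun a b => L a b + c * relMat V α a b) p q r s
      = quadBr L p q r s + c * linBr L α p q r s := by
  set F := relMat V α with hF
  have v : ∀ a b, a ∈ V → b ∈ V → F a b = if b = a then 1 else if a = b + 1 then -α else 0 := by
    intro a b ha hb
    split_ifs with h h'
    · rw [h, hF, relMat_self α ha]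
    · obtain rfl : b = a - 1 := by omega
      rw [hF, relMat_sub α ha hb]
    · rw [hF, relMat_of_ne α h (by omega)]
  -- A and C are the coefficients of the swapped and of the direct monomial in `quadBr_eq`.
  obtain ⟨A, hA⟩ : ∃ A : ℝ, (if r < p then (1 : ℝ) else 0) - (if q < s then 1 else 0) = A := ⟨_, rfl⟩
  obtain ⟨C, hC⟩ : ∃ C : ℝ, (if p ≤ s then (1 : ℝ) else 0) - (if q ≤ s then 1 else 0)
    - (if p < r then 1 else 0) + (if q < r then 1 else 0) = C := ⟨_, rfl⟩
  have h1 : A * F r q = if r = q + 1 then α else if r = q then (if q < s then -1 else 0) else 0 := by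
    rw [v r q hr hq, ← hA]
    split_ifs <;> first | omega | ring
  have h2 : A * F p s = if p = s + 1 then -α else if p = s then (if r < p then 1 else 0) else 0 := by
    rw [v p s hp hs, ← hA]
    split_ifs <;> first | omega | ring
  have h3 : C * F p q = 0 := by
    rw [v p q hp hq, ← hC]
    split_ifs <;> first | omega | ring
  have h4 : C * F r s = if r = s then (if p = r then 1 else 0) - (if q = r then 1 else 0) else 0 := by
    rw [v r s hr hs, ← hC]
    split_ifs <;> first | omega | ring
  have h5 : A * F r q * F p s = 0 := by
    rw [h1, v p s hp hs]
    split_ifs <;> first | omega | ring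
  have h6 : A * F r q * L p s + A * F p s * L r q + C * F r s * L p q = linBr L α p q r s := by
    rw [h1, h2, h4, linBr]
    by_cases e1 : r = q
    · subst e1
      by_cases e2 : p = s
      · obtain rfl : r = p := by omega
        subst e2
        simp
      · by_cases e3 : r = s
        · subst e3
          have e4 : p ≠ r + 1 := by omega
          simp [e2, e4]
        · have e4 : r < s := by omega
          have e5 : p ≠ s + 1 := by omega
          simp [e2, e3, e4, e5]
    · by_cases e2 : p = s
      · subst e2
        by_cases e3 : r = p
        · subst e3
          have e4 : r ≠ q + 1 := by omega
          simp [e1, e4, Ne.symm e1]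
        · have e4 : r < p := by omega
          have e5 : r ≠ q + 1 := by omega
          simp [e1, e3, e4, e5]
      · have e3 : (if r = s then ((if p = r then (1 : ℝ) else 0) - (if q = r then 1 else 0)) else 0)
            = 0 := by
          split_ifs <;> first | omega | ring
        rw [e3, if_neg e1, if_neg e1, if_neg e2, if_neg e2]
        split_ifs <;> ring
  rw [quadBr_eq, quadBr_eq, hA, hC, ← h6]
  linear_combination c ^ 2 * h5 + c * L r s * h3 + c ^ 2 * F r s * h3

theorem Lattice.lin_kernel (x : ι → ℝ) (α : ℝ) {p r : ℤ} {i j : ℕ} :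
    (if p ≤ r then linTerm α (G.field x) i (p : K) j (r - p).toNat else 0)
      - (if r ≤ p then linTerm α (G.field x) j (r : K) i (p - r).toNat else 0)
      = linBr (Λ.laxMat x) α p (p + i) r (r + j) := by
  rcases lt_trichotomy p r with h | rfl | h
  · obtain ⟨ℓ, rfl⟩ : ∃ ℓ : ℕ, r = p + ℓ := ⟨(r - p).toNat, by omega⟩
    rw [if_pos h.le, if_neg (by omega), sub_zero, show (p + ℓ - p).toNat = ℓ by omega,
      linTerm, linBr, if_neg (show ¬ p = p + ℓ + j by omega),
      if_neg (show ¬ p = p + ℓ + j + 1 by omega)]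
    by_cases h1 : ℓ = i
    · subst h1
      rw [if_pos (by omega), if_neg (by omega), if_pos rfl, if_neg (by omega),
        show p + ℓ + j = p + ((ℓ + j : ℕ) : ℤ) by omega, Λ.laxMat_field]
      ring
    · by_cases h2 : ℓ = i + 1
      · subst h2
        rw [if_neg (by omega), if_pos rfl, if_neg (by omega), if_pos (by omega),
          show p + (i + 1 : ℕ) + j = p + ((i + j + 1 : ℕ) : ℤ) by omega, Λ.laxMat_field]
        ring
      · rw [if_neg (by omega), if_neg h2, if_neg (by omega), if_neg (by omega)]
        ring
  · have e : ∀ i j : ℕ, linTerm α (G.field x) i (p : K) j 0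
        = if i = 0 ∧ j ≠ 0 then - G.field x j (p : K) else 0 := by
      intro i j
      rw [linTerm, if_neg (show ¬ 0 = i + 1 by omega), add_zero]
      by_cases h : i = 0 ∧ j ≠ 0
      · rw [if_pos h, if_pos (by omega), h.1, zero_add]
      · rw [if_neg h, if_neg (by omega)]
    simp only [le_refl, if_true, sub_self, Int.toNat_zero, e, linBr, Λ.laxMat_field]
    rw [if_neg (show ¬ p = p + i + 1 by omega), if_neg (show ¬ p = p + j + 1 by omega)]
    rcases Nat.eq_zero_or_pos i with rfl | hi <;> rcases Nat.eq_zero_or_pos j with rfl | hj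
    · simp
    · simp [hj.ne']
    · simp [hi.ne']
    · simp [hi.ne', hj.ne']
  · obtain ⟨ℓ, rfl⟩ : ∃ ℓ : ℕ, p = r + ℓ := ⟨(p - r).toNat, by omega⟩
    rw [if_neg (by omega), if_pos h.le, zero_sub, show (r + ℓ - r).toNat = ℓ by omega,
      linTerm, linBr, if_neg (show ¬ r = r + ℓ + i by omega),
      if_neg (show ¬ r = r + ℓ + i + 1 by omega)]
    by_cases h1 : ℓ = j
    · subst h1
      rw [if_pos (by omega), if_neg (by omega), if_pos rfl, if_neg (by omega),
        show r + ℓ + i = r + ((ℓ + i : ℕ) : ℤ) by omega, Λ.laxMat_field]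
      ring
    · by_cases h2 : ℓ = j + 1
      · subst h2
        rw [if_neg (by omega), if_pos rfl, if_neg (by omega), if_pos (by omega),
          show r + (j + 1 : ℕ) + i = r + ((j + i + 1 : ℕ) : ℤ) by omega, Λ.laxMat_field]
        ring
      · rw [if_neg (by omega), if_neg h2, if_neg (by omega), if_neg (by omega)]
        ring

theorem Lattice.quad_eq_sum (β γ : ι) (x : ι → ℝ) {p : ℤ} (hp : G.site β = (p : K)) :
    G.quad m β γ x = ∑ r ∈ Finset.Icc (p - (m + 1)) (p + (m + 1)), if G.site γ = (r : K) then
      quadBr (Λ.laxMat x) p (p + G.lev β) r (r + G.lev γ) else 0 := by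
  rw [Grid.quad, Grid.structFn_eq_sum G m _ β γ x hp]
  refine Finset.sum_congr rfl fun r _ => ?_
  by_cases h : G.site γ = (r : K)
  · rw [if_pos h, if_pos h]
    exact Λ.quad_kernel x (Λ.mem_of_site hp).1 (Λ.mem_of_site hp).2 (Λ.mem_of_site h).1
      (Λ.mem_of_site h).2
  · rw [if_neg h, if_neg h]

theorem Lattice.lin_eq_sum (α : ℝ) (β γ : ι) (x : ι → ℝ) {p : ℤ} (hp : G.site β = (p : K)) :
    G.lin m α β γ x = ∑ r ∈ Finset.Icc (p - (m + 1)) (p + (m + 1)), if G.site γ = (r : K) then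
      linBr (Λ.laxMat x) α p (p + G.lev β) r (r + G.lev γ) else 0 := by
  rw [Grid.lin, Grid.structFn_eq_sum G m _ β γ x hp]
  refine Finset.sum_congr rfl fun r _ => ?_
  by_cases h : G.site γ = (r : K)
  · rw [if_pos h, if_pos h]
    exact Λ.lin_kernel x α
  · rw [if_neg h, if_neg h]

/-- The pencil of the two brackets on coordinates. -/
def Grid.pencilBr (G : Grid ι K) (m : ℕ) (α c : ℝ) (β γ : ι) (x : ι → ℝ) : ℝ :=
  1 * G.quad m β γ x + c * G.lin m α β γ x

theorem Lattice.pencilBr_eq_sum (α c : ℝ) (β γ : ι) (x : ι → ℝ) {p : ℤ}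
    (hp : G.site β = (p : K)) :
    G.pencilBr m α c β γ x = ∑ r ∈ Finset.Icc (p - (m + 1)) (p + (m + 1)),
      if G.site γ = (r : K) then
        quadBr (Λ.pencil α c x) p (p + G.lev β) r (r + G.lev γ) else 0 := by
  rw [Grid.pencilBr, Λ.quad_eq_sum β γ x hp, Λ.lin_eq_sum α β γ x hp, one_mul, Finset.mul_sum,
    ← Finset.sum_add_distrib]
  refine Finset.sum_congr rfl fun r _ => ?_
  split_ifs with h
  · exact (quadBr_shift α c (Λ.mem_of_site hp).1 (Λ.mem_of_site hp).2 (Λ.mem_of_site h).1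
      (Λ.mem_of_site h).2 (by omega) (by omega)).symm
  · ring

theorem Grid.structFn_swap (G : Grid ι K) (m : ℕ) (t : (ℕ → K → ℝ) → ℕ → K → ℕ → ℕ → ℝ)
    (β γ : ι) (x : ι → ℝ) : G.structFn m t β γ x = - G.structFn m t γ β x := by
  rw [Grid.structFn, Grid.structFn, ← Finset.sum_neg_distrib]
  exact Finset.sum_congr rfl fun ℓ _ => by ring

theorem Grid.contDiff_field (G : Grid ι K) (j : ℕ) (k : K) :
    ContDiff ℝ ∞ (fun x => G.field x j k) := by
  refine ContDiff.sum fun β _ => ?_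
  split_ifs
  · exact contDiff_apply ℝ ℝ β
  · exact contDiff_const

theorem Grid.contDiff_structFn (G : Grid ι K) (m : ℕ) {t : (ℕ → K → ℝ) → ℕ → K → ℕ → ℕ → ℝ}
    (ht : ∀ i k j ℓ, ContDiff ℝ ∞ (fun x => t (G.field x) i k j ℓ)) (β γ : ι) :
    ContDiff ℝ ∞ (G.structFn m t β γ) := by
  refine ContDiff.sum fun ℓ _ => ContDiff.sub ?_ ?_
  · split_ifs
    · exact ht _ _ _ _
    · exact contDiff_const
  · split_ifs
    · exact ht _ _ _ _
    · exact contDiff_const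

theorem Grid.contDiff_quad (G : Grid ι K) (m : ℕ) (β γ : ι) : ContDiff ℝ ∞ (G.quad m β γ) := by
  refine G.contDiff_structFn m (fun i k j ℓ => ?_) β γ
  have h := G.contDiff_field
  refine (ContDiff.add ?_ ?_).add ?_ <;> split_ifs
  · exact (h _ _).neg
  · exact contDiff_const
  · exact ((h _ _).mul (h _ _)).neg
  · exact contDiff_const
  · exact ((h _ _).mul (h _ _)).neg.sub ((h _ _).mul (h _ _))
  · exact contDiff_const

theorem Grid.contDiff_lin (G : Grid ι K) (m : ℕ) (α : ℝ) (β γ : ι) :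
    ContDiff ℝ ∞ (G.lin m α β γ) := by
  refine G.contDiff_structFn m (fun i k j ℓ => ?_) β γ
  have h := G.contDiff_field
  refine ContDiff.add ?_ ?_ <;> split_ifs
  · exact (h _ _).neg
  · exact contDiff_const
  · exact contDiff_const.mul (h _ _)
  · exact contDiff_const

theorem tsum_eq_sum_Icc {f : ℤ → ℝ} {a b : ℤ} (h : ∀ r, f r ≠ 0 → a ≤ r ∧ r ≤ b) :
    ∑' r, f r = ∑ r ∈ Finset.Icc a b, f r :=
  tsum_eq_sum fun r hr => by_contra fun h' => hr (Finset.mem_Icc.2 (h r h'))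

theorem summable_of_Icc {f : ℤ → ℝ} {a b : ℤ} (h : ∀ r, f r ≠ 0 → a ≤ r ∧ r ≤ b) : Summable f :=
  summable_of_ne_finset_zero (s := Finset.Icc a b)
    fun r hr => by_contra fun h' => hr (Finset.mem_Icc.2 (h r h'))

theorem summable_of_Icc_prod {f : ℤ × ℤ → ℝ} {a b c d : ℤ}
    (h : ∀ r t, f (r, t) ≠ 0 → (a ≤ r ∧ r ≤ b) ∧ c ≤ t ∧ t ≤ d) : Summable f :=
  summable_of_ne_finset_zero (s := Finset.Icc a b ×ˢ Finset.Icc c d)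
    fun r hr => by_contra fun h' => hr (by
      simpa only [Finset.mem_product, Finset.mem_Icc] using h r.1 r.2 h')

/-- A sum over all of ℤ, unlike one over a window around p, can be reindexed by translations. -/
theorem Lattice.pencilBr_eq_tsum (α c : ℝ) (β γ : ι) (x : ι → ℝ) {p : ℤ}
    (hp : G.site β = (p : K)) :
    G.pencilBr m α c β γ x = ∑' r : ℤ, if G.site γ = (r : K) then
        quadBr (Λ.pencil α c x) p (p + G.lev β) r (r + G.lev γ) else 0 := by
  rw [Λ.pencilBr_eq_sum α c β γ x hp]
  refine (tsum_eq_sum_Icc fun r hr => ?_).symm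
  split_ifs at hr with h
  · have := (Λ.isBand_pencil α c x).dist_le_of_ne_zero hr
    omega
  · exact absurd rfl hr

/-- The Hamiltonian vector field of the coordinate `β`, extended to all matrix entries. -/
theorem Lattice.sum_pencilBr_genMat (α c : ℝ) (β : ι) (x : ι → ℝ) {p : ℤ}
    (hp : G.site β = (p : K)) (r s : ℤ) :
    ∑ δ, G.pencilBr m α c β δ x * G.genMat δ r s = ∑' n : ℤ, if (n : K) = 0 then
      quadBr (Λ.pencil α c x) p (p + G.lev β) (r + n) (s + n) else 0 := by
  by_cases h : IsCoord Λ.V m r s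
  · obtain ⟨hr, hs, h1, h2⟩ := h
    obtain ⟨δ, hδ, hδ'⟩ := Λ.exists_label r (s - r).toNat (by omega) hr
      (by rwa [show r + ((s - r).toNat : ℤ) = s by omega])
    rw [Finset.sum_eq_single δ, Λ.pencilBr_eq_tsum α c β δ x hp, Grid.genMat,
      if_pos ⟨hδ', by omega⟩, mul_one, ← (Equiv.addLeft r).tsum_eq]
    · refine tsum_congr fun n => ?_
      have e : (G.site δ = ((r + n : ℤ) : K)) ↔ (n : K) = 0 := by
        rw [hδ']
        push_cast
        simp
      simp only [Equiv.coe_addLeft, e]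
      rw [show r + n + (G.lev δ : ℤ) = s + n by omega]
    · intro γ _ hγ
      have : G.genMat γ r s = 0 := by
        unfold Grid.genMat
        rw [if_neg]
        rintro ⟨h3, h4⟩
        exact hγ (Λ.label_inj _ _ (by omega) (h3.trans hδ'.symm))
      rw [this, mul_zero]
    · simp
  -- The entry (r, s) is constant on the phase space; its brackets vanish because the band matrices
  -- form a Poisson submanifold.
  · rw [Finset.sum_eq_zero fun δ _ => by rw [Λ.genMat_eq_zero h, mul_zero]]
    rw [tsum_congr (g := fun _ => (0 : ℝ)), tsum_zero]
    intro n
    split_ifs with hn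
    · refine (Λ.isBand_pencil α c x).quadBr_eq_zero (fun h' => h ?_) _ _
      obtain ⟨a, b, c, d⟩ := h'
      exact ⟨(Λ.mem_add_iff hn r).1 a, (Λ.mem_add_iff hn s).1 b, by omega, by omega⟩
    · rfl

theorem Lattice.differentiable_pencil (α c : ℝ) (p q : ℤ) (x : ι → ℝ) :
    DifferentiableAt ℝ (fun y => Λ.pencil α c y p q) x := by
  unfold pencil laxMat
  fun_prop

theorem Lattice.pd_pencil (α c : ℝ) (p q : ℤ) (x : ι → ℝ) (δ : ι) :
    pd (fun y => Λ.pencil α c y p q) x δ = G.genMat δ p q := by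
  have h1 : ∀ β : ι, DifferentiableAt ℝ (fun y : ι → ℝ => G.genMat β p q * y β) x := fun β => by
    fun_prop
  have h2 : (fun y => Λ.pencil α c y p q) = fun y : ι → ℝ => (subDiag Λ.V p q + c * relMat Λ.V α p q)
      + ∑ β, G.genMat β p q * y β := by
    funext y
    simp only [pencil, laxMat, mul_comm]
    ring
  rw [h2, pd_add (differentiableAt_const _) (DifferentiableAt.fun_sum fun β _ => h1 β), pd_const,
    pd_sum fun β _ => h1 β, zero_add]
  have h3 : ∀ β, pd (fun y : ι → ℝ => G.genMat β p q * y β) x δ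
      = G.genMat β p q * if δ = β then 1 else 0 := fun β => by
    rw [pd_const_mul (by fun_prop), pd_coord]
  simp [h3]

theorem Lattice.pd_quadBr_pencil (α c : ℝ) (p q r s : ℤ) (x : ι → ℝ) (δ : ι) :
    pd (fun y => quadBr (Λ.pencil α c y) p q r s) x δ
      = swapCoef p q r s * (G.genMat δ r q * Λ.pencil α c x p s
          + Λ.pencil α c x r q * G.genMat δ p s)
        + diagCoef p q r s * (G.genMat δ p q * Λ.pencil α c x r s
          + Λ.pencil α c x p q * G.genMat δ r s) := by
  have d := fun p q => Λ.differentiable_pencil α c p q x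
  simp only [quadBr]
  rw [pd_add (((d _ _).fun_mul (d _ _)).const_mul _) (((d _ _).fun_mul (d _ _)).const_mul _),
    pd_const_mul ((d _ _).fun_mul (d _ _)), pd_const_mul ((d _ _).fun_mul (d _ _)),
    pd_mul (d _ _) (d _ _), pd_mul (d _ _) (d _ _)]
  simp only [Λ.pd_pencil]

end Lattice

end

/-! ### The Jacobi identity of the pencil on the lattice. -/

section

theorem hasSum_congr_real {κ : Type} {f g : κ → ℝ} {a b : ℝ} (h : HasSum f a)
    (hf : ∀ n, g n = f n) (ha : b = a) : HasSum g b := by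
  rw [show g = f from funext hf, ha]
  exact h

section Lattice

variable {ι K : Type} [Fintype ι] [DecidableEq ι] [AddGroupWithOne K] [DecidableEq K]
variable {G : Grid ι K} {m : ℕ} (Λ : Lattice G m)

/-- The double bracket `{x_β, {x_γ, x_ε}}` on the unrolled lattice, with `β` at the row `p`, `γ`
at the row `r` and `ε` at the row `t`. -/
def Lattice.doubleAt (α c : ℝ) (x : ι → ℝ) (β γ ε : ι) (p r t : ℤ) : ℝ :=
  doubleBr (Λ.pencil α c x) p (p + G.lev β) r (r + G.lev γ) t (t + G.lev ε)

theorem Lattice.doubleAt_add (α c : ℝ) (x : ι → ℝ) (β γ ε : ι) (p r t : ℤ) {n : ℤ}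
    (hn : (n : K) = 0) : Λ.doubleAt α c x β γ ε (p + n) (r + n) (t + n)
      = Λ.doubleAt α c x β γ ε p r t := by
  unfold doubleAt
  simp only [add_right_comm _ n]
  exact doubleBr_add (fun p q => Λ.pencil_add α c x hn p q) _ _ _ _ _ _

theorem Lattice.doubleAt_dist {α c : ℝ} {x : ι → ℝ} {β γ ε : ι} {p r t : ℤ}
    (h : Λ.doubleAt α c x β γ ε p r t ≠ 0) :
    (r ≤ p + (4 * m + 4) ∧ p ≤ r + (4 * m + 4)) ∧ (t ≤ p + (4 * m + 4) ∧ p ≤ t + (4 * m + 4)) := by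
  have h1 := Λ.lev_le γ
  have h2 := Λ.lev_le ε
  exact (Λ.isBand_pencil α c x).dist_le_of_doubleBr_ne_zero ⟨by omega, by omega⟩
    ⟨by omega, by omega⟩ h

theorem Lattice.doubleAt_jacobi (α c : ℝ) (x : ι → ℝ) (β γ ε : ι) (p r t : ℤ) :
    Λ.doubleAt α c x β γ ε p r t + Λ.doubleAt α c x γ ε β r t p
      + Λ.doubleAt α c x ε β γ t p r = 0 :=
  doubleBr_jacobi _ _ _ _ _ _ _

theorem Lattice.hasSum_quadBr (α c : ℝ) (β : ι) (x : ι → ℝ) {p : ℤ} (hp : G.site β = (p : K))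
    (r s : ℤ) : HasSum (fun n : ℤ => if (n : K) = 0 then
      quadBr (Λ.pencil α c x) p (p + G.lev β) (r + n) (s + n) else 0)
      (∑ δ, G.pencilBr m α c β δ x * G.genMat δ r s) := by
  rw [Λ.sum_pencilBr_genMat α c β x hp r s]
  refine (summable_of_Icc (a := p - r - (m + 1)) (b := p - r + (m + 1)) fun n hn => ?_).hasSum
  split_ifs at hn with h
  · have := (Λ.isBand_pencil α c x).dist_le_of_ne_zero hn
    omega
  · exact absurd rfl hn

/-- Leibniz rule along the Hamiltonian field of β. Each differentiated entry is a sum over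
translations n, and invariance of L under n moves the undifferentiated factor along, so that both
index pairs are translated together. -/
theorem Lattice.hasSum_doubleBr (α c : ℝ) (β : ι) (x : ι → ℝ) {p : ℤ} (hp : G.site β = (p : K))
    (r s t u : ℤ) :
    HasSum (fun n : ℤ => if (n : K) = 0 then
      doubleBr (Λ.pencil α c x) p (p + G.lev β) (r + n) (s + n) (t + n) (u + n) else 0)
      (∑ δ, G.pencilBr m α c β δ x * pd (fun y => quadBr (Λ.pencil α c y) r s t u) x δ) := by
  have h := Λ.hasSum_quadBr α c β x hp
  set L := Λ.pencil α c x with hL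
  have h1 := ((((h t s).mul_right (L r u)).add ((h r u).mul_left (L t s))).mul_left
    (swapCoef r s t u)).add ((((h r s).mul_right (L t u)).add ((h t u).mul_left (L r s))).mul_left
    (diagCoef r s t u))
  refine hasSum_congr_real h1 (fun n => ?_) ?_
  · split_ifs with hn
    · have hs : ∀ a b, L (a + n) (b + n) = L a b := fun a b => Λ.pencil_add α c x hn a b
      simp only [doubleBr, hs, swapCoef_add, diagCoef_add]
    · ring
  · simp only [Λ.pd_quadBr_pencil, ← hL, Finset.sum_mul, Finset.mul_sum, ← Finset.sum_add_distrib]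
    exact Finset.sum_congr rfl fun δ _ => by ring

theorem Lattice.summable_doubleAt (α c : ℝ) (x : ι → ℝ) (β γ ε : ι) (p : ℤ) :
    Summable fun z : ℤ × ℤ => if G.site γ = (z.1 : K) ∧ G.site ε = (z.2 : K) then
      Λ.doubleAt α c x β γ ε p z.1 z.2 else 0 := by
  refine summable_of_Icc_prod (a := p - (4 * m + 4)) (b := p + (4 * m + 4))
    (c := p - (4 * m + 4)) (d := p + (4 * m + 4)) fun r t h => ?_
  split_ifs at h
  · have := Λ.doubleAt_dist h
    omega
  · exact absurd rfl h

/-- One term of the Jacobiator becomes a sum over all pairs of lifts of γ and ε, with the lift p of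
β fixed. In this form the three terms can be compared summand by summand. -/
theorem Lattice.sum_pd_pencilBr (α c : ℝ) (x : ι → ℝ) (β γ ε : ι) {p : ℤ}
    (hp : G.site β = (p : K)) :
    ∑ δ, G.pencilBr m α c β δ x * pd (G.pencilBr m α c γ ε) x δ
      = ∑' z : ℤ × ℤ, if G.site γ = (z.1 : K) ∧ G.site ε = (z.2 : K) then
        Λ.doubleAt α c x β γ ε p z.1 z.2 else 0 := by
  obtain ⟨r, hr⟩ : ∃ r : ℤ, G.site γ = (r : K) := ⟨Λ.row γ, (Λ.row_cast γ).symm⟩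
  -- A fixed finite window is needed for differentiation under the sum. Twice the bound 4m + 4 is
  -- taken because both rows lie that close to p in a nonzero double bracket.
  have e1 : G.pencilBr m α c γ ε = fun y => ∑ t ∈ Finset.Icc (r - (8 * m + 8)) (r + (8 * m + 8)),
      if G.site ε = (t : K) then
        quadBr (Λ.pencil α c y) r (r + G.lev γ) t (t + G.lev ε) else 0 := by
    funext y
    rw [Λ.pencilBr_eq_tsum α c γ ε y hr]
    refine tsum_eq_sum_Icc fun t ht => ?_
    split_ifs at ht
    · have := (Λ.isBand_pencil α c y).dist_le_of_ne_zero ht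
      omega
    · exact absurd rfl ht
  have dq : ∀ p q r s, DifferentiableAt ℝ (fun y => quadBr (Λ.pencil α c y) p q r s) x := by
    intro p q r s
    have d := fun p q => Λ.differentiable_pencil α c p q x
    exact (((d _ _).fun_mul (d _ _)).const_mul _).fun_add (((d _ _).fun_mul (d _ _)).const_mul _)
  set g : ℤ × ℤ → ℝ := fun z => if G.site ε = (z.1 : K) ∧ (z.2 : K) = 0 then
    Λ.doubleAt α c x β γ ε p (r + z.2) (z.1 + z.2) else 0 with hg
  -- A lift t of ε relative to the fixed lift r of γ, together with a common translation n, amounts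
  -- to an arbitrary pair of lifts.
  set e : ℤ × ℤ ≃ ℤ × ℤ :=
    { toFun := fun z => (r + z.2, z.1 + z.2)
      invFun := fun z => (z.2 - (z.1 - r), z.1 - r)
      left_inv := fun z => by ext <;> (dsimp only; ring)
      right_inv := fun z => by ext <;> (dsimp only; ring) } with he
  set f : ℤ × ℤ → ℝ := fun z => if G.site γ = (z.1 : K) ∧ G.site ε = (z.2 : K) then
    Λ.doubleAt α c x β γ ε p z.1 z.2 else 0 with hf
  have hge : ∀ z, g z = f (e z) := by
    rintro ⟨t, n⟩
    simp only [hg, hf, he, Equiv.coe_fn_mk]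
    refine if_congr ?_ rfl rfl
    rw [hr]
    push_cast
    constructor
    · rintro ⟨h1, h2⟩
      rw [h2, add_zero, add_zero]
      exact ⟨rfl, h1⟩
    · rintro ⟨h1, h2⟩
      have h3 : (n : K) = 0 := by simpa using h1.symm
      rw [h3, add_zero] at h2
      exact ⟨h2, h3⟩
  have sg : Summable g := by
    rw [show g = f ∘ e from funext hge, e.summable_iff]
    exact Λ.summable_doubleAt α c x β γ ε p
  have e2 : ∀ t, (∑' n, g (t, n)) = if G.site ε = (t : K) then
      ∑ δ, G.pencilBr m α c β δ x
        * pd (fun y => quadBr (Λ.pencil α c y) r (r + G.lev γ) t (t + G.lev ε)) x δ else 0 := by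
    intro t
    by_cases ht : G.site ε = (t : K)
    · rw [if_pos ht, ← (Λ.hasSum_doubleBr α c β x hp r (r + G.lev γ) t (t + G.lev ε)).tsum_eq]
      refine tsum_congr fun n => ?_
      simp only [hg, ht, true_and, doubleAt, add_right_comm _ _ n]
    · rw [if_neg ht]
      simp [hg, ht]
  calc _ = ∑ t ∈ Finset.Icc (r - (8 * m + 8)) (r + (8 * m + 8)), ∑' n, g (t, n) := by
        rw [e1]
        simp only [e2]
        have hpd : ∀ δ, pd (fun y => ∑ t ∈ Finset.Icc (r - (8 * m + 8)) (r + (8 * m + 8)),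
            if G.site ε = (t : K) then
            quadBr (Λ.pencil α c y) r (r + G.lev γ) t (t + G.lev ε) else 0) x δ
            = ∑ t ∈ Finset.Icc (r - (8 * m + 8)) (r + (8 * m + 8)), if G.site ε = (t : K) then
              pd (fun y => quadBr (Λ.pencil α c y) r (r + G.lev γ) t (t + G.lev ε)) x δ else 0 := by
          intro δ
          rw [pd_sum]
          · refine Finset.sum_congr rfl fun t _ => ?_
            split_ifs
            · rfl
            · exact pd_const _ _ _
          · intro t _
            split_ifs
            · exact dq _ _ _ _
            · exact differentiableAt_const _
        simp only [hpd, Finset.mul_sum]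
        rw [Finset.sum_comm]
        refine Finset.sum_congr rfl fun t _ => ?_
        split_ifs
        · rfl
        · simp
    _ = ∑' t, ∑' n, g (t, n) := by
        refine (tsum_eq_sum_Icc fun t ht => ?_).symm
        by_contra hcon
        apply ht
        rw [tsum_congr (g := fun _ => (0 : ℝ)), tsum_zero]
        intro n
        by_contra hn
        simp only [hg] at hn
        split_ifs at hn
        · have := Λ.doubleAt_dist hn
          omega
        · exact hn rfl
    _ = ∑' z, g z := (sg.tsum_prod).symm
    _ = _ := by
        rw [← e.tsum_eq f]
        exact tsum_congr hge

/-- Translations move the site that is kept fixed. -/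
theorem Lattice.tsum_doubleAt_cycle (α c : ℝ) (x : ι → ℝ) (β γ ε : ι) {p r : ℤ}
    (hp : G.site β = (p : K)) (hr : G.site γ = (r : K)) :
    HasSum (fun z : ℤ × ℤ => if G.site γ = (z.1 : K) ∧ G.site ε = (z.2 : K) then
        Λ.doubleAt α c x γ ε β z.1 z.2 p else 0)
      (∑' z : ℤ × ℤ, if G.site ε = (z.1 : K) ∧ G.site β = (z.2 : K) then
        Λ.doubleAt α c x γ ε β r z.1 z.2 else 0) := by
  -- Each summand is translated by r minus the row of γ, so that γ comes to rest at r while the row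
  -- of β starts to vary.
  set e : ℤ × ℤ ≃ ℤ × ℤ :=
    { toFun := fun z => (z.2 + (r - z.1), p + (r - z.1))
      invFun := fun z => (p + r - z.2, z.1 - (z.2 - p))
      left_inv := fun z => by ext <;> (dsimp only; ring)
      right_inv := fun z => by ext <;> (dsimp only; ring) } with he
  rw [← e.tsum_eq]
  have h := (e.summable_iff.2 (Λ.summable_doubleAt α c x γ ε β r)).hasSum
  refine hasSum_congr_real h (fun z => ?_) rfl
  obtain ⟨a, t⟩ := z
  simp only [he, Equiv.coe_fn_mk, Function.comp]
  by_cases ha : G.site γ = (a : K)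
  · have hn : ((r - a : ℤ) : K) = 0 := by
      push_cast
      rw [← ha, ← hr, sub_self]
    have e1 : (G.site ε = ((t + (r - a) : ℤ) : K) ∧ G.site β = ((p + (r - a) : ℤ) : K))
        ↔ (G.site γ = (a : K) ∧ G.site ε = (t : K)) := by
      rw [Int.cast_add, Int.cast_add, hn, add_zero, add_zero]
      exact ⟨fun h => ⟨ha, h.1⟩, fun h => ⟨h.2, hp⟩⟩
    refine if_congr e1.symm ?_ rfl
    rw [← Λ.doubleAt_add α c x γ ε β a t p hn, add_sub_cancel]
  · rw [if_neg (fun h => ha h.1), if_neg]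
    rintro ⟨-, h2⟩
    apply ha
    rw [hp, Int.cast_add] at h2
    have h3 : ((r - a : ℤ) : K) = 0 := by simpa using h2.symm
    rw [hr]
    push_cast at h3
    exact sub_eq_zero.1 h3

theorem Lattice.tsum_doubleAt_cycle' (α c : ℝ) (x : ι → ℝ) (β γ ε : ι) {p t : ℤ}
    (hp : G.site β = (p : K)) (ht : G.site ε = (t : K)) :
    HasSum (fun z : ℤ × ℤ => if G.site γ = (z.1 : K) ∧ G.site ε = (z.2 : K) then
        Λ.doubleAt α c x ε β γ z.2 p z.1 else 0)
      (∑' z : ℤ × ℤ, if G.site β = (z.1 : K) ∧ G.site γ = (z.2 : K) then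
        Λ.doubleAt α c x ε β γ t z.1 z.2 else 0) := by
  set e : ℤ × ℤ ≃ ℤ × ℤ :=
    { toFun := fun z => (p + (t - z.2), z.1 + (t - z.2))
      invFun := fun z => (z.2 - (z.1 - p), p + t - z.1)
      left_inv := fun z => by ext <;> (dsimp only; ring)
      right_inv := fun z => by ext <;> (dsimp only; ring) } with he
  rw [← e.tsum_eq]
  have h := (e.summable_iff.2 (Λ.summable_doubleAt α c x ε β γ t)).hasSum
  refine hasSum_congr_real h (fun z => ?_) rfl
  obtain ⟨r, a⟩ := z
  simp only [he, Equiv.coe_fn_mk, Function.comp]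
  by_cases ha : G.site ε = (a : K)
  · have hn : ((t - a : ℤ) : K) = 0 := by
      push_cast
      rw [← ha, ← ht, sub_self]
    have e1 : (G.site β = ((p + (t - a) : ℤ) : K) ∧ G.site γ = ((r + (t - a) : ℤ) : K))
        ↔ (G.site γ = (r : K) ∧ G.site ε = (a : K)) := by
      rw [Int.cast_add, Int.cast_add, hn, add_zero, add_zero]
      exact ⟨fun h => ⟨h.2, ha⟩, fun h => ⟨hp, h.1⟩⟩
    refine if_congr e1.symm ?_ rfl
    rw [← Λ.doubleAt_add α c x ε β γ a p r hn, add_sub_cancel]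
  · rw [if_neg (fun h => ha h.2), if_neg]
    rintro ⟨h2, -⟩
    apply ha
    rw [hp, Int.cast_add] at h2
    have h3 : ((t - a : ℤ) : K) = 0 := by simpa using h2.symm
    rw [ht]
    push_cast at h3
    exact sub_eq_zero.1 h3

/-- After the translations all three terms are sums over the same lifts of γ and ε with β fixed, and
the summands cancel by `doubleBr_jacobi`. -/
theorem Lattice.jacobiator_pencilBr (Λ : Lattice G m) (α c : ℝ) (β γ ε : ι) (x : ι → ℝ) :
    jacobiator (G.pencilBr m α c) (G.pencilBr m α c) β γ ε x = 0 := by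
  have hβ := (Λ.row_cast β).symm
  have hγ := (Λ.row_cast γ).symm
  have hε := (Λ.row_cast ε).symm
  rw [jacobiator, Finset.sum_add_distrib, Finset.sum_add_distrib,
    Λ.sum_pd_pencilBr α c x β γ ε hβ, Λ.sum_pd_pencilBr α c x γ ε β hγ,
    Λ.sum_pd_pencilBr α c x ε β γ hε]
  have h1 := (Λ.summable_doubleAt α c x β γ ε (Λ.row β)).hasSum
  have h2 := Λ.tsum_doubleAt_cycle α c x β γ ε hβ hγ
  have h3 := Λ.tsum_doubleAt_cycle' α c x β γ ε hβ hε
  refine ((h1.add h2).add h3).unique ?_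
  convert hasSum_zero with z
  split_ifs
  · exact Λ.doubleAt_jacobi α c x β γ ε _ _ _
  · ring

/-- The linear and the quadratic bracket are compatible Poisson brackets. -/
theorem Lattice.areCompatible (Λ : Lattice G m) (α : ℝ) :
    AreCompatible (bracket (G.lin m α)) (bracket (G.quad m)) :=
  areCompatible_of_pencil (G.contDiff_quad m) (G.contDiff_lin m α)
    (fun β γ x => G.structFn_swap m _ β γ x) (fun β γ x => G.structFn_swap m _ β γ x)
    (fun c β γ ε x => Λ.jacobiator_pencilBr α c β γ ε x)

end Lattice

end

/-! ### Realization of the algebras by matrices indexed by ℤ × ℤ. -/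

section

section Model

variable {ι K : Type} [Fintype ι] [DecidableEq ι] [AddGroupWithOne K] [DecidableEq K]
variable {G : Grid ι K} {m : ℕ}

/-- A realization of an algebra `A` by matrices with rows and columns in `ℤ`, invariant under the
translations in the kernel of `ℤ → K` and supported on `V × V`.  The entry `(p, q)` has degree
`p - q`, and `τ * degree` is bounded below on every element. -/
structure Model (Λ : Lattice G m) (A : Type) [Ring A] [Algebra ℝ A] where
  U : A →ₗ[ℝ] (ℤ → ℤ → ℝ)
  inj : Function.Injective U
  τ : ℤ
  sign : τ = 1 ∨ τ = -1
  off_row : ∀ X p q, p ∉ Λ.V → U X p q = 0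
  off_col : ∀ X p q, q ∉ Λ.V → U X p q = 0
  shift : ∀ X p q (n : ℤ), (n : K) = 0 → U X (p + n) (q + n) = U X p q
  bdd : ∀ X, ∃ d : ℤ, ∀ p q, τ * (p - q) < -d → U X p q = 0
  one : U 1 = diagMat Λ.V
  mul : ∀ X Y p q, U (X * Y) p q = ∑ᶠ r, U X p r * U Y r q
  realize : ∀ g : ℤ → ℤ → ℝ, (∀ p q, p ∉ Λ.V ∨ q ∉ Λ.V → g p q = 0) →
    (∀ p q (n : ℤ), (n : K) = 0 → g (p + n) (q + n) = g p q) →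
    (∃ d : ℤ, ∀ p q, τ * (p - q) < -d → g p q = 0) → ∃ X, U X = g
  reps : Finset ℤ
  reps_unique : ∀ p : ℤ, p ∈ Λ.V → ∃! k, k ∈ reps ∧ (k : K) = (p : K)
  pair : A → A → ℝ
  pair_eq : ∀ X Y, pair X Y = ∑ k ∈ reps, U (X * Y) k k
  pair_comm : ∀ X Y, pair X Y = pair Y X
  E : A
  U_E : U E = subDiag Λ.V
  gen : ι → A
  U_gen : ∀ β, U (gen β) = G.genMat β
  R : A → A
  U_R : ∀ X p q, U (R X) p q = if q ≤ p then U X p q else - U X p q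

namespace Model

variable {Λ : Lattice G m} {A : Type} [Ring A] [Algebra ℝ A] (M : Model Λ A)

/-- The Lax matrix. -/
def T (x : ι → ℝ) : A := M.E + ∑ β, x β • M.gen β

/-- `F = I - α E`. -/
def F (α : ℝ) : A := 1 - α • M.E

theorem ext {X Y : A} (h : ∀ p q, M.U X p q = M.U Y p q) : X = Y :=
  M.inj (funext fun p => funext fun q => h p q)

theorem U_add (X Y : A) (p q : ℤ) : M.U (X + Y) p q = M.U X p q + M.U Y p q := by
  rw [map_add]; rfl

theorem U_sub (X Y : A) (p q : ℤ) : M.U (X - Y) p q = M.U X p q - M.U Y p q := by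
  rw [map_sub]; rfl

theorem U_smul (c : ℝ) (X : A) (p q : ℤ) : M.U (c • X) p q = c * M.U X p q := by
  rw [map_smul]; rfl

theorem U_sum {κ : Type*} (s : Finset κ) (f : κ → A) (p q : ℤ) :
    M.U (∑ i ∈ s, f i) p q = ∑ i ∈ s, M.U (f i) p q := by
  rw [map_sum, Finset.sum_apply, Finset.sum_apply]

theorem U_zero (p q : ℤ) : M.U 0 p q = 0 := by
  rw [map_zero]; rfl

theorem U_T (x : ι → ℝ) (p q : ℤ) : M.U (M.T x) p q = Λ.laxMat x p q := by
  simp only [T, U_add, U_sum, U_smul, M.U_E, M.U_gen, Lattice.laxMat]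

theorem U_F (α : ℝ) (p q : ℤ) : M.U (M.F α) p q = relMat Λ.V α p q := by
  simp only [F, U_sub, U_smul, M.one, M.U_E, relMat]

theorem mul_sum {X Y : A} {p q : ℤ} (S : Finset ℤ) (h : ∀ r, r ∉ S → M.U X p r * M.U Y r q = 0) :
    M.U (X * Y) p q = ∑ r ∈ S, M.U X p r * M.U Y r q := by
  rw [M.mul]
  refine finsum_eq_sum_of_support_subset _ fun r hr => ?_
  by_contra h'
  exact hr (h r h')

theorem U_E_mul (X : A) {p : ℤ} (hp : p ∈ Λ.V) (q : ℤ) : M.U (M.E * X) p q = M.U X (p - 1) q := by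
  rw [M.mul_sum {p - 1}, Finset.sum_singleton, M.U_E]
  · by_cases h : p - 1 ∈ Λ.V
    · simp [subDiag, hp, h]
    · rw [M.off_row X _ _ h, mul_zero]
  · intro r hr
    rw [Finset.mem_singleton] at hr
    simp [M.U_E, subDiag, hr]

theorem U_mul_E (X : A) (p : ℤ) {q : ℤ} (hq : q ∈ Λ.V) : M.U (X * M.E) p q = M.U X p (q + 1) := by
  rw [M.mul_sum {q + 1}, Finset.sum_singleton, M.U_E]
  · by_cases h : q + 1 ∈ Λ.V
    · simp [subDiag, hq, h]
    · rw [M.off_col X _ _ h, zero_mul]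
  · intro r hr
    rw [Finset.mem_singleton] at hr
    have : q ≠ r - 1 := by omega
    simp [M.U_E, subDiag, this]

theorem U_F_mul (α : ℝ) (X : A) {p : ℤ} (hp : p ∈ Λ.V) (q : ℤ) :
    M.U (M.F α * X) p q = M.U X p q - α * M.U X (p - 1) q := by
  rw [F, sub_mul, one_mul, U_sub, smul_mul_assoc, U_smul, M.U_E_mul X hp]

theorem U_mul_F (α : ℝ) (X : A) (p : ℤ) {q : ℤ} (hq : q ∈ Λ.V) :
    M.U (X * M.F α) p q = M.U X p q - α * M.U X p (q + 1) := by
  rw [F, mul_sub, mul_one, U_sub, mul_smul_comm, U_smul, M.U_mul_E X p hq]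

theorem U_T_mul (x : ι → ℝ) (X : A) {p q : ℤ} {S : Finset ℤ}
    (hS : ∀ r, p - 1 ≤ r → r ≤ p + m → r ∈ S) :
    M.U (M.T x * X) p q = ∑ r ∈ S, Λ.laxMat x p r * M.U X r q := by
  rw [M.mul_sum S]
  · simp only [U_T]
  · intro r hr
    have hb := Λ.isBand_laxMat x
    rw [U_T]
    by_cases h1 : r < p - 1
    · rw [hb.lower _ _ h1, zero_mul]
    · rw [hb.upper _ _ (by_contra fun h2 => hr (hS r (by omega) (by omega))), zero_mul]

theorem U_mul_T (x : ι → ℝ) (X : A) {p q : ℤ} {S : Finset ℤ}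
    (hS : ∀ r, q - m ≤ r → r ≤ q + 1 → r ∈ S) :
    M.U (X * M.T x) p q = ∑ r ∈ S, M.U X p r * Λ.laxMat x r q := by
  rw [M.mul_sum S]
  · simp only [U_T]
  · intro r hr
    have hb := Λ.isBand_laxMat x
    rw [U_T]
    by_cases h1 : q < r - 1
    · rw [hb.lower _ _ h1, mul_zero]
    · rw [hb.upper _ _ (by_contra fun h2 => hr (hS r (by omega) (by omega))), mul_zero]

/-- Pairing with the matrix unit at `(p, q)`. -/
theorem pair_unit {p q : ℤ} (hq : q ∈ Λ.V) {Z : A} (hZ : ∀ a b, M.U Z a b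
    = if (a : K) = (p : K) ∧ a - p = b - q then 1 else 0) (X : A) : M.pair X Z = M.U X q p := by
  rw [M.pair_eq]
  obtain ⟨k, ⟨hk, hk'⟩, huniq⟩ := M.reps_unique q hq
  have e : ∀ l, M.U (X * Z) l l = if (l : K) = (q : K) then M.U X l (p + l - q) else 0 := by
    intro l
    rw [M.mul_sum {p + l - q}, Finset.sum_singleton, hZ]
    · have : (((p + l - q : ℤ) : K) = (p : K)) ↔ ((l : K) = (q : K)) := by
        rw [show p + l - q = p + (l - q) by ring]
        push_cast
        rw [add_eq_left, sub_eq_zero]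
      by_cases h : (l : K) = (q : K)
      · rw [if_pos ⟨this.2 h, by ring⟩, if_pos h, mul_one]
      · rw [if_neg (fun h' => h (this.1 h'.1)), if_neg h, mul_zero]
    · intro r hr
      rw [Finset.mem_singleton] at hr
      rw [hZ, if_neg (fun h => hr (by omega)), mul_zero]
  rw [Finset.sum_eq_single k, e, if_pos hk']
  · have := M.shift X q p (k - q) (by push_cast; rw [hk', sub_self])
    rwa [show q + (k - q) = k by ring, show p + (k - q) = p + k - q by ring] at this
  · intro l hl hne
    rw [e, if_neg]
    exact fun h => hne (huniq l ⟨hl, h⟩)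
  · exact fun h => absurd hk h

theorem pair_gen (X : A) {β : ι} {p : ℤ} (hp : G.site β = (p : K)) :
    M.pair X (M.gen β) = M.U X (p + G.lev β) p := by
  refine M.pair_unit (Λ.mem_of_site hp).2 (fun a b => ?_) X
  rw [M.U_gen, Grid.genMat, hp]
  refine if_congr (and_congr eq_comm ?_) rfl rfl
  constructor <;> intro <;> omega

theorem exists_unit {p q : ℤ} (hp : p ∈ Λ.V) (hq : q ∈ Λ.V) : ∃ Z : A, ∀ a b, M.U Z a b
    = if (a : K) = (p : K) ∧ a - p = b - q then 1 else 0 := by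
  suffices h : ∃ Z : A, M.U Z = fun a b : ℤ =>
      if (a : K) = (p : K) ∧ a - p = b - q then (1 : ℝ) else 0 by
    obtain ⟨Z, hZ⟩ := h
    exact ⟨Z, fun a b => by rw [hZ]⟩
  refine M.realize _ ?_ ?_ ?_
  · rintro a b h
    refine if_neg fun h' => ?_
    have h2 : ((a - p : ℤ) : K) = 0 := by push_cast; rw [h'.1, sub_self]
    have h3 : (a : ℤ) = p + (a - p) := by ring
    have h4 : b = q + (a - p) := by omega
    rcases h with h | h
    · rw [h3, Λ.mem_add_iff h2] at h
      exact h hp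
    · rw [h4, Λ.mem_add_iff h2] at h
      exact h hq
  · intro a b n hn
    refine if_congr (and_congr ?_ ?_) rfl rfl
    · push_cast
      rw [hn, add_zero]
    · constructor <;> intro <;> omega
  · refine ⟨|p - q|, fun a b h => if_neg fun h' => ?_⟩
    rcases M.sign with hs | hs <;> rw [hs] at h <;>
    rcases abs_cases (p - q) with h1 | h1 <;> omega

/-- The sum of all translates of a matrix unit belongs to the algebra, and pairing with it reads off
one entry. -/
theorem eq_of_pair {X Y : A} (h : ∀ Z, M.pair X Z = M.pair Y Z) : X = Y := by
  refine M.ext fun p q => ?_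
  by_cases hp : p ∈ Λ.V
  swap
  · rw [M.off_row _ _ _ hp, M.off_row _ _ _ hp]
  by_cases hq : q ∈ Λ.V
  swap
  · rw [M.off_col _ _ _ hq, M.off_col _ _ _ hq]
  obtain ⟨Z, hZ⟩ := M.exists_unit hq hp
  rw [← M.pair_unit hp hZ X, ← M.pair_unit hp hZ Y, h]

theorem pair_mul_left (X Y Z : A) : M.pair (X * Y) Z = M.pair X (Y * Z) := by
  rw [M.pair_eq, M.pair_eq, mul_assoc]

theorem pair_mul_right (X Y Z : A) : M.pair X (Y * Z) = M.pair (Z * X) Y := by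
  rw [← pair_mul_left, M.pair_comm, pair_mul_left]

theorem pair_add_left (X Y Z : A) : M.pair (X + Y) Z = M.pair X Z + M.pair Y Z := by
  simp only [M.pair_eq, add_mul, U_add, Finset.sum_add_distrib]

theorem pair_add_right (X Y Z : A) : M.pair X (Y + Z) = M.pair X Y + M.pair X Z := by
  simp only [M.pair_eq, mul_add, U_add, Finset.sum_add_distrib]

theorem pair_smul_left (c : ℝ) (X Z : A) : M.pair (c • X) Z = c * M.pair X Z := by
  simp only [M.pair_eq, smul_mul_assoc, U_smul, Finset.mul_sum]

theorem pair_smul_right (c : ℝ) (X Z : A) : M.pair X (c • Z) = c * M.pair X Z := by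
  simp only [M.pair_eq, mul_smul_comm, U_smul, Finset.mul_sum]

theorem pair_zero_left (Z : A) : M.pair 0 Z = 0 := by
  simp only [M.pair_eq, zero_mul, U_zero, Finset.sum_const_zero]

theorem pair_sum_left {κ : Type*} (s : Finset κ) (f : κ → A) (Z : A) :
    M.pair (∑ i ∈ s, f i) Z = ∑ i ∈ s, M.pair (f i) Z := by
  simp only [M.pair_eq, Finset.sum_mul, U_sum]
  rw [Finset.sum_comm]

end Model

theorem sum_telescope (f : ℤ → ℝ) {r s : ℤ} (h : r ≤ s + 1) :
    ∑ p ∈ Finset.Icc r s, (f (p + 1) - f p) = f (s + 1) - f r := by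
  obtain ⟨n, hn⟩ : ∃ n : ℕ, s + 1 = r + n := ⟨(s + 1 - r).toNat, by omega⟩
  have h1 : ∑ p ∈ Finset.Icc r s, (f (p + 1) - f p)
      = ∑ i ∈ Finset.range n, (f (r + (i + 1 : ℕ)) - f (r + i)) := by
    refine Finset.sum_nbij' (fun p => (p - r).toNat) (fun i => r + i) ?_ ?_ ?_ ?_ ?_
    · intro p hp
      simp only [Finset.mem_Icc, Finset.mem_range] at hp ⊢
      omega
    · intro p hp
      simp only [Finset.mem_Icc, Finset.mem_range] at hp ⊢
      omega
    · intro p hp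
      simp only [Finset.mem_Icc] at hp
      omega
    · intro p hp
      omega
    · intro p hp
      simp only [Finset.mem_Icc] at hp
      congr 2 <;> omega
  rw [h1, Finset.sum_range_sub (fun i : ℕ => f (r + i)), hn]
  simp

theorem Lattice.sum_genMat {Λ : Lattice G m} {p q : ℤ} (h : IsCoord Λ.V m p q) :
    ∑ γ, G.genMat γ p q = 1 := by
  obtain ⟨hp, hq, h1, h2⟩ := h
  obtain ⟨δ, hδ, hδ'⟩ := Λ.exists_label p (q - p).toNat (by omega) hp
    (by rwa [show p + ((q - p).toNat : ℤ) = q by omega])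
  rw [Finset.sum_eq_single δ, Grid.genMat, if_pos ⟨hδ', by omega⟩]
  · intro γ _ hγ
    unfold Grid.genMat
    rw [if_neg]
    rintro ⟨h3, h4⟩
    exact hγ (Λ.label_inj _ _ (by omega) (h3.trans hδ'.symm))
  · simp

theorem Lattice.quad_eq_sum' (Λ : Lattice G m) (β γ : ι) (x : ι → ℝ) {r : ℤ}
    (hr : G.site β = (r : K)) :
    G.quad m γ β x = ∑ p ∈ Finset.Icc (r - (m + 1)) (r + (m + 1)), if G.site γ = (p : K) then
      quadBr (Λ.laxMat x) p (p + G.lev γ) r (r + G.lev β) else 0 := by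
  rw [Grid.quad, Grid.structFn_swap, ← Grid.quad, Λ.quad_eq_sum β γ x hr, ← Finset.sum_neg_distrib]
  refine Finset.sum_congr rfl fun p _ => ?_
  split_ifs
  · rw [← quadBr_swap]
  · exact neg_zero

/-- The `β`-component of a Hamiltonian vector field, as a sum over the unrolled lattice. -/
theorem Lattice.sum_quad_mul (Λ : Lattice G m) (x : ι → ℝ) (β : ι) {r : ℤ}
    (hr : G.site β = (r : K)) {X : ℤ → ℤ → ℝ} {ξ : ι → ℝ}
    (hξ : ∀ γ (p : ℤ), G.site γ = (p : K) → ξ γ = X (p + G.lev γ) p) {S : Finset ℤ}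
    (hS : ∀ p, r - (2 * m + 1) ≤ p → p ≤ r + (2 * m + 1) → p ∈ S) :
    ∑ γ, G.quad m γ β x * ξ γ
      = ∑ p ∈ S, ∑ q ∈ S, X q p * quadBr (Λ.laxMat x) p q r (r + G.lev β) := by
  have hb := Λ.isBand_laxMat x
  calc _ = ∑ p ∈ Finset.Icc (r - (m + 1)) (r + (m + 1)), ∑ q ∈ S,
        X q p * quadBr (Λ.laxMat x) p q r (r + G.lev β) := by
        simp only [Λ.quad_eq_sum' β _ x hr, Finset.sum_mul]
        rw [Finset.sum_comm]
        refine Finset.sum_congr rfl fun p hp => ?_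
        rw [Finset.mem_Icc] at hp
        have e : ∀ γ, (if G.site γ = (p : K) then
            quadBr (Λ.laxMat x) p (p + G.lev γ) r (r + G.lev β) else 0) * ξ γ
            = ∑ q ∈ S, G.genMat γ p q * (X q p * quadBr (Λ.laxMat x) p q r (r + G.lev β)) := by
          intro γ
          have hl := Λ.lev_le γ
          by_cases h : G.site γ = (p : K)
          · rw [if_pos h, hξ γ p h, Finset.sum_eq_single (p + (G.lev γ : ℤ))]
            · rw [Grid.genMat, if_pos ⟨h, rfl⟩]
              ring
            · intro q _ hq
              rw [Grid.genMat, if_neg (fun h' => hq h'.2), zero_mul]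
            · intro h'
              by_cases h0 : quadBr (Λ.laxMat x) p (p + G.lev γ) r (r + G.lev β) = 0
              · rw [h0]
                ring
              · have := hb.dist_le_of_ne_zero h0
                have h2 := (hb.isCoord_of_ne_zero h0).2
                obtain ⟨-, -, h3, h4⟩ := h2
                refine absurd (hS _ ?_ ?_) h' <;> omega
          · rw [if_neg h, zero_mul]
            refine (Finset.sum_eq_zero fun q _ => ?_).symm
            rw [Grid.genMat, if_neg (fun h' => h h'.1), zero_mul]
        simp only [e]
        rw [Finset.sum_comm]
        refine Finset.sum_congr rfl fun q _ => ?_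
        rw [← Finset.sum_mul]
        by_cases h : IsCoord Λ.V m p q
        · rw [Λ.sum_genMat h, one_mul]
        · rw [hb.quadBr_eq_zero' h, mul_zero, mul_zero]
    _ = _ := by
        refine Finset.sum_subset (fun p hp => ?_) fun p _ hp => ?_
        · rw [Finset.mem_Icc] at hp
          exact hS p (by omega) (by omega)
        · refine Finset.sum_eq_zero fun q _ => ?_
          by_cases h0 : quadBr (Λ.laxMat x) p q r (r + G.lev β) = 0
          · rw [h0, mul_zero]
          · refine absurd ?_ hp
            have := hb.dist_le_of_ne_zero h0
            rw [Finset.mem_Icc]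
            omega

end Model

end

/-! ### Lax equations as Hamiltonian vector fields. -/

section

variable {ι K : Type} [Fintype ι] [DecidableEq ι] [AddGroupWithOne K] [DecidableEq K]
variable {G : Grid ι K} {m : ℕ}

/-- The quadratic bracket with an arbitrary covector, in terms of `T X` and `X T`. -/
theorem sum_mul_quadBr {V : Set ℤ} {L X TX XT : ℤ → ℤ → ℝ} (hb : IsBand V m 1 L) {r s : ℤ}
    {S : Finset ℤ} (hr : ∀ p, r - (2 * m + 2) ≤ p → p ≤ r + (2 * m + 2) → p ∈ S)
    (hs : ∀ p, s - (2 * m + 2) ≤ p → p ≤ s + (2 * m + 2) → p ∈ S)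
    (hTX : ∀ p q : ℤ, (∀ l : ℤ, p - 1 ≤ l → l ≤ p + m → l ∈ S) → TX p q = ∑ l ∈ S, L p l * X l q)
    (hXT : ∀ p q : ℤ, (∀ l : ℤ, q - m ≤ l → l ≤ q + 1 → l ∈ S) → XT p q = ∑ l ∈ S, X p l * L l q) :
    ∑ p ∈ S, ∑ q ∈ S, X q p * quadBr L p q r s
      = (∑ p ∈ S, (if r < p then 1 else 0) * TX r p * L p s)
        - (∑ q ∈ S, L r q * ((if q < s then 1 else 0) * XT q s))
        + L r s * ∑ p ∈ Finset.Icc r s, (TX p p - XT p p) := by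
  have e1 : ∑ p ∈ S, (if r < p then 1 else 0) * TX r p * L p s
      = ∑ p ∈ S, ∑ q ∈ S, X q p * ((if r < p then 1 else 0) * (L r q * L p s)) := by
    refine Finset.sum_congr rfl fun p _ => ?_
    rw [hTX r p (fun l _ _ => hr l (by omega) (by omega)), Finset.mul_sum, Finset.sum_mul]
    exact Finset.sum_congr rfl fun q _ => by ring
  have e2 : ∑ q ∈ S, L r q * ((if q < s then 1 else 0) * XT q s)
      = ∑ p ∈ S, ∑ q ∈ S, X q p * ((if q < s then 1 else 0) * (L r q * L p s)) := by
    rw [Finset.sum_comm]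
    refine Finset.sum_congr rfl fun q _ => ?_
    rw [hXT q s (fun l _ _ => hs l (by omega) (by omega)), Finset.mul_sum, Finset.mul_sum]
    exact Finset.sum_congr rfl fun p _ => by ring
  have e3 : L r s * ∑ p ∈ Finset.Icc r s, (TX p p - XT p p)
      = ∑ p ∈ S, ∑ q ∈ S, X q p * (((if p ≤ s then 1 else 0) - (if q ≤ s then 1 else 0)
        - (if p < r then 1 else 0) + (if q < r then 1 else 0)) * (L p q * L r s)) := by
    by_cases h1 : s < r - 1
    · rw [hb.lower r s h1, zero_mul]
      exact (Finset.sum_eq_zero fun p _ => Finset.sum_eq_zero fun q _ => by ring).symm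
    by_cases h2 : r + m < s
    · rw [hb.upper r s h2, zero_mul]
      exact (Finset.sum_eq_zero fun p _ => Finset.sum_eq_zero fun q _ => by ring).symm
    -- The difference of indicators is the indicator of [r, s] only for s ≥ r - 1; smaller s was
    -- excluded above, where L_rs = 0.
    have hI : ∀ f : ℤ → ℝ, ∑ p ∈ Finset.Icc r s, f p
        = ∑ p ∈ S, ((if p ≤ s then 1 else 0) - (if p < r then 1 else 0)) * f p := by
      intro f
      trans ∑ p ∈ Finset.Icc r s, ((if p ≤ s then 1 else 0) - (if p < r then 1 else 0)) * f p
      · refine Finset.sum_congr rfl fun p hp => ?_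
        rw [Finset.mem_Icc] at hp
        rw [if_pos hp.2, if_neg (by omega)]
        ring
      · refine Finset.sum_subset (fun p hp => ?_) fun p _ hp => ?_
        · rw [Finset.mem_Icc] at hp
          exact hr p (by omega) (by omega)
        · rw [Finset.mem_Icc] at hp
          split_ifs <;> first | omega | ring
    have a1 : ∑ p ∈ Finset.Icc r s, TX p p = ∑ p ∈ S, ∑ q ∈ S,
        X q p * (((if p ≤ s then 1 else 0) - (if p < r then 1 else 0)) * L p q) := by
      rw [Finset.sum_congr rfl (g := fun p => ∑ q ∈ S, L p q * X q p) (fun p hp => hTX p p ?_), hI]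
      · refine Finset.sum_congr rfl fun p _ => ?_
        rw [Finset.mul_sum]
        exact Finset.sum_congr rfl fun q _ => by ring
      · rw [Finset.mem_Icc] at hp
        exact fun l _ _ => hr l (by omega) (by omega)
    have a2 : ∑ p ∈ Finset.Icc r s, XT p p = ∑ p ∈ S, ∑ q ∈ S,
        X q p * (((if q ≤ s then 1 else 0) - (if q < r then 1 else 0)) * L p q) := by
      rw [Finset.sum_congr rfl (g := fun p => ∑ l ∈ S, X p l * L l p) (fun p hp => hXT p p ?_), hI,
        Finset.sum_comm]
      · refine Finset.sum_congr rfl fun p _ => ?_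
        rw [Finset.mul_sum]
        exact Finset.sum_congr rfl fun q _ => by ring
      · rw [Finset.mem_Icc] at hp
        exact fun l _ _ => hr l (by omega) (by omega)
    rw [Finset.sum_sub_distrib, a1, a2, mul_sub]
    simp only [Finset.mul_sum, ← Finset.sum_sub_distrib]
    exact Finset.sum_congr rfl fun p _ => Finset.sum_congr rfl fun q _ => by ring
  rw [e1, e2, e3, ← Finset.sum_sub_distrib, ← Finset.sum_add_distrib]
  refine Finset.sum_congr rfl fun p _ => ?_
  rw [← Finset.sum_sub_distrib, ← Finset.sum_add_distrib]
  refine Finset.sum_congr rfl fun q _ => ?_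
  rw [quadBr_eq]
  ring

namespace Model

variable {Λ : Lattice G m} {A : Type} [Ring A] [Algebra ℝ A] (M : Model Λ A)

/-- The projection to the negative powers of `λ`. -/
def neg (X : A) : A := (1 / 2 : ℝ) • (X - M.R X)

theorem U_neg (X : A) (p q : ℤ) : M.U (M.neg X) p q = (if p < q then 1 else 0) * M.U X p q := by
  rw [neg, U_smul, U_sub, M.U_R]
  split_ifs <;> first | omega | ring

theorem R_eq (X : A) : M.R X = X - (2 : ℝ) • M.neg X := by
  rw [neg, smul_smul]
  norm_num

/-- Since F is bidiagonal, the projection to negative degrees commutes with multiplication by F up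
to one boundary entry: α Y_{r-1,r} on the left and α Y_{s,s+1} on the right. These match the
diagonal sum in `sum_mul_quadBr`, which telescopes because (TX - XT)_pp = α(Y_{p,p+1} - Y_{p-1,p}).
The contributions of S cancel by `hS`. -/
theorem U_lax (x : ι → ℝ) {α : ℝ} {X Y S : A} (h1 : M.T x * X + S = M.F α * Y)
    (h2 : X * M.T x + S = Y * M.F α) (hS : M.neg S * M.T x = M.T x * M.neg S) {r s : ℤ}
    (hr : r ∈ Λ.V) (hs : s ∈ Λ.V) {W : Finset ℤ}
    (hWr : ∀ p, r - (2 * m + 2) ≤ p → p ≤ r + (2 * m + 2) → p ∈ W)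
    (hWs : ∀ p, s - (2 * m + 2) ≤ p → p ≤ s + (2 * m + 2) → p ∈ W) :
    M.U (M.F α * M.neg Y * M.T x - M.T x * M.neg Y * M.F α) r s
      = ∑ p ∈ W, ∑ q ∈ W, M.U X q p * quadBr (Λ.laxMat x) p q r s := by
  have hb := Λ.isBand_laxMat x
  set L := Λ.laxMat x with hL
  have u1 : ∀ p ∈ Λ.V, ∀ q, M.U (M.T x * X) p q + M.U S p q
      = M.U Y p q - α * M.U Y (p - 1) q := by
    intro p hp q
    rw [← U_add, h1, M.U_F_mul α Y hp]
  have u2 : ∀ p, ∀ q ∈ Λ.V, M.U (X * M.T x) p q + M.U S p q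
      = M.U Y p q - α * M.U Y p (q + 1) := by
    intro p q hq
    rw [← U_add, h2, M.U_mul_F α Y p hq]
  rw [sum_mul_quadBr hb hWr hWs (TX := M.U (M.T x * X)) (XT := M.U (X * M.T x))
    (fun p q h => M.U_T_mul x X h) (fun p q h => M.U_mul_T x X h)]
  have e1 : L r s * ∑ p ∈ Finset.Icc r s, (M.U (M.T x * X) p p - M.U (X * M.T x) p p)
      = L r s * (α * (M.U Y s (s + 1) - M.U Y (r - 1) r)) := by
    by_cases h1 : s < r - 1
    · rw [hb.lower r s h1, zero_mul, zero_mul]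
    congr 1
    have := sum_telescope (fun p => M.U Y (p - 1) p) (r := r) (s := s) (by omega)
    rw [add_sub_cancel_right] at this
    rw [← this, Finset.mul_sum]
    refine Finset.sum_congr rfl fun p hp => ?_
    rw [Finset.mem_Icc] at hp
    have hp' := Λ.interval r p s hr hs hp.1 hp.2
    rw [add_sub_cancel_right]
    linarith [u1 p hp' p, u2 p p hp']
  have e2 : M.U (M.F α * M.neg Y * M.T x) r s
      = (∑ p ∈ W, (if r < p then 1 else 0) * M.U (M.T x * X) r p * L p s)
        + M.U (M.neg S * M.T x) r s - α * (M.U Y (r - 1) r * L r s) := by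
    have hW : ∀ l, s - m ≤ l → l ≤ s + 1 → l ∈ W := fun l _ _ => hWs l (by omega) (by omega)
    rw [mul_assoc, M.U_F_mul α _ hr, M.U_mul_T x _ hW, M.U_mul_T x _ hW, M.U_mul_T x _ hW]
    have e : M.U Y (r - 1) r * L r s
        = ∑ p ∈ W, if p = r then M.U Y (r - 1) p * L p s else 0 := by
      rw [Finset.sum_ite_eq' W r, if_pos (hWr r (by omega) (by omega))]
    rw [e, Finset.mul_sum, Finset.mul_sum, ← Finset.sum_sub_distrib, ← Finset.sum_add_distrib,
      ← Finset.sum_sub_distrib]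
    refine Finset.sum_congr rfl fun p _ => ?_
    simp only [U_neg]
    rcases lt_trichotomy p r with h | h | h
    · rw [if_neg (by omega), if_neg (by omega), if_neg (by omega)]
      ring
    · rw [if_neg (by omega), if_pos (by omega), if_pos h]
      ring
    · rw [if_pos h, if_pos (by omega), if_neg (by omega)]
      linear_combination (- L p s) * u1 r hr p
  have e3 : M.U (M.T x * M.neg Y * M.F α) r s
      = (∑ q ∈ W, L r q * ((if q < s then 1 else 0) * M.U (X * M.T x) q s))
        + M.U (M.T x * M.neg S) r s - α * (L r s * M.U Y s (s + 1)) := by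
    have hW : ∀ l, r - 1 ≤ l → l ≤ r + m → l ∈ W := fun l _ _ => hWr l (by omega) (by omega)
    rw [M.U_mul_F α _ r hs, M.U_T_mul x _ hW, M.U_T_mul x _ hW, M.U_T_mul x _ hW]
    have e : L r s * M.U Y s (s + 1)
        = ∑ q ∈ W, if q = s then L r q * M.U Y q (s + 1) else 0 := by
      rw [Finset.sum_ite_eq' W s, if_pos (hWs s (by omega) (by omega))]
    rw [e, Finset.mul_sum, Finset.mul_sum, ← Finset.sum_sub_distrib, ← Finset.sum_add_distrib,
      ← Finset.sum_sub_distrib]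
    refine Finset.sum_congr rfl fun q _ => ?_
    simp only [U_neg]
    rcases lt_trichotomy q s with h | h | h
    · rw [if_pos h, if_pos (by omega), if_neg (by omega)]
      linear_combination (- L r q) * u2 q s hs
    · rw [if_neg (by omega), if_pos (by omega), if_pos h]
      ring
    · rw [if_neg (by omega), if_neg (by omega), if_neg (by omega)]
      ring
  rw [U_sub, e1, e2, e3, hS]
  ring

theorem bracket_coord (P : ι → ι → (ι → ℝ) → ℝ) (H : (ι → ℝ) → ℝ) (x : ι → ℝ) (β : ι) :
    bracket P H (fun y => y β) x = ∑ γ, P γ β x * pd H x γ := by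
  rw [bracket]
  refine Finset.sum_congr rfl fun γ _ => ?_
  simp [pd_coord]

/-- If `T X + S = F Y` and `X T + S = Y F`, where `S` and its negative part commute with `T`, then
the Lax equation defined by `Y` is the Hamiltonian vector field of the covector `X`. -/
theorem lax_eq_sum (x : ι → ℝ) {α : ℝ} {X Y S : A} (h1 : M.T x * X + S = M.F α * Y)
    (h2 : X * M.T x + S = Y * M.F α) (hS : S * M.T x = M.T x * S)
    (hS' : M.neg S * M.T x = M.T x * M.neg S) {H : (ι → ℝ) → ℝ}
    (hH : ∀ γ, pd H x γ = M.pair X (M.gen γ)) :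
    M.T x * ((1 / 2 : ℝ) • (M.R Y * M.F α)) - ((1 / 2 : ℝ) • (M.F α * M.R Y)) * M.T x
      = ∑ β, bracket (G.quad m) H (fun y => y β) x • M.gen β := by
  have e : M.T x * ((1 / 2 : ℝ) • (M.R Y * M.F α)) - ((1 / 2 : ℝ) • (M.F α * M.R Y)) * M.T x
      = M.F α * M.neg Y * M.T x - M.T x * M.neg Y * M.F α := by
    -- Both sides equal T X T + S T. Hence the identity in R = id - 2·neg contributes nothing to the
    -- Lax equation.
    have c : M.T x * Y * M.F α = M.F α * Y * M.T x := by
      rw [mul_assoc, ← h2, ← h1, mul_add, add_mul, hS, mul_assoc]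
    simp only [R_eq, sub_mul, mul_sub, smul_sub, smul_mul_assoc, mul_smul_comm, smul_smul,
      ← mul_assoc, c]
    norm_num
  rw [e]
  refine M.ext fun r s => ?_
  by_cases hr : r ∈ Λ.V
  swap
  · rw [M.off_row _ _ _ hr, M.off_row _ _ _ hr]
  by_cases hs : s ∈ Λ.V
  swap
  · rw [M.off_col _ _ _ hs, M.off_col _ _ _ hs]
  have hW : ∀ a p, a - (2 * (m : ℤ) + 2) ≤ p → p ≤ a + (2 * m + 2) → (a = r ∨ a = s) →
      p ∈ Finset.Icc (min r s - (2 * (m : ℤ) + 2)) (max r s + (2 * m + 2)) := by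
    intro a p h1 h2 h3
    rw [Finset.mem_Icc]
    omega
  rw [M.U_lax x h1 h2 hS' hr hs (fun p h1 h2 => hW r p h1 h2 (Or.inl rfl))
    (fun p h1 h2 => hW s p h1 h2 (Or.inr rfl)), U_sum]
  simp only [U_smul, M.U_gen]
  by_cases hc : IsCoord Λ.V m r s
  · obtain ⟨-, -, h3, h4⟩ := hc
    obtain ⟨β, hβ, hβ'⟩ := Λ.exists_label r (s - r).toNat (by omega) hr
      (by rwa [show r + ((s - r).toNat : ℤ) = s by omega])
    rw [Finset.sum_eq_single β, bracket_coord, Grid.genMat, if_pos ⟨hβ', by omega⟩, mul_one,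
      Λ.sum_quad_mul x β hβ' (X := M.U X) (ξ := pd H x)
        (S := Finset.Icc (min r s - (2 * (m : ℤ) + 2)) (max r s + (2 * m + 2)))]
    · rw [show r + (G.lev β : ℤ) = s by omega]
    · intro γ p hp
      rw [hH, M.pair_gen X hp]
    · intro p h5 h6
      exact hW r p (by omega) (by omega) (Or.inl rfl)
    · intro γ _ hγ
      have : G.genMat γ r s = 0 := by
        unfold Grid.genMat
        rw [if_neg]
        rintro ⟨h3, h4⟩
        exact hγ (Λ.label_inj _ _ (by omega) (h3.trans hβ'.symm))
      rw [this, mul_zero]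
    · simp
  -- Tangency: at a position that carries no coordinate every bracket is zero, and so is the Lax
  -- vector.
  · rw [Finset.sum_eq_zero fun p _ => Finset.sum_eq_zero fun q _ => by
      rw [(Λ.isBand_laxMat x).quadBr_eq_zero hc, mul_zero],
      Finset.sum_eq_zero fun β _ => by rw [Λ.genMat_eq_zero hc, mul_zero]]

end Model

end

/-! ### The r-matrix bracket, Ad-invariant flows and the logarithmic Hamiltonian. -/

section

variable {ι K : Type} [Fintype ι] [DecidableEq ι] [AddGroupWithOne K] [DecidableEq K]
variable {G : Grid ι K} {m : ℕ}

namespace Model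

variable {Λ : Lattice G m} {A : Type} [Ring A] [Algebra ℝ A] (M : Model Λ A)

theorem U_gen_transpose_mul {Z : A} {γ : ι} (hZ : ∀ a b, M.U Z a b = G.genMat γ b a) (X : A)
    (p q : ℤ) : M.U (Z * X) p q
      = if G.site γ = ((p - G.lev γ : ℤ) : K) then M.U X (p - G.lev γ) q else 0 := by
  rw [M.mul_sum {p - (G.lev γ : ℤ)}, Finset.sum_singleton, hZ, Grid.genMat]
  · split_ifs with h1 h2 h2
    · ring
    · exact absurd h1.1 h2
    · exact absurd ⟨h2, by ring⟩ h1
    · ring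
  · intro r hr
    rw [Finset.mem_singleton] at hr
    rw [hZ, Grid.genMat, if_neg (fun h => hr (by omega)), zero_mul]

theorem U_mul_gen_transpose {Z : A} {γ : ι} (hZ : ∀ a b, M.U Z a b = G.genMat γ b a) (X : A)
    (p q : ℤ) : M.U (X * Z) p q
      = if G.site γ = (q : K) then M.U X p (q + G.lev γ) else 0 := by
  rw [M.mul_sum {q + (G.lev γ : ℤ)}, Finset.sum_singleton, hZ, Grid.genMat]
  · split_ifs with h1 h2 h2
    · ring
    · exact absurd h1.1 h2
    · exact absurd ⟨h2, by ring⟩ h1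
    · ring
  · intro r hr
    rw [Finset.mem_singleton] at hr
    rw [hZ, Grid.genMat, if_neg (fun h => hr (by omega)), mul_zero]

/-- The linear bracket is induced by the linear r-matrix bracket. -/
theorem lin_eq_rLin {dual : ι → A} (hd : ∀ β a b, M.U (dual β) a b = G.genMat β b a) (α : ℝ)
    (β γ : ι) (x : ι → ℝ) : G.lin m α β γ x
      = rLin M.pair M.R (M.F α) (dual β) (dual γ) (M.T x) := by
  -- The gradients λ^j E_{k+j,k} have nonnegative degree, so R fixes them and the two summands of
  -- the r-matrix bracket coincide.
  have hR : ∀ β, M.R (dual β) = dual β := by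
    refine fun β => M.ext fun p q => ?_
    rw [M.U_R]
    split_ifs with h
    · rfl
    · rw [hd, Grid.genMat, if_neg (fun h' => h (by omega)), neg_zero]
  obtain ⟨p, hp⟩ : ∃ p : ℤ, G.site β = (p : K) := ⟨Λ.row β, (Λ.row_cast β).symm⟩
  obtain ⟨hpV, hqV⟩ := Λ.mem_of_site hp
  have hl := Λ.lev_le β
  have hl' := Λ.lev_le γ
  have hunit : ∀ X, M.pair X (dual β) = M.U X p (p + G.lev β) := by
    refine M.pair_unit hpV fun a b => ?_
    rw [hd, Grid.genMat]
    refine if_congr ?_ rfl rfl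
    constructor
    · rintro ⟨h1, h2⟩
      refine ⟨?_, by omega⟩
      rw [h2]
      push_cast
      rw [← h1, hp]
    · rintro ⟨h1, h2⟩
      have h3 : b = p + (a - (p + G.lev β)) := by omega
      refine ⟨?_, by omega⟩
      rw [h3, Int.cast_add, Int.cast_sub, h1, sub_self, add_zero, hp]
  have e1 : M.pair (dual β * M.F α * dual γ) (M.T x)
      = M.U (dual γ * M.T x) p (p + G.lev β) - α * M.U (dual γ * M.T x) (p - 1) (p + G.lev β) := by
    rw [mul_assoc, pair_mul_left, M.pair_comm, hunit, mul_assoc, M.U_F_mul α _ hpV]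
  have e2 : M.pair (dual γ * M.F α * dual β) (M.T x)
      = M.U (M.T x * dual γ) p (p + G.lev β) - α * M.U (M.T x * dual γ) p (p + G.lev β + 1) := by
    rw [M.pair_comm, pair_mul_right, M.pair_comm, pair_mul_right, M.pair_comm, M.pair_comm, hunit,
      ← mul_assoc, M.U_mul_F α _ _ hqV]
  rw [rLin, hR, hR, brF, ← two_smul ℝ (dual β * M.F α * dual γ - dual γ * M.F α * dual β),
    pair_smul_left, sub_eq_add_neg, ← neg_one_smul ℝ (dual γ * M.F α * dual β), pair_add_left,
    pair_smul_left, e1, e2]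
  simp only [M.U_gen_transpose_mul (hd γ), M.U_mul_gen_transpose (hd γ), U_T]
  rw [Λ.lin_eq_sum α β γ x hp]
  -- Each of the four terms is spread over the window of `Lattice.lin_eq_sum`, so that the
  -- comparison can be made for each lift r.
  have key : ∀ (c : ℝ) (a : ℤ) (f : ℤ → ℝ), p - (m + 1) ≤ a → a ≤ p + (m + 1) →
      (if G.site γ = (a : K) then c * f a else 0)
        = ∑ r ∈ Finset.Icc (p - ((m : ℤ) + 1)) (p + (m + 1)), if r = a then
          (if G.site γ = (r : K) then c * f r else 0) else 0 := by
    intro c a f h1 h2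
    rw [Finset.sum_ite_eq' _ a, if_pos (Finset.mem_Icc.2 ⟨h1, h2⟩)]
  have k1 := key (-1) (p + G.lev β) (fun r => Λ.laxMat x p (r + G.lev γ)) (by omega) (by omega)
  have k2 := key α (p + G.lev β + 1) (fun r => Λ.laxMat x p (r + G.lev γ)) (by omega) (by omega)
  have k3 := key 1 (p - G.lev γ) (fun r => Λ.laxMat x r (p + G.lev β)) (by omega) (by omega)
  have k4 := key (-α) (p - 1 - G.lev γ) (fun r => Λ.laxMat x r (p + G.lev β)) (by omega) (by omega)
  trans (if G.site γ = ((p + G.lev β : ℤ) : K) then -1 * Λ.laxMat x p (p + G.lev β + G.lev γ) else 0)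
    + (if G.site γ = ((p + G.lev β + 1 : ℤ) : K) then
        α * Λ.laxMat x p (p + G.lev β + 1 + G.lev γ) else 0)
    + (if G.site γ = ((p - G.lev γ : ℤ) : K) then 1 * Λ.laxMat x (p - G.lev γ) (p + G.lev β) else 0)
    + (if G.site γ = ((p - 1 - G.lev γ : ℤ) : K) then
        -α * Λ.laxMat x (p - 1 - G.lev γ) (p + G.lev β) else 0)
  · rw [k1, k2, k3, k4, ← Finset.sum_add_distrib, ← Finset.sum_add_distrib,
      ← Finset.sum_add_distrib]
    refine Finset.sum_congr rfl fun r _ => ?_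
    by_cases h : G.site γ = (r : K)
    · simp only [if_pos h, linBr]
      have i3 : (p = r + (G.lev γ : ℤ)) ↔ r = p - G.lev γ := by constructor <;> intro <;> omega
      have i4 : (p = r + (G.lev γ : ℤ) + 1) ↔ r = p - 1 - G.lev γ := by
        constructor <;> intro <;> omega
      simp only [i3, i4]
      split_ifs <;> ring
    · simp [if_neg h]
  · split_ifs <;> ring

theorem relLax_eq (f : A → A) (α : ℝ) (x : ι → ℝ) {Y : A}
    (h1 : Ring.inverse (M.F α) * f (M.T x * Ring.inverse (M.F α)) = Y)
    (h2 : f (Ring.inverse (M.F α) * M.T x) * Ring.inverse (M.F α) = Y) :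
    relLax M.R (M.F α) f (M.T x)
      = M.T x * ((1 / 2 : ℝ) • (M.R Y * M.F α)) - ((1 / 2 : ℝ) • (M.F α * M.R Y)) * M.T x := by
  rw [relLax, h1, h2]

theorem T_line (x : ι → ℝ) (β : ι) (ε : ℝ) :
    M.T (x + ε • Pi.single β 1) = M.T x + ε • M.gen β := by
  have h : ∀ γ, (x + ε • (Pi.single β 1 : ι → ℝ)) γ • M.gen γ
      = x γ • M.gen γ + if γ = β then ε • M.gen γ else 0 := by
    intro γ
    simp only [Pi.add_apply, Pi.smul_apply, Pi.single_apply, add_smul, smul_eq_mul]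
    split_ifs <;> simp
  simp only [T, h, Finset.sum_add_distrib, Finset.sum_ite_eq', Finset.mem_univ, if_true]
  abel

/-- Differentiation of φ(gXg⁻¹) = φ(X) along a line, followed by cyclicity and nondegeneracy of the
pairing. `FinOpen` keeps a neighbourhood of the base point on the line inside U. -/
theorem grad_conj {U : Set A} {φ : A → ℝ} {grad : A → A} (h : IsAdInvariant M.pair U φ grad)
    (g : Aˣ) {X : A} (hX : X ∈ U) : grad (g * X * ↑g⁻¹) = g * grad X * ↑g⁻¹ := by
  refine M.eq_of_pair fun Z => ?_
  have h1 := h.gradient _ (h.conj_mem g X hX) Z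
  have h2 := h.gradient X hX (↑g⁻¹ * Z * g)
  have h3 : ∀ᶠ ε : ℝ in nhds 0, X + ε • (↑g⁻¹ * Z * g : A) ∈ U := by
    have ho := h.isOpen Unit X fun _ => (↑g⁻¹ * Z * g : A)
    have hc : Continuous fun ε : ℝ => fun _ : Unit => ε := by fun_prop
    have := (ho.preimage hc).mem_nhds (x := 0) (by simpa using hX)
    filter_upwards [this] with ε hε
    simpa using hε
  have h4 : (fun ε : ℝ => φ (g * X * ↑g⁻¹ + ε • Z))
      =ᶠ[nhds 0] fun ε : ℝ => φ (X + ε • (↑g⁻¹ * Z * g : A)) := by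
    filter_upwards [h3] with ε hε
    rw [← h.conj_eq g _ hε]
    congr 1
    rw [mul_add, add_mul, mul_smul_comm, smul_mul_assoc]
    congr 2
    simp [mul_assoc]
  rw [h1.unique (h2.congr_of_eventuallyEq h4), M.pair_mul_left (↑g * grad X), M.pair_mul_left,
    M.pair_comm _ (grad X * _), M.pair_mul_left, mul_assoc, M.pair_mul_right, M.pair_mul_left]

/-- The flow attached to an Ad-invariant function is Hamiltonian. -/
theorem isHamiltonianLaxOn_adInvariant {α : ℝ} (hF : IsUnit (M.F α)) {U : Set A} {φ : A → ℝ}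
    {grad : A → A} (h : IsAdInvariant M.pair U φ grad) :
    IsHamiltonianLaxOn (G.quad m) M.gen {x | M.T x * Ring.inverse (M.F α) ∈ U}
      (fun x => φ (M.T x * Ring.inverse (M.F α)))
      (fun x => relLax M.R (M.F α) (fun X => X * grad X) (M.T x)) := by
  obtain ⟨u, hu⟩ := hF
  have hFI : Ring.inverse (M.F α) = ↑u⁻¹ := by rw [← hu, Ring.inverse_unit]
  have hT : ∀ x, M.T x * Ring.inverse (M.F α)
      = M.E * Ring.inverse (M.F α) + ∑ β, x β • (M.gen β * Ring.inverse (M.F α)) := by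
    intro x
    simp only [T, add_mul, Finset.sum_mul, smul_mul_assoc]
  have ho : IsOpen {x | M.T x * Ring.inverse (M.F α) ∈ U} := by
    simpa only [hT] using h.isOpen ι (M.E * Ring.inverse (M.F α))
      fun β => M.gen β * Ring.inverse (M.F α)
  have hs : ContDiffOn ℝ ∞ (fun x => φ (M.T x * Ring.inverse (M.F α)))
      {x | M.T x * Ring.inverse (M.F α) ∈ U} := by
    simpa only [hT] using h.smooth ι (M.E * Ring.inverse (M.F α))
      fun β => M.gen β * Ring.inverse (M.F α)
  refine ⟨ho, hs, fun x hx => ?_⟩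
  set FI := Ring.inverse (M.F α) with hFI'
  have c1 : M.F α * FI = 1 := by rw [hFI, ← hu, Units.mul_inv]
  have c2 : FI * M.F α = 1 := by rw [hFI, ← hu, Units.inv_mul]
  set g := grad (M.T x * FI) with hg
  have hcomm : g * (M.T x * FI) = M.T x * FI * g := h.commutes _ hx
  -- F⁻¹T is the conjugate of TF⁻¹ by F⁻¹; this is what makes the two expressions for Y, from C₁ and
  -- C₂, agree.
  have hconj : grad (FI * M.T x) = FI * g * M.F α := by
    have := M.grad_conj h u⁻¹ hx
    rw [inv_inv, ← hFI, hu] at this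
    rw [hg, ← this]
    congr 1
    rw [mul_assoc, mul_assoc, c2, mul_one]
  beta_reduce
  rw [M.relLax_eq (fun X => X * grad X) α x (Y := FI * (M.T x * FI * g)) rfl]
  -- By cyclicity of the pairing, F⁻¹∇φ(TF⁻¹) is the gradient of x ↦ φ(TF⁻¹).
  · refine M.lax_eq_sum x (X := FI * g) (S := 0) ?_ ?_ (by simp) ?_ ?_
    · rw [add_zero, ← mul_assoc (M.F α), c1, one_mul, mul_assoc]
    · rw [add_zero, ← hcomm, ← mul_assoc FI, mul_assoc (FI * g), mul_assoc (M.T x), c2, mul_one]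
    · have : M.neg 0 = 0 := M.ext fun p q => by rw [U_neg, U_zero, mul_zero]
      rw [this, zero_mul, mul_zero]
    · intro γ
      have hd : DifferentiableAt ℝ (fun x => φ (M.T x * FI)) x :=
        (hs.contDiffAt (ho.mem_nhds hx)).differentiableAt (by simp)
      refine pd_eq_of_hasDerivAt hd ?_
      have := h.gradient _ hx (M.gen γ * FI)
      rw [M.pair_mul_right] at this
      simpa only [T_line, add_mul, smul_mul_assoc] using this
  · rw [← hFI', hconj]
    rw [mul_assoc, mul_assoc (FI * g), c1, mul_one]
    simp only [mul_assoc]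

end Model

theorem Lattice.field_site (Λ : Lattice G m) (x : ι → ℝ) (γ : ι) :
    G.field x (G.lev γ) (G.site γ) = x γ := by
  rw [Grid.field, Finset.sum_eq_single γ, if_pos ⟨rfl, rfl⟩]
  · exact fun β _ hβ => if_neg fun h => hβ (Λ.label_inj _ _ h.1 h.2)
  · simp

theorem Lattice.mem_regular_iff (Λ : Lattice G m) {α : ℝ} {x : ι → ℝ} :
    x ∈ G.regular α ↔ ∀ γ, G.lev γ = 0 → 1 + α * x γ ≠ 0 := by
  constructor
  · intro h γ hγ
    have := h (G.site γ)
    rwa [← hγ, Λ.field_site] at this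
  · intro h k
    by_cases hk : ∃ γ, G.lev γ = 0 ∧ G.site γ = k
    · obtain ⟨γ, hγ, rfl⟩ := hk
      have := h γ hγ
      rwa [← Λ.field_site x γ, hγ] at this
    · rw [Grid.field, Finset.sum_eq_zero fun β _ => if_neg fun h' => hk ⟨β, h'⟩]
      simp

theorem Lattice.isOpen_regular (Λ : Lattice G m) (α : ℝ) : IsOpen (G.regular α) := by
  have : G.regular α = ⋂ γ, {x : ι → ℝ | G.lev γ = 0 → 1 + α * x γ ≠ 0} := by
    ext x
    rw [Λ.mem_regular_iff, Set.mem_iInter]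
    rfl
  rw [this]
  refine isOpen_iInter_of_finite fun γ => ?_
  by_cases h : G.lev γ = 0
  · simp only [h, true_imp_iff]
    exact isOpen_ne_fun (by fun_prop) (by fun_prop)
  · simp [h]

theorem Lattice.contDiffOn_logHam (Λ : Lattice G m) (α : ℝ) :
    ContDiffOn ℝ ∞ (G.logHam α) (G.regular α) := by
  refine contDiffOn_const.mul (ContDiffOn.sum fun γ _ => ?_)
  by_cases h : G.lev γ = 0
  · simp only [h, if_true]
    refine ContDiffOn.log ?_ fun x hx => Λ.mem_regular_iff.1 hx γ h
    fun_prop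
  · simp only [h, if_false]
    exact contDiffOn_const

theorem Lattice.pd_logHam (Λ : Lattice G m) {α : ℝ} (hα : α ≠ 0) {x : ι → ℝ}
    (hx : x ∈ G.regular α) (γ : ι) :
    pd (G.logHam α) x γ = if G.lev γ = 0 then (1 + α * x γ)⁻¹ else 0 := by
  have hd : ∀ β, DifferentiableAt ℝ (fun y : ι → ℝ =>
      if G.lev β = 0 then Real.log (1 + α * y β) else 0) x := by
    intro β
    split_ifs with h
    · exact DifferentiableAt.log (by fun_prop) (Λ.mem_regular_iff.1 hx β h)
    · exact differentiableAt_const _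
  have hp : ∀ β, pd (fun y : ι → ℝ => if G.lev β = 0 then Real.log (1 + α * y β) else 0) x γ
      = if β = γ then (if G.lev γ = 0 then α * (1 + α * x γ)⁻¹ else 0) else 0 := by
    intro β
    by_cases h : G.lev β = 0
    · simp only [h, if_true]
      refine pd_eq_of_hasDerivAt (by simpa only [h, if_true] using hd β) ?_
      by_cases hβ : β = γ
      · subst hβ
        simp only [h, if_true, Pi.add_apply, Pi.smul_apply, Pi.single_eq_same, smul_eq_mul, mul_one]
        have h1 : HasDerivAt (fun ε : ℝ => 1 + α * (x β + ε)) α 0 := by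
          simpa using (((hasDerivAt_id (0 : ℝ)).const_add (x β)).const_mul α).const_add 1
        have := h1.log (by simpa using Λ.mem_regular_iff.1 hx β h)
        simpa [div_eq_mul_inv] using this
      · simp only [hβ, if_false, Pi.add_apply, Pi.smul_apply, Pi.single_eq_of_ne hβ, smul_zero]
        exact hasDerivAt_const _ _
    · simp only [h, if_false]
      rw [pd_const]
      split_ifs with h1 h2
      · exact absurd (h1 ▸ h2) h
      · rfl
      · rfl
  have : G.logHam α = fun y => α⁻¹ * ∑ β, if G.lev β = 0 then Real.log (1 + α * y β) else 0 := rfl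
  rw [this, pd_const_mul (DifferentiableAt.fun_sum fun β _ => hd β), pd_sum fun β _ => hd β]
  simp only [hp, Finset.sum_ite_eq', Finset.mem_univ, if_true]
  split_ifs
  · rw [← mul_assoc, inv_mul_cancel₀ hα, one_mul]
  · rw [mul_zero]

/-- The "minus first" flow is the Hamiltonian flow of `-α H₀`. -/
theorem Lattice.bracket_logHam (Λ : Lattice G m) {α : ℝ} (hα : α ≠ 0) {x : ι → ℝ}
    (hx : x ∈ G.regular α) (β : ι) :
    bracket (G.quad m) (G.logHam α) (fun y => y β) x = G.minusFirst α x β := by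
  have hb := Λ.isBand_laxMat x
  obtain ⟨r, hr⟩ : ∃ r : ℤ, G.site β = (r : K) := ⟨Λ.row β, (Λ.row_cast β).symm⟩
  obtain ⟨hrV, hsV⟩ := Λ.mem_of_site hr
  have hl := Λ.lev_le β
  set j := G.lev β with hj
  set d : ℤ → ℝ := fun p => (1 + α * G.field x 0 (p : K))⁻¹ with hd
  set L := Λ.laxMat x with hL
  have hb1 : ∀ p, L p p = G.field x 0 (p : K) := fun p => by
    have := Λ.laxMat_field x p 0
    simpa using this
  set S := Finset.Icc (r - (2 * (m : ℤ) + 1)) (r + (2 * m + 1)) with hS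
  have e1 : bracket (G.quad m) (G.logHam α) (fun y => y β) x
      = ∑ p ∈ S, d p * (((if r < p then 1 else 0) - (if p < r + j then 1 else 0))
        * (L r p * L p (r + j))) := by
    rw [Model.bracket_coord, Λ.sum_quad_mul x β hr (X := fun q p => if q = p then d p else 0) (S := S)]
    · refine Finset.sum_congr rfl fun p hp => ?_
      rw [Finset.sum_eq_single p]
      · rw [if_pos rfl, quadBr_eq]
        ring
      · intro q _ hq
        rw [if_neg hq, zero_mul]
      · exact fun h => absurd hp h
    · intro γ p hp
      rw [Λ.pd_logHam hα hx]
      by_cases h : G.lev γ = 0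
      · rw [if_pos h, if_pos (by omega), hd, ← Λ.field_site x γ, h, hp]
      · rw [if_neg h, if_neg (by omega)]
    · intro p h1 h2
      exact Finset.mem_Icc.2 ⟨h1, h2⟩
  have hup : ∀ p, L r p * L p (r + j) ≠ 0 → r - 1 ≤ p ∧ p ≤ r + j + 1 := by
    intro p hp
    constructor
    · by_contra h
      exact left_ne_zero_of_mul hp (hb.lower _ _ (by omega))
    · by_contra h
      exact right_ne_zero_of_mul hp (hb.lower _ _ (by omega))
  have f1 : L r (r - 1) * L (r - 1) (r + j) = G.field x (j + 1) ((r : K) - 1) := by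
    have h := Λ.laxMat_field x (r - 1) (j + 1)
    rw [show r - 1 + ((j + 1 : ℕ) : ℤ) = r + j by push_cast; ring] at h
    push_cast at h
    rw [← h]
    by_cases h1 : r - 1 ∈ Λ.V
    · rw [hb.sub r hrV h1, one_mul]
    · rw [hb.row _ _ h1, mul_zero]
      exact (hb.row _ _ h1).symm
  have f2 : L r (r + j + 1) * L (r + j + 1) (r + j) = G.field x (j + 1) (r : K) := by
    have h := Λ.laxMat_field x r (j + 1)
    rw [show r + ((j + 1 : ℕ) : ℤ) = r + j + 1 by push_cast; ring] at h
    rw [← h]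
    by_cases h1 : r + j + 1 ∈ Λ.V
    · have := hb.sub (r + j + 1) h1 (by rwa [add_sub_cancel_right])
      rw [add_sub_cancel_right] at this
      rw [this, mul_one]
    · rw [hb.col _ _ h1, zero_mul]
      exact (hb.col _ _ h1).symm
  have mem : ∀ p, r - 1 ≤ p → p ≤ r + j + 1 → p ∈ S := fun p h1 h2 =>
    Finset.mem_Icc.2 ⟨by omega, by omega⟩
  -- For r < p < r + j the two indicators cancel, so only the ends and their outer neighbours
  -- remain. If j = 0, the points r and r + j coincide and contribute nothing.
  have e2 : ∀ p ∈ S, d p * (((if r < p then 1 else 0) - (if p < r + j then 1 else 0))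
        * (L r p * L p (r + j)))
      = (if p = r - 1 then - (d p * (L r p * L p (r + j))) else 0)
        + (if p = r + j + 1 then d p * (L r p * L p (r + j)) else 0)
        + (if p = r then (if j = 0 then 0 else - (d p * (L r p * L p (r + j)))) else 0)
        + (if p = r + j then (if j = 0 then 0 else d p * (L r p * L p (r + j))) else 0) := by
    intro p _
    by_cases h0 : L r p * L p (r + j) = 0
    · rw [h0]
      simp
    · have := hup p h0
      split_ifs <;> first | omega | ring
  rw [e1, Finset.sum_congr rfl e2, Finset.sum_add_distrib, Finset.sum_add_distrib,
    Finset.sum_add_distrib, Finset.sum_ite_eq' S, Finset.sum_ite_eq' S, Finset.sum_ite_eq' S,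
    Finset.sum_ite_eq' S, if_pos (mem _ le_rfl (by omega)), if_pos (mem _ (by omega) le_rfl),
    if_pos (mem _ (by omega) (by omega)), if_pos (mem _ (by omega) (by omega)), f1, f2,
    Grid.minusFirst, ← hj, hr]
  simp only [hd]
  push_cast
  by_cases h : j = 0
  · simp only [h, if_true, Nat.cast_zero, add_zero, zero_add, div_eq_mul_inv]
    ring
  · simp only [h, if_false, hb1, div_eq_mul_inv]
    have := Λ.laxMat_field x r j
    rw [← hL] at this
    rw [this]
    push_cast
    ring

end

/-! ### Entrywise differential calculus in the algebra. -/

section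

variable {ι K : Type} [Fintype ι] [DecidableEq ι] [AddGroupWithOne K] [DecidableEq K]
variable {G : Grid ι K} {m : ℕ}

namespace Model

variable {Λ : Lattice G m} {A : Type} [Ring A] [Algebra ℝ A] (M : Model Λ A)

/-- All entries of `g` are smooth on `D`, and the degrees are uniformly bounded. -/
structure SmoothFam (D : Set (ι → ℝ)) (g : (ι → ℝ) → A) : Prop where
  bdd : ∃ d : ℤ, ∀ y ∈ D, ∀ p q, M.τ * (p - q) < -d → M.U (g y) p q = 0
  smooth : ∀ p q, ContDiffOn ℝ ∞ (fun y => M.U (g y) p q) D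

/-- `g'` is the entrywise partial derivative of `g` at `x` with respect to the coordinate `β`. -/
def HasPd (g : (ι → ℝ) → A) (x : ι → ℝ) (β : ι) (g' : A) : Prop :=
  ∀ p q, pd (fun y => M.U (g y) p q) x β = M.U g' p q

variable {M}

theorem HasPd.unique {g : (ι → ℝ) → A} {x : ι → ℝ} {β : ι} {X Y : A} (h : M.HasPd g x β X)
    (h' : M.HasPd g x β Y) : X = Y :=
  M.ext fun p q => (h p q).symm.trans (h' p q)

theorem HasPd.const (X : A) (x : ι → ℝ) (β : ι) : M.HasPd (fun _ => X) x β 0 := fun p q => by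
  rw [pd_const, U_zero]

theorem HasPd.congr {g h : (ι → ℝ) → A} {x : ι → ℝ} {β : ι} {X : A} (hg : M.HasPd g x β X)
    {D : Set (ι → ℝ)} (hD : IsOpen D) (hx : x ∈ D) (he : ∀ y ∈ D, h y = g y) :
    M.HasPd h x β X := fun p q => by
  rw [← hg p q]
  refine pd_congr ?_ β
  filter_upwards [hD.mem_nhds hx] with y hy
  rw [he y hy]

namespace SmoothFam

variable {D : Set (ι → ℝ)} {g h : (ι → ℝ) → A}

theorem differentiableAt (hg : M.SmoothFam D g) (hD : IsOpen D) {x : ι → ℝ} (hx : x ∈ D)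
    (p q : ℤ) : DifferentiableAt ℝ (fun y => M.U (g y) p q) x :=
  ((hg.smooth p q).contDiffAt (hD.mem_nhds hx)).differentiableAt (by simp)

theorem const (X : A) : M.SmoothFam D (fun _ => X) where
  bdd := by
    obtain ⟨d, hd⟩ := M.bdd X
    exact ⟨d, fun _ _ => hd⟩
  smooth _ _ := contDiffOn_const

theorem add (hg : M.SmoothFam D g) (hh : M.SmoothFam D h) :
    M.SmoothFam D (fun y => g y + h y) where
  bdd := by
    obtain ⟨d, hd⟩ := hg.bdd
    obtain ⟨e, he⟩ := hh.bdd
    refine ⟨max d e, fun y hy p q hpq => ?_⟩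
    rw [U_add, hd y hy p q (by omega), he y hy p q (by omega), add_zero]
  smooth p q := by
    simp only [U_add]
    exact (hg.smooth p q).add (hh.smooth p q)

theorem smul (c : ℝ) (hg : M.SmoothFam D g) : M.SmoothFam D (fun y => c • g y) where
  bdd := by
    obtain ⟨d, hd⟩ := hg.bdd
    exact ⟨d, fun y hy p q hpq => by rw [U_smul, hd y hy p q hpq, mul_zero]⟩
  smooth p q := by
    simp only [U_smul]
    exact contDiffOn_const.mul (hg.smooth p q)

theorem hasPd_add (hg : M.SmoothFam D g) (hh : M.SmoothFam D h) (hD : IsOpen D) {x : ι → ℝ}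
    (hx : x ∈ D) {β : ι} {X Y : A} (hX : M.HasPd g x β X) (hY : M.HasPd h x β Y) :
    M.HasPd (fun y => g y + h y) x β (X + Y) := fun p q => by
  simp only [U_add]
  rw [pd_add (hg.differentiableAt hD hx p q) (hh.differentiableAt hD hx p q), hX, hY]

theorem hasPd_smul (c : ℝ) (hg : M.SmoothFam D g) (hD : IsOpen D) {x : ι → ℝ}
    (hx : x ∈ D) {β : ι} {X : A} (hX : M.HasPd g x β X) :
    M.HasPd (fun y => c • g y) x β (c • X) := fun p q => by
  simp only [U_smul]
  rw [pd_const_mul (hg.differentiableAt hD hx p q), hX]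

/-- Products of entries with uniformly bounded degrees are sums over a fixed finite window. -/
theorem _root_.RTL.Model.mul_window (M : Model Λ A) (d e p q : ℤ) : ∃ S : Finset ℤ, ∀ X Y : A,
    (∀ r, M.τ * (p - r) < -d → M.U X p r = 0) → (∀ r, M.τ * (r - q) < -e → M.U Y r q = 0) →
    M.U (X * Y) p q = ∑ r ∈ S, M.U X p r * M.U Y r q := by
  refine ⟨Finset.Icc (min (q - e) (p - d)) (max (p + d) (q + e)), fun X Y hX hY => ?_⟩
  refine M.mul_sum _ fun r hr => ?_
  rw [Finset.mem_Icc] at hr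
  by_cases h1 : M.τ * (p - r) < -d
  · rw [hX r h1, zero_mul]
  · rw [hY r, mul_zero]
    rcases M.sign with hs | hs <;> rw [hs] at h1 ⊢ <;> omega

theorem bdd_pd (hD : IsOpen D) {x : ι → ℝ} (hx : x ∈ D) {β : ι} {X : A} (hX : M.HasPd g x β X)
    {d : ℤ} (hd : ∀ y ∈ D, ∀ p q, M.τ * (p - q) < -d → M.U (g y) p q = 0) (p q : ℤ)
    (hpq : M.τ * (p - q) < -d) : M.U X p q = 0 := by
  rw [← hX, ← pd_const 0 x β]
  refine pd_congr ?_ β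
  filter_upwards [hD.mem_nhds hx] with y hy
  exact hd y hy p q hpq

theorem mul (hg : M.SmoothFam D g) (hh : M.SmoothFam D h) :
    M.SmoothFam D (fun y => g y * h y) where
  bdd := by
    obtain ⟨d, hd⟩ := hg.bdd
    obtain ⟨e, he⟩ := hh.bdd
    refine ⟨d + e, fun y hy p q hpq => ?_⟩
    rw [M.mul_sum ∅ fun r _ => ?_, Finset.sum_empty]
    by_cases h1 : M.τ * (p - r) < -d
    · rw [hd y hy _ _ h1, zero_mul]
    · rw [he y hy, mul_zero]
      rcases M.sign with hs | hs <;> rw [hs] at h1 hpq ⊢ <;> omega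
  smooth p q := by
    obtain ⟨d, hd⟩ := hg.bdd
    obtain ⟨e, he⟩ := hh.bdd
    obtain ⟨S, hS⟩ := M.mul_window d e p q
    refine ContDiffOn.congr (f := fun y => ∑ r ∈ S, M.U (g y) p r * M.U (h y) r q) ?_
      fun y hy => hS _ _ (fun r hr => hd y hy _ _ hr) fun r hr => he y hy _ _ hr
    exact ContDiffOn.sum fun r _ => (hg.smooth p r).mul (hh.smooth r q)

/-- No topology on the algebra is involved: the uniform degree bounds make an entry of the product a
finite sum over a window independent of the point, to which the ordinary product rule applies. -/
theorem hasPd_mul (hg : M.SmoothFam D g) (hh : M.SmoothFam D h) (hD : IsOpen D) {x : ι → ℝ}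
    (hx : x ∈ D) {β : ι} {X Y : A} (hX : M.HasPd g x β X) (hY : M.HasPd h x β Y) :
    M.HasPd (fun y => g y * h y) x β (X * h x + g x * Y) := fun p q => by
  obtain ⟨d, hd⟩ := hg.bdd
  obtain ⟨e, he⟩ := hh.bdd
  obtain ⟨S, hS⟩ := M.mul_window d e p q
  have h1 : (fun y => M.U (g y * h y) p q)
      =ᶠ[nhds x] fun y => ∑ r ∈ S, M.U (g y) p r * M.U (h y) r q := by
    filter_upwards [hD.mem_nhds hx] with y hy
    exact hS _ _ (fun r hr => hd y hy _ _ hr) fun r hr => he y hy _ _ hr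
  have dg := fun r => hg.differentiableAt hD hx p r
  have dh := fun r => hh.differentiableAt hD hx r q
  rw [pd_congr h1, pd_sum fun r _ => (dg r).fun_mul (dh r), U_add,
    hS _ _ (fun r hr => bdd_pd hD hx hX hd _ _ hr) (fun r hr => he x hx _ _ hr),
    hS _ _ (fun r hr => hd x hx _ _ hr) (fun r hr => bdd_pd hD hx hY he _ _ hr),
    ← Finset.sum_add_distrib]
  refine Finset.sum_congr rfl fun r _ => ?_
  rw [pd_mul (dg r) (dh r), hX, hY]

/-- The entrywise derivatives inherit support, periodicity and the degree bound, so `realize`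
assembles them to an element. -/
theorem exists_hasPd (hg : M.SmoothFam D g) (hD : IsOpen D) {x : ι → ℝ} (hx : x ∈ D) (β : ι) :
    ∃ X, M.HasPd g x β X := by
  suffices h : ∃ X, M.U X = fun p q => pd (fun y => M.U (g y) p q) x β by
    obtain ⟨X, hX⟩ := h
    exact ⟨X, fun p q => by rw [hX]⟩
  refine M.realize _ ?_ ?_ ?_
  · rintro p q (h | h)
    · simp only [M.off_row _ _ _ h, pd_const]
    · simp only [M.off_col _ _ _ h, pd_const]
  · intro p q n hn
    simp only [M.shift _ _ _ _ hn]
  · obtain ⟨d, hd⟩ := hg.bdd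
    refine ⟨d, fun p q hpq => ?_⟩
    rw [← pd_const 0 x β]
    refine pd_congr ?_ β
    filter_upwards [hD.mem_nhds hx] with y hy
    exact hd y hy p q hpq

theorem contDiffOn_pair (S : A) (hg : M.SmoothFam D g) :
    ContDiffOn ℝ ∞ (fun y => M.pair S (g y)) D := by
  simp only [M.pair_eq]
  exact ContDiffOn.sum fun k _ => ((const S).mul hg).smooth k k

theorem pd_pair (S : A) (hg : M.SmoothFam D g) (hD : IsOpen D) {x : ι → ℝ} (hx : x ∈ D) {β : ι}
    {X : A} (hX : M.HasPd g x β X) : pd (fun y => M.pair S (g y)) x β = M.pair S X := by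
  have hs : M.SmoothFam D (fun y => S * g y) := (const S).mul hg
  simp only [M.pair_eq]
  rw [pd_sum fun k _ => hs.differentiableAt hD hx k k]
  refine Finset.sum_congr rfl fun k _ => ?_
  rw [(const S).hasPd_mul hg hD hx (HasPd.const S x β) hX, zero_mul, zero_add]

theorem pow (hg : M.SmoothFam D g) (n : ℕ) : M.SmoothFam D (fun y => g y ^ n) := by
  induction n with
  | zero => simpa only [pow_zero] using const 1
  | succ n ih => simpa only [pow_succ] using ih.mul hg

/-- Differentiation of the power `g ^ (n + 1)` under the scalar product. -/
theorem pair_pd_pow (hg : M.SmoothFam D g) (hD : IsOpen D) {x : ι → ℝ} (hx : x ∈ D) {β : ι}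
    {X : A} (hX : M.HasPd g x β X) (n : ℕ) :
    ∃ Y, M.HasPd (fun y => g y ^ (n + 1)) x β Y ∧ ∀ Z, Commute Z (g x) →
      M.pair Z Y = (n + 1) * M.pair (Z * g x ^ n) X := by
  induction n with
  | zero => exact ⟨X, by simpa using hX, by simp⟩
  | succ n ih =>
    obtain ⟨Y, hY, hZ⟩ := ih
    refine ⟨Y * g x + g x ^ (n + 1) * X, ?_, fun Z hc => ?_⟩
    · simpa only [pow_succ _ (n + 1)] using (hg.pow (n + 1)).hasPd_mul hg hD hx hY hX
    -- Cyclicity brings the last factor next to Z; their product still commutes with g x, so the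
    -- induction hypothesis applies to it.
    · rw [M.pair_add_right, M.pair_mul_right, ← hc.eq, hZ _ (hc.mul_left rfl), mul_assoc,
        ← pow_succ', ← M.pair_mul_left Z]
      push_cast
      ring

end SmoothFam

variable (M)

theorem smoothFam_T (D : Set (ι → ℝ)) : M.SmoothFam D M.T where
  bdd := by
    refine ⟨m + 1, fun y _ p q hpq => ?_⟩
    have hb := Λ.isBand_laxMat y
    rw [U_T]
    rcases M.sign with hs | hs <;> rw [hs] at hpq
    · exact hb.upper _ _ (by omega)
    · exact hb.lower _ _ (by omega)
  smooth p q := by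
    simp only [T, U_add, U_sum, U_smul]
    fun_prop

theorem hasPd_T (x : ι → ℝ) (β : ι) : M.HasPd M.T x β (M.gen β) := fun p q => by
  have h := (M.smoothFam_T Set.univ).differentiableAt isOpen_univ (Set.mem_univ x) p q
  refine pd_eq_of_hasDerivAt h ?_
  simp only [T_line, U_add, U_smul]
  simpa using ((hasDerivAt_id (0 : ℝ)).mul_const (M.U (M.gen β) p q)).const_add (M.U (M.T x) p q)

end Model

end

/-! ### Inverses of upper triangular elements, and the matrix B = F + αT. -/

section

/-- The entry `(p, p + n)` of the left inverse of an upper triangular matrix. -/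
def upInv (X : ℤ → ℤ → ℝ) (p : ℤ) (n : ℕ) : ℝ :=
  ((if n = 0 then 1 else 0) - ∑ i : Fin n, upInv X p i * X (p + (i : ℕ)) (p + n))
    * (X (p + n) (p + n))⁻¹
termination_by n
decreasing_by exact i.2

theorem upInv_zero (X : ℤ → ℤ → ℝ) (p : ℤ) : upInv X p 0 = (X p p)⁻¹ := by
  rw [upInv, Finset.sum_of_isEmpty, if_pos rfl, sub_zero, one_mul, Nat.cast_zero, add_zero]

theorem upInv_sum {X : ℤ → ℤ → ℝ} {p : ℤ} {n : ℕ} (h : X (p + n) (p + n) ≠ 0) :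
    ∑ i ∈ Finset.range (n + 1), upInv X p i * X (p + i) (p + n) = if n = 0 then 1 else 0 := by
  rw [Finset.sum_range_succ, upInv.eq_1 X p n, inv_mul_cancel_right₀ h,
    Fin.sum_univ_eq_sum_range (fun i => upInv X p i * X (p + i) (p + n))]
  ring

theorem upInv_eq_zero {X : ℤ → ℤ → ℝ} {p : ℤ} (h : ∀ q, X p q = 0) (n : ℕ) : upInv X p n = 0 := by
  induction n using Nat.strong_induction_on with
  | _ n ih =>
    rw [upInv]
    by_cases hn : n = 0
    · subst hn
      simp [h]
    · rw [if_neg hn, Finset.sum_eq_zero fun i _ => by rw [ih _ i.2, zero_mul]]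
      simp

theorem upInv_shift {X : ℤ → ℤ → ℝ} {c : ℤ} (h : ∀ p q, X (p + c) (q + c) = X p q) (p : ℤ)
    (n : ℕ) : upInv X (p + c) n = upInv X p n := by
  induction n using Nat.strong_induction_on with
  | _ n ih =>
    have e : ∀ k : ℕ, p + c + k = p + k + c := fun k => by ring
    rw [upInv, upInv.eq_1 X p n, e, h, Finset.sum_congr rfl fun i _ => by rw [ih _ i.2, e, h]]

theorem contDiffOn_upInv {ι : Type} [Fintype ι] {D : Set (ι → ℝ)} {X : (ι → ℝ) → ℤ → ℤ → ℝ}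
    (hs : ∀ p q, ContDiffOn ℝ ∞ (fun y => X y p q) D) {p : ℤ}
    (hd : ∀ q, (∀ y ∈ D, X y q q ≠ 0) ∨ ∀ y ∈ D, X y q q = 0) (n : ℕ) :
    ContDiffOn ℝ ∞ (fun y => upInv (X y) p n) D := by
  induction n using Nat.strong_induction_on with
  | _ n ih =>
    simp only [upInv.eq_1 _ p n]
    refine (contDiffOn_const.sub (ContDiffOn.sum fun i _ => (ih _ i.2).mul (hs _ _))).mul ?_
    rcases hd (p + n) with h | h
    · exact (hs _ _).inv h
    -- A diagonal entry outside V is identically zero; with the convention 0⁻¹ = 0 its inverse is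
    -- still smooth.
    · exact contDiffOn_const.congr fun y hy => by rw [h y hy, inv_zero]

variable {ι K : Type} [Fintype ι] [DecidableEq ι] [AddGroupWithOne K] [DecidableEq K]
variable {G : Grid ι K} {m : ℕ}

namespace Model

variable {Λ : Lattice G m} {A : Type} [Ring A] [Algebra ℝ A] (M : Model Λ A)

/-- A row of the left inverse is solved recursively, starting at the diagonal. It may have
infinitely many nonzero entries to the right, which are admissible because τ = -1 bounds the degrees
only from above. -/
theorem exists_left_inverse (hτ : M.τ = -1) {X : A} (hX : ∀ p q, q < p → M.U X p q = 0)
    (hd : ∀ p ∈ Λ.V, M.U X p p ≠ 0) :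
    ∃ Y, (∀ p q, M.U Y p q = if p ≤ q then upInv (M.U X) p (q - p).toNat else 0) ∧ Y * X = 1 := by
  obtain ⟨Y, hY⟩ : ∃ Y, M.U Y
      = fun p q => if p ≤ q then upInv (M.U X) p (q - p).toNat else 0 := by
    refine M.realize _ ?_ ?_ ?_
    · rintro p q h
      split_ifs with hpq
      swap
      · rfl
      rcases h with h | h
      · exact upInv_eq_zero (fun q => M.off_row _ _ _ h) _
      -- In a column outside V the recursion divides by a zero diagonal entry, and 0⁻¹ = 0 gives the
      -- required support.
      · rw [upInv, show p + ((q - p).toNat : ℤ) = q by omega, M.off_row _ _ _ h, inv_zero, mul_zero]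
    · intro p q c hc
      rw [show q + c - (p + c) = q - p by ring, upInv_shift (fun p q => M.shift _ _ _ _ hc)]
      exact if_congr (add_le_add_iff_right c) rfl rfl
    · exact ⟨0, fun p q hpq => if_neg (by rw [hτ] at hpq; omega)⟩
  replace hY : ∀ p q, M.U Y p q = if p ≤ q then upInv (M.U X) p (q - p).toNat else 0 :=
    fun p q => by rw [hY]
  refine ⟨Y, hY, M.ext fun p q => ?_⟩
  rw [M.one, diagMat]
  by_cases hq : q ∈ Λ.V
  swap
  · rw [M.off_col _ _ _ hq]
    split_ifs with h
    · exact absurd (by aesop) hq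
    · rfl
  by_cases hp : p ∈ Λ.V
  swap
  · rw [M.off_row _ _ _ hp]
    split_ifs with h
    · exact absurd (by aesop) hp
    · rfl
  by_cases hpq : p ≤ q
  swap
  · rw [M.mul_sum ∅ fun r _ => ?_, Finset.sum_empty, if_neg]
    · rintro ⟨-, h⟩
      omega
    · rw [hY]
      by_cases h : p ≤ r
      · rw [hX r q (by omega), mul_zero]
      · simp [h]
  obtain ⟨n, rfl⟩ : ∃ n : ℕ, q = p + n := ⟨(q - p).toNat, by omega⟩
  rw [M.mul_sum ((Finset.range (n + 1)).image fun i : ℕ => p + i), Finset.sum_image]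
  · have := upInv_sum (X := M.U X) (hd _ hq)
    have h : ∀ i : ℕ, M.U Y p (p + i) = upInv (M.U X) p i := fun i => by
      rw [hY, if_pos (by omega), show (p + (i : ℤ) - p).toNat = i by omega]
    simp only [h, this]
    by_cases hn : n = 0 <;> simp [hp, hn]
  · intro i _ j _ h
    simpa using h
  · intro r hr
    by_cases h : p ≤ r
    · rw [hX r, mul_zero]
      by_contra h'
      refine hr (Finset.mem_image.2 ⟨(r - p).toNat, ?_, ?_⟩)
      · rw [Finset.mem_range]
        omega
      · omega
    · rw [hY]
      simp [h]

/-- Upper triangular elements with non-vanishing diagonal are invertible. -/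
theorem isUnit_of_upper (hτ : M.τ = -1) {X : A} (hX : ∀ p q, q < p → M.U X p q = 0)
    (hd : ∀ p ∈ Λ.V, M.U X p p ≠ 0) : IsUnit X ∧ ∀ p q, M.U (Ring.inverse X) p q
      = if p ≤ q then upInv (M.U X) p (q - p).toNat else 0 := by
  obtain ⟨Y, hY, h1⟩ := M.exists_left_inverse hτ hX hd
  -- The left inverse is itself upper triangular with nonvanishing diagonal. Having a left inverse
  -- of its own, it is a two-sided inverse.
  obtain ⟨Z, -, h2⟩ := M.exists_left_inverse hτ (X := Y)
    (fun p q hpq => by rw [hY, if_neg (by omega)]) (fun p hp => by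
      rw [hY, if_pos le_rfl, sub_self, Int.toNat_zero, upInv_zero]
      exact inv_ne_zero (hd p hp))
  have h3 : Z = X := by rw [← mul_one Z, ← h1, ← mul_assoc, h2, one_mul]
  rw [h3] at h2
  let u : Aˣ := ⟨X, Y, h2, h1⟩
  have hu : Ring.inverse X = Y := Ring.inverse_unit u
  exact ⟨u.isUnit, by rw [hu]; exact hY⟩

/-- `B = F + α T`. -/
def B (α : ℝ) (x : ι → ℝ) : A := M.F α + α • M.T x

theorem smoothFam_B (α : ℝ) (D : Set (ι → ℝ)) : M.SmoothFam D (M.B α) :=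
  (SmoothFam.const _).add ((M.smoothFam_T D).smul α)

theorem hasPd_B (α : ℝ) (x : ι → ℝ) (β : ι) : M.HasPd (M.B α) x β (α • M.gen β) := by
  have h := SmoothFam.hasPd_add (SmoothFam.const (M.F α)) ((M.smoothFam_T Set.univ).smul α)
    isOpen_univ (Set.mem_univ x) (HasPd.const _ x β)
    ((M.smoothFam_T Set.univ).hasPd_smul α isOpen_univ (Set.mem_univ x) (M.hasPd_T x β))
  rwa [zero_add] at h

/-- The subdiagonal -α of F cancels the subdiagonal of αT. -/
theorem U_B_lower (α : ℝ) (x : ι → ℝ) {p q : ℤ} (h : q < p) : M.U (M.B α x) p q = 0 := by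
  have hb := Λ.isBand_laxMat x
  rw [B, U_add, U_smul, U_F, U_T]
  by_cases h1 : q = p - 1
  · subst h1
    by_cases hp : p ∈ Λ.V
    · by_cases hq : p - 1 ∈ Λ.V
      · rw [hb.sub p hp hq, relMat, diagMat, subDiag]
        simp [hp, hq]
      · rw [hb.col _ _ hq, relMat, diagMat, subDiag]
        simp [hq]
    · rw [hb.row _ _ hp, relMat, diagMat, subDiag]
      simp [hp]
  · rw [hb.lower _ _ (by omega), relMat, diagMat, subDiag]
    simp [h1, h.ne]

theorem U_B_diag (α : ℝ) (x : ι → ℝ) {p : ℤ} (hp : p ∈ Λ.V) :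
    M.U (M.B α x) p p = 1 + α * G.field x 0 (p : K) := by
  have h := Λ.laxMat_field x p 0
  rw [Nat.cast_zero, add_zero] at h
  have h' : p ≠ p - 1 := by omega
  rw [B, U_add, U_smul, U_F, U_T, h, relMat, diagMat, subDiag]
  simp [hp, h']

variable {α : ℝ}

theorem isUnit_B (hτ : M.τ = -1) {x : ι → ℝ} (hx : x ∈ G.regular α) : IsUnit (M.B α x) :=
  (M.isUnit_of_upper hτ (fun _ _ h => M.U_B_lower α x h) fun p hp => by
    rw [M.U_B_diag α x hp]; exact hx _).1

theorem U_inverse_B (hτ : M.τ = -1) {x : ι → ℝ} (hx : x ∈ G.regular α) (p q : ℤ) :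
    M.U (Ring.inverse (M.B α x)) p q
      = if p ≤ q then upInv (M.U (M.B α x)) p (q - p).toNat else 0 :=
  (M.isUnit_of_upper hτ (fun _ _ h => M.U_B_lower α x h) fun p hp => by
    rw [M.U_B_diag α x hp]; exact hx _).2 p q

theorem smoothFam_inverse_B (hτ : M.τ = -1) :
    M.SmoothFam (G.regular α) (fun x => Ring.inverse (M.B α x)) where
  bdd := ⟨0, fun y hy p q hpq => by
    rw [M.U_inverse_B hτ hy, if_neg]
    rw [hτ] at hpq
    omega⟩
  smooth p q := by
    refine ContDiffOn.congr
      (f := fun y => if p ≤ q then upInv (M.U (M.B α y)) p (q - p).toNat else 0) ?_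
      fun y hy => M.U_inverse_B hτ hy p q
    by_cases h : p ≤ q
    · simp only [h, if_true]
      refine contDiffOn_upInv (M.smoothFam_B α _).smooth (fun r => ?_) _
      by_cases hr : r ∈ Λ.V
      · exact Or.inl fun y hy => by rw [M.U_B_diag α y hr]; exact hy _
      · exact Or.inr fun y _ => M.off_row _ _ _ hr
    · simp only [h, if_false]
      exact contDiffOn_const

/-- The derivative exists by smoothness of the recursion for the inverse, and is then found by
differentiating B⁻¹B = 1. -/
theorem hasPd_inverse_B (hτ : M.τ = -1) {x : ι → ℝ} (hx : x ∈ G.regular α) (β : ι) :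
    M.HasPd (fun y => Ring.inverse (M.B α y)) x β
      (-(Ring.inverse (M.B α x) * (α • M.gen β) * Ring.inverse (M.B α x))) := by
  have hD := Λ.isOpen_regular α
  have hG := M.smoothFam_inverse_B (α := α) hτ
  obtain ⟨Y, hY⟩ := hG.exists_hasPd hD hx β
  have h1 := hG.hasPd_mul (M.smoothFam_B α _) hD hx hY (M.hasPd_B α x β)
  have h2 := (HasPd.const (M := M) (1 : A) x β).congr hD hx
    (h := fun y => Ring.inverse (M.B α y) * M.B α y)
    fun y hy => Ring.inverse_mul_cancel _ (M.isUnit_B hτ hy)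
  have h3 := h1.unique h2
  have h4 : Y = -(Ring.inverse (M.B α x) * (α • M.gen β) * Ring.inverse (M.B α x)) := by
    rw [← mul_one Y, ← Ring.mul_inverse_cancel _ (M.isUnit_B hτ hx), ← mul_assoc,
      eq_neg_of_add_eq_zero_left h3, neg_mul]
  rwa [h4] at hY

theorem pair_inverse_B (hτ : M.τ = -1) {x : ι → ℝ} (hx : x ∈ G.regular α) (γ : ι) :
    M.pair (Ring.inverse (M.B α x)) (M.gen γ) = if G.lev γ = 0 then (1 + α * x γ)⁻¹ else 0 := by
  obtain ⟨p, hp⟩ : ∃ p : ℤ, G.site γ = (p : K) := ⟨Λ.row γ, (Λ.row_cast γ).symm⟩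
  rw [M.pair_gen _ hp, M.U_inverse_B hτ hx]
  by_cases h : G.lev γ = 0
  · rw [if_pos (by omega), if_pos h, h, Nat.cast_zero, add_zero, sub_self, Int.toNat_zero,
      upInv_zero, M.U_B_diag α x (Λ.mem_of_site hp).1, ← hp, ← h, Λ.field_site]
  · rw [if_neg (by omega), if_neg h]

end Model

end

/-! ### Shifts, the degree derivation, and the polynomial and rational flows. -/

section

variable {ι K : Type} [Fintype ι] [DecidableEq ι] [AddGroupWithOne K] [DecidableEq K]
variable {G : Grid ι K} {m : ℕ}

namespace Model

variable {Λ : Lattice G m} {A : Type} [Ring A] [Algebra ℝ A] (M : Model Λ A)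

theorem pair_neg_left (X Z : A) : M.pair (-X) Z = - M.pair X Z := by
  rw [← neg_one_smul ℝ, M.pair_smul_left, neg_one_mul]

theorem pair_neg_right (X Z : A) : M.pair X (-Z) = - M.pair X Z := by
  rw [← neg_one_smul ℝ, M.pair_smul_right, neg_one_mul]

theorem pair_mul_mul (X Y Z : A) : M.pair X (Y * Z * Y) = M.pair (Y * (X * Y)) Z := by
  rw [mul_assoc, ← M.pair_mul_left, M.pair_mul_right]

theorem exists_deg (X : A) : ∃ Y, ∀ p q, M.U Y p q = (p - q : ℤ) * M.U X p q := by
  suffices h : ∃ Y, M.U Y = fun p q : ℤ => ((p - q : ℤ) : ℝ) * M.U X p q by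
    obtain ⟨Y, hY⟩ := h
    exact ⟨Y, fun p q => by rw [hY]⟩
  refine M.realize _ ?_ ?_ ?_
  · rintro p q (h | h)
    · rw [M.off_row _ _ _ h, mul_zero]
    · rw [M.off_col _ _ _ h, mul_zero]
  · intro p q n hn
    rw [M.shift _ _ _ _ hn, add_sub_add_right_eq_sub]
  · obtain ⟨d, hd⟩ := M.bdd X
    exact ⟨d, fun p q h => by rw [hd p q h, mul_zero]⟩

/-- The derivation multiplying every entry by its degree. -/
def deg (X : A) : A := (M.exists_deg X).choose

theorem U_deg (X : A) (p q : ℤ) : M.U (M.deg X) p q = (p - q : ℤ) * M.U X p q :=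
  (M.exists_deg X).choose_spec p q

theorem deg_mul (X Y : A) : M.deg (X * Y) = M.deg X * Y + X * M.deg Y := by
  refine M.ext fun p q => ?_
  obtain ⟨d, hd⟩ := M.bdd X
  obtain ⟨e, he⟩ := M.bdd Y
  obtain ⟨S, hS⟩ := M.mul_window d e p q
  rw [U_add, U_deg, hS X Y (fun r => hd _ _) (fun r => he _ _),
    hS _ Y (fun r h => by rw [U_deg, hd _ _ h, mul_zero]) (fun r => he _ _),
    hS X _ (fun r => hd _ _) (fun r h => by rw [U_deg, he _ _ h, mul_zero]), Finset.mul_sum,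
    ← Finset.sum_add_distrib]
  refine Finset.sum_congr rfl fun r _ => ?_
  rw [U_deg, U_deg]
  push_cast
  ring

theorem deg_one : M.deg 1 = 0 := by
  refine M.ext fun p q => ?_
  rw [U_deg, M.one, diagMat, U_zero]
  split_ifs with h
  · rw [h.2]
    simp
  · rw [mul_zero]

theorem smoothFam_deg {D : Set (ι → ℝ)} {g : (ι → ℝ) → A} (hg : M.SmoothFam D g) :
    M.SmoothFam D (fun y => M.deg (g y)) where
  bdd := by
    obtain ⟨d, hd⟩ := hg.bdd
    exact ⟨d, fun y hy p q h => by rw [U_deg, hd y hy p q h, mul_zero]⟩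
  smooth p q := by
    simp only [U_deg]
    exact contDiffOn_const.mul (hg.smooth p q)

theorem hasPd_deg {D : Set (ι → ℝ)} {g : (ι → ℝ) → A} (hg : M.SmoothFam D g) (hD : IsOpen D)
    {x : ι → ℝ} (hx : x ∈ D) {β : ι} {X : A} (hX : M.HasPd g x β X) :
    M.HasPd (fun y => M.deg (g y)) x β (M.deg X) := fun p q => by
  simp only [U_deg]
  rw [pd_const_mul (hg.differentiableAt hD hx p q), hX]

/-- A central element concentrated in one degree, equal to `1` if that degree is `0`. -/
structure IsShift (S : A) (d : ℤ) : Prop where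
  comm : ∀ X, Commute S X
  degree : ∀ p q, M.U S p q ≠ 0 → p - q = d
  one : d = 0 → S = 1

theorem isShift_one : M.IsShift 1 0 where
  comm X := Commute.one_left X
  degree p q h := by
    rw [M.one, diagMat] at h
    split_ifs at h with h'
    · omega
    · exact absurd rfl h
  one _ := rfl

variable {M}

/-- Being concentrated in one degree, S has negative part S or 0. -/
theorem IsShift.commute_neg {S : A} {d : ℤ} (h : M.IsShift S d) (X : A) : Commute (M.neg S) X := by
  by_cases hd : d < 0
  · have : M.neg S = S := by
      refine M.ext fun p q => ?_
      rw [U_neg]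
      by_cases hS : M.U S p q = 0
      · rw [hS, mul_zero]
      · have := h.degree p q hS
        rw [if_pos (by omega), one_mul]
    rw [this]
    exact h.comm X
  · have : M.neg S = 0 := by
      refine M.ext fun p q => ?_
      rw [U_neg, U_zero]
      by_cases hS : M.U S p q = 0
      · rw [hS, mul_zero]
      · have := h.degree p q hS
        rw [if_neg (by omega), zero_mul]
    rw [this]
    exact Commute.zero_left X

/-- The pairing with S sees only the part of X of degree -d. -/
theorem IsShift.pair_deg {S : A} {d : ℤ} (h : M.IsShift S d) (X : A) :
    M.pair S (M.deg X) = - d * M.pair S X := by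
  obtain ⟨e, he⟩ := M.bdd S
  obtain ⟨f, hf⟩ := M.bdd X
  rw [M.pair_eq, M.pair_eq, Finset.mul_sum]
  refine Finset.sum_congr rfl fun k _ => ?_
  obtain ⟨W, hW⟩ := M.mul_window e f k k
  rw [hW S X (fun r => he _ _) (fun r => hf _ _),
    hW S _ (fun r => he _ _) (fun r h => by rw [U_deg, hf _ _ h, mul_zero]), Finset.mul_sum]
  refine Finset.sum_congr rfl fun r _ => ?_
  by_cases hS : M.U S k r = 0
  · rw [hS]
    ring
  · rw [U_deg, ← h.degree k r hS]
    push_cast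
    ring

theorem IsShift.pair_comm {S : A} {d : ℤ} (h : M.IsShift S d) (X Y : A) :
    M.pair S (X * Y) = M.pair S (Y * X) := by
  rw [M.pair_mul_right, ← (h.comm Y).eq, M.pair_mul_left]

variable (M) {α : ℝ}

theorem one_add_smul (hF : IsUnit (M.F α)) (x : ι → ℝ) :
    1 + α • (M.T x * Ring.inverse (M.F α)) = M.B α x * Ring.inverse (M.F α) ∧
    1 + α • (Ring.inverse (M.F α) * M.T x) = Ring.inverse (M.F α) * M.B α x := by
  constructor
  · rw [B, add_mul, Ring.mul_inverse_cancel _ hF, smul_mul_assoc]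
  · rw [B, mul_add, Ring.inverse_mul_cancel _ hF, mul_smul_comm]

/-- The flow attached to a function `f` of `Θ = B F⁻¹` multiplied by a shift. -/
theorem relLax_eq_sum (hF : IsUnit (M.F α)) (x : ι → ℝ) {f : A → A} {S Q W : A} {d : ℤ}
    (hS : M.IsShift S d) (h1 : f (M.T x * Ring.inverse (M.F α)) = S * W)
    (h2 : f (Ring.inverse (M.F α) * M.T x) * Ring.inverse (M.F α)
      = Ring.inverse (M.F α) * (S * W))
    (hQ : M.B α x * Ring.inverse (M.F α) * Q = Q + W - 1)
    (hQ' : Commute Q (M.B α x * Ring.inverse (M.F α))) {H : (ι → ℝ) → ℝ}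
    (hH : ∀ γ, pd H x γ = M.pair (S * Q) (α • M.gen γ * Ring.inverse (M.F α))) :
    relLax M.R (M.F α) f (M.T x) = ∑ β, bracket (G.quad m) H (fun y => y β) x • M.gen β := by
  set I := Ring.inverse (M.F α) with hI
  have c1 : M.F α * I = 1 := Ring.mul_inverse_cancel _ hF
  have c2 : I * M.F α = 1 := Ring.inverse_mul_cancel _ hF
  have hB : α • M.T x = M.B α x - M.F α := by rw [B, add_sub_cancel_left]
  have hS' := fun X => (hS.comm X).eq
  rw [M.relLax_eq f α x (by rw [← hI, h1]) h2]
  -- As αT = B - F, this X satisfies T X = S(Θ - 1)Q = SW - S with Θ = BF⁻¹. The central S in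
  -- `lax_eq_sum` is there to absorb the last term.
  refine M.lax_eq_sum x (X := α • (I * (S * Q))) (S := S) ?_ ?_ (hS.comm _).eq
    (hS.commute_neg _).eq ?_
  · rw [mul_smul_comm, ← smul_mul_assoc, hB, ← mul_assoc I, ← hS', mul_assoc S, ← mul_assoc _ S,
      ← hS', mul_assoc S, ← mul_assoc _ I, sub_mul, sub_mul, c1, one_mul, hQ, ← mul_assoc (M.F α),
      c1, one_mul]
    noncomm_ring
  · rw [smul_mul_assoc, ← mul_smul_comm, hB, ← mul_assoc I, ← hS', mul_assoc S, mul_assoc S,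
      ← mul_assoc I S, ← hS', mul_assoc S, mul_assoc S]
    have : I * Q * (M.B α x - M.F α) = I * W * M.F α - 1 := by
      have e : M.B α x = M.B α x * I * M.F α := by rw [mul_assoc, c2, mul_one]
      rw [e, mul_sub, mul_assoc I Q, ← mul_assoc Q, hQ'.eq, hQ, ← mul_assoc I, mul_sub, mul_add,
        sub_mul, add_mul, mul_one, c2]
      abel
    rw [this, mul_sub, mul_one, sub_add_cancel]
  · intro γ
    rw [hH, M.pair_smul_left, smul_mul_assoc, M.pair_smul_right, M.pair_mul_right]

/-- The polynomial flows are Hamiltonian. -/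
theorem exists_hamiltonian_pow (hF : IsUnit (M.F α)) {S : A} {d : ℤ} (hS : M.IsShift S d) (n : ℕ) :
    ∃ H : (ι → ℝ) → ℝ, IsHamiltonianLaxOn (G.quad m) M.gen Set.univ H
      (fun x => relLax M.R (M.F α) (fun X => S * (1 + α • X) ^ n) (M.T x)) := by
  set I := Ring.inverse (M.F α) with hI
  set Θ : (ι → ℝ) → A := fun x => M.B α x * I with hΘ
  have hs : M.SmoothFam Set.univ Θ := (M.smoothFam_B α _).mul (SmoothFam.const I)
  have hp : ∀ x γ, M.HasPd Θ x γ (α • M.gen γ * I) := fun x γ => by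
    have := (M.smoothFam_B α Set.univ).hasPd_mul (SmoothFam.const I) isOpen_univ (Set.mem_univ x)
      (M.hasPd_B α x γ) (HasPd.const I x γ)
    rwa [mul_zero, add_zero] at this
  -- The geometric sum Q = 1 + Θ + … + Θ^{n-1} solves (Θ - 1)Q = Θ^n - 1; each SΘ^i is the gradient
  -- of ⟨S, Θ^{i+1}⟩/(i + 1) as a function of Θ.
  refine ⟨fun y => ∑ i ∈ Finset.range n, ((i : ℝ) + 1)⁻¹ * M.pair S (Θ y ^ (i + 1)), isOpen_univ,
    ContDiffOn.sum fun i _ => contDiffOn_const.mul ((hs.pow (i + 1)).contDiffOn_pair S),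
    fun x hx => ?_⟩
  beta_reduce
  obtain ⟨e1, e2⟩ := M.one_add_smul hF x
  refine M.relLax_eq_sum hF x (f := fun X => S * (1 + α • X) ^ n) hS
    (Q := ∑ i ∈ Finset.range n, Θ x ^ i) (W := Θ x ^ n) ?_ ?_ ?_ ?_ ?_
  · rw [e1]
  · rw [e2, ← mul_assoc, ← (hS.comm _).eq, mul_assoc, mul_assoc]
    congr 1
    have : SemiconjBy I (Θ x) (I * M.B α x) := by
      simp only [SemiconjBy, hΘ, mul_assoc]
    exact (this.pow_right n).eq.symm
  · have := mul_geom_sum (Θ x) n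
    rw [sub_mul, one_mul, sub_eq_iff_eq_add] at this
    rw [this]
    abel
  · exact Commute.sum_left _ _ _ fun i _ => (Commute.refl _).pow_left i
  · intro γ
    have hd : ∀ i : ℕ, DifferentiableAt ℝ (fun y => M.pair S (Θ y ^ (i + 1))) x := fun i =>
      (((hs.pow (i + 1)).contDiffOn_pair S).contDiffAt
        (isOpen_univ.mem_nhds hx)).differentiableAt (by simp)
    rw [pd_sum fun i _ => (hd i).const_mul _, Finset.mul_sum, M.pair_sum_left]
    refine Finset.sum_congr rfl fun i _ => ?_
    obtain ⟨Y, hY, hZ⟩ := hs.pair_pd_pow isOpen_univ hx (hp x γ) i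
    rw [pd_const_mul (hd i), (hs.pow (i + 1)).pd_pair S isOpen_univ hx hY, hZ S (hS.comm _),
      ← mul_assoc, inv_mul_cancel₀ (by positivity), one_mul]

/-- A primitive of the function with gradient `S B⁻¹`. -/
theorem exists_log (hα : α ≠ 0) (hτ : M.τ = -1) {S : A} {d : ℤ} (hS : M.IsShift S d) :
    ∃ H : (ι → ℝ) → ℝ, ContDiffOn ℝ ∞ H (G.regular α) ∧ ∀ x ∈ G.regular α, ∀ γ,
      pd H x γ = M.pair (S * Ring.inverse (M.B α x)) (α • M.gen γ) := by
  have hD := Λ.isOpen_regular α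
  by_cases hd : d = 0
  · refine ⟨fun x => α * G.logHam α x, contDiffOn_const.mul (Λ.contDiffOn_logHam α),
      fun x hx γ => ?_⟩
    have h1 : DifferentiableAt ℝ (G.logHam α) x :=
      ((Λ.contDiffOn_logHam α).contDiffAt (hD.mem_nhds hx)).differentiableAt (by simp)
    rw [hS.one hd, one_mul, pd_const_mul h1, Λ.pd_logHam hα hx, M.pair_smul_right,
      M.pair_inverse_B hτ hx]
  have hG := M.smoothFam_inverse_B (α := α) hτ
  have hB := M.smoothFam_deg (M.smoothFam_B α (G.regular α))
  have hs := hG.mul hB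
  -- In nonzero degree the logarithm is replaced by its logarithmic derivative along the grading,
  -- divided by -d: formally ⟨S, log B⟩ = -d⁻¹⟨S, deg log B⟩.
  refine ⟨fun x => (-(d : ℝ)⁻¹) * M.pair S (Ring.inverse (M.B α x) * M.deg (M.B α x)),
    contDiffOn_const.mul (hs.contDiffOn_pair S), fun x hx γ => ?_⟩
  have h1 : DifferentiableAt ℝ
      (fun y => M.pair S (Ring.inverse (M.B α y) * M.deg (M.B α y))) x :=
    ((hs.contDiffOn_pair S).contDiffAt (hD.mem_nhds hx)).differentiableAt (by simp)
  rw [pd_const_mul h1, hs.pd_pair S hD hx (hG.hasPd_mul hB hD hx (M.hasPd_inverse_B hτ hx γ)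
    (M.hasPd_deg (M.smoothFam_B α _) hD hx (M.hasPd_B α x γ)))]
  set I := Ring.inverse (M.B α x) with hI
  set Z := α • M.gen γ
  have c1 : I * M.B α x = 1 := Ring.inverse_mul_cancel _ (M.isUnit_B hτ hx)
  have c2 : M.B α x * I = 1 := Ring.mul_inverse_cancel _ (M.isUnit_B hτ hx)
  have hdeg : M.deg I = -(I * M.deg (M.B α x) * I) := by
    have := M.deg_mul I (M.B α x)
    rw [c1, M.deg_one] at this
    rw [← mul_one (M.deg I), ← c2, ← mul_assoc, eq_neg_of_add_eq_zero_left this.symm, neg_mul]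
  -- The variation of B⁻¹ deg B equals deg(B⁻¹ δB) up to a commutator, which the central S
  -- annihilates under the pairing.
  have h2 : M.pair S (-(I * Z * I) * M.deg (M.B α x) + I * M.deg Z) = M.pair S (M.deg (I * Z)) := by
    rw [M.deg_mul, M.pair_add_right, M.pair_add_right, hdeg]
    congr 1
    rw [neg_mul, neg_mul, ← neg_one_smul ℝ, M.pair_smul_right, ← neg_one_smul ℝ (_ * Z),
      M.pair_smul_right, mul_assoc (I * Z), hS.pair_comm, mul_assoc _ I Z]
  rw [h2, hS.pair_deg, M.pair_mul_left]
  have : (d : ℝ) ≠ 0 := by exact_mod_cast hd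
  field_simp

/-- The rational flows are Hamiltonian. -/
theorem exists_hamiltonian_inverse_pow (hα : α ≠ 0) (hτ : M.τ = -1) (hF : IsUnit (M.F α)) {S : A}
    {d : ℤ} (hS : M.IsShift S d) (n : ℕ) :
    ∃ H : (ι → ℝ) → ℝ, IsHamiltonianLaxOn (G.quad m) M.gen (G.regular α) H
      (fun x => relLax M.R (M.F α) (fun X => S * Ring.inverse (1 + α • X) ^ n) (M.T x)) := by
  have hD := Λ.isOpen_regular α
  set I := Ring.inverse (M.F α) with hI
  have c1 : M.F α * I = 1 := Ring.mul_inverse_cancel _ hF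
  have c2 : I * M.F α = 1 := Ring.inverse_mul_cancel _ hF
  set Ξ : (ι → ℝ) → A := fun x => M.F α * Ring.inverse (M.B α x) with hΞ
  have hG := M.smoothFam_inverse_B (α := α) hτ
  have hs : M.SmoothFam (G.regular α) Ξ := (SmoothFam.const _).mul hG
  have hGI : ∀ x, Ring.inverse (M.B α x) = I * Ξ x := fun x => by
    rw [hΞ, ← mul_assoc, c2, one_mul]
  have hp : ∀ x ∈ G.regular α, ∀ γ,
      M.HasPd Ξ x γ (-(Ξ x * (α • M.gen γ * I) * Ξ x)) := fun x hx γ => by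
    have := (SmoothFam.const (M.F α)).hasPd_mul hG hD hx (HasPd.const _ x γ)
      (M.hasPd_inverse_B hτ hx γ)
    rw [zero_mul, zero_add, mul_neg, hGI] at this
    have e : M.F α * (I * Ξ x * (α • M.gen γ) * (I * Ξ x)) = Ξ x * (α • M.gen γ * I) * Ξ x := by
      simp only [← mul_assoc, c1, one_mul]
    rwa [e] at this
  -- With Ξ = Θ⁻¹, the element Q = -(Ξ + … + Ξ^n) solves (Θ - 1)Q = Ξ^n - 1. Its term -Ξ requires
  -- the logarithm; since δΞ = -Ξ δΘ Ξ, each term -Ξ^{i+2} comes from ⟨S, Ξ^{i+1}⟩/(i + 1).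
  have hL : ∃ L : (ι → ℝ) → ℝ, ContDiffOn ℝ ∞ L (G.regular α) ∧ ∀ x ∈ G.regular α, ∀ γ,
      pd L x γ = M.pair (S * (-∑ i ∈ Finset.range n, Ξ x ^ (i + 1))) (α • M.gen γ * I) := by
    cases n with
    | zero =>
      refine ⟨fun _ => 0, contDiffOn_const, fun x _ γ => ?_⟩
      rw [pd_const, Finset.sum_range_zero, neg_zero, mul_zero, M.pair_zero_left]
    | succ n =>
      obtain ⟨L, hL, hL'⟩ := M.exists_log hα hτ hS
      refine ⟨fun y => (-1) * L y + ∑ i ∈ Finset.range n, ((i : ℝ) + 1)⁻¹ * M.pair S (Ξ y ^ (i + 1)),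
        (contDiffOn_const.mul hL).add (ContDiffOn.sum fun i _ =>
          contDiffOn_const.mul ((hs.pow (i + 1)).contDiffOn_pair S)), fun x hx γ => ?_⟩
      have hd : ∀ i : ℕ, DifferentiableAt ℝ (fun y => M.pair S (Ξ y ^ (i + 1))) x := fun i =>
        (((hs.pow (i + 1)).contDiffOn_pair S).contDiffAt
          (hD.mem_nhds hx)).differentiableAt (by simp)
      have hd' : DifferentiableAt ℝ L x :=
        (hL.contDiffAt (hD.mem_nhds hx)).differentiableAt (by simp)
      rw [pd_add (hd'.const_mul _) (DifferentiableAt.fun_sum fun i _ => (hd i).const_mul _),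
        pd_sum fun i _ => (hd i).const_mul _, pd_const_mul hd', hL' x hx, hGI,
        Finset.sum_range_succ', neg_add, add_comm (-_), mul_add, M.pair_add_left]
      congr 1
      · rw [zero_add, pow_one, M.pair_mul_right, ← mul_assoc, (hS.comm I).eq, mul_neg, mul_neg,
          M.pair_neg_left, mul_assoc, neg_one_mul]
      · rw [mul_neg, M.pair_neg_left, Finset.mul_sum, M.pair_sum_left, ← Finset.sum_neg_distrib]
        refine Finset.sum_congr rfl fun i _ => ?_
        obtain ⟨Y, hY, hZ⟩ := hs.pair_pd_pow hD hx (hp x hx γ) i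
        rw [pd_const_mul (hd i), (hs.pow (i + 1)).pd_pair S hD hx hY, hZ S (hS.comm _),
          ← mul_assoc, inv_mul_cancel₀ (by positivity), one_mul, M.pair_neg_right, M.pair_mul_mul,
          mul_assoc S, ← mul_assoc, ← (hS.comm (Ξ x)).eq, mul_assoc, ← pow_succ, ← pow_succ']
  obtain ⟨L, hL, hL'⟩ := hL
  refine ⟨L, hD, hL, fun x hx => ?_⟩
  beta_reduce
  have hB := M.isUnit_B hτ hx
  obtain ⟨e1, e2⟩ := M.one_add_smul hF x
  have d1 : M.B α x * I * Ξ x = 1 := by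
    rw [mul_assoc, ← hGI, Ring.mul_inverse_cancel _ hB]
  have d2 : Ξ x * (M.B α x * I) = 1 := by
    rw [hΞ, mul_assoc, ← mul_assoc _ _ I, Ring.inverse_mul_cancel _ hB, one_mul, c1]
  have e3 : Ring.inverse (M.B α x * I) = Ξ x := Ring.inverse_unit ⟨_, _, d1, d2⟩
  have e4 : Ring.inverse (I * M.B α x) = Ring.inverse (M.B α x) * M.F α :=
    Ring.inverse_unit ⟨I * M.B α x, Ring.inverse (M.B α x) * M.F α,
      by rw [mul_assoc, ← mul_assoc (M.B α x), Ring.mul_inverse_cancel _ hB, one_mul, c2],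
      by rw [mul_assoc, ← mul_assoc (M.F α), c1, one_mul, Ring.inverse_mul_cancel _ hB]⟩
  have hc : Commute (Ξ x) (M.B α x * I) := d2.trans d1.symm
  refine M.relLax_eq_sum hF x (f := fun X => S * Ring.inverse (1 + α • X) ^ n) hS
    (Q := -∑ i ∈ Finset.range n, Ξ x ^ (i + 1)) (W := Ξ x ^ n) ?_ ?_ ?_ ?_ (hL' x hx)
  · rw [e1, e3]
  · rw [e2, e4, ← mul_assoc, ← (hS.comm _).eq, mul_assoc, mul_assoc]
    congr 1
    have : SemiconjBy I (Ξ x) (Ring.inverse (M.B α x) * M.F α) := by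
      rw [SemiconjBy, ← hGI, mul_assoc, c1, mul_one]
    exact (this.pow_right n).eq.symm
  · have h1 : M.B α x * I * ∑ i ∈ Finset.range n, Ξ x ^ (i + 1)
        = ∑ i ∈ Finset.range n, Ξ x ^ i := by
      rw [Finset.mul_sum]
      refine Finset.sum_congr rfl fun i _ => ?_
      rw [pow_succ', ← mul_assoc, d1, one_mul]
    have h2 := Finset.sum_range_succ (fun i => Ξ x ^ i) n
    rw [Finset.sum_range_succ', pow_zero] at h2
    rw [mul_neg, h1, ← sub_eq_iff_eq_add.2 h2]
    abel
  · exact (Commute.sum_left _ _ _ fun i _ => hc.pow_left _).neg_left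

/-- The "minus first" flow. -/
theorem relLax_minusFirst (hα : α ≠ 0) (hτ : M.τ = -1) (hF : IsUnit (M.F α)) {x : ι → ℝ}
    (hx : x ∈ G.regular α) :
    relLax M.R (M.F α) (fun X => (-α⁻¹) • Ring.inverse (1 + α • X)) (M.T x)
      = ∑ β, G.minusFirst α x β • M.gen β := by
  set I := Ring.inverse (M.F α) with hI
  set V := Ring.inverse (M.B α x) with hV
  have c1 : M.F α * I = 1 := Ring.mul_inverse_cancel _ hF
  have c2 : I * M.F α = 1 := Ring.inverse_mul_cancel _ hF
  have hB := M.isUnit_B hτ hx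
  have b1 : M.B α x * V = 1 := Ring.mul_inverse_cancel _ hB
  have b2 : V * M.B α x = 1 := Ring.inverse_mul_cancel _ hB
  obtain ⟨e1, e2⟩ := M.one_add_smul hF x
  have e3 : Ring.inverse (M.B α x * I) = M.F α * V :=
    Ring.inverse_unit ⟨M.B α x * I, M.F α * V,
      by rw [mul_assoc, ← mul_assoc I, c2, one_mul, b1],
      by rw [mul_assoc, ← mul_assoc V, b2, one_mul, c1]⟩
  have e4 : Ring.inverse (I * M.B α x) = V * M.F α :=
    Ring.inverse_unit ⟨I * M.B α x, V * M.F α,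
      by rw [mul_assoc, ← mul_assoc (M.B α x), b1, one_mul, c2],
      by rw [mul_assoc, ← mul_assoc (M.F α), c1, one_mul, b2]⟩
  have hT : M.T x = α⁻¹ • (M.B α x - M.F α) := by
    rw [B, add_sub_cancel_left, smul_smul, inv_mul_cancel₀ hα, one_smul]
  have hS := M.isShift_one
  rw [M.relLax_eq _ α x (Y := (-α⁻¹) • V),
    -- From αT = B - F one gets T B⁻¹ - α⁻¹ = -α⁻¹ F B⁻¹, so the diagonal of B⁻¹ is the gradient of
    -- the Hamiltonian.
    M.lax_eq_sum x (X := V) (S := (-α⁻¹) • 1) (H := G.logHam α)]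
  · simp only [Λ.bracket_logHam hα hx]
  · rw [hT, smul_mul_assoc, sub_mul, b1, mul_smul_comm]
    module
  · rw [hT, mul_smul_comm, mul_sub, b2, smul_mul_assoc]
    module
  · rw [smul_mul_assoc, mul_smul_comm, one_mul, mul_one]
  · have : M.neg ((-α⁻¹) • (1 : A)) = (-α⁻¹) • M.neg 1 := M.ext fun p q => by
      rw [U_neg, U_smul, U_smul, U_neg]
      ring
    rw [this, smul_mul_assoc, mul_smul_comm, (hS.commute_neg _).eq]
  · intro γ
    rw [Λ.pd_logHam hα hx, M.pair_inverse_B hτ hx]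
  · rw [e1, e3, mul_smul_comm, ← mul_assoc, c2, one_mul]
  · rw [e2, e4, smul_mul_assoc, mul_assoc, c1, mul_one]

end Model

end

/-! ### The open-end case: gl(N). -/

section

section OpenModel

variable (N m : ℕ)

/-- The open lattice `{1, …, N}`. -/
def openLattice : Lattice (openGrid N m) m where
  V := Set.Icc 1 (N : ℤ)
  row β := (openGrid N m).site β
  row_cast β := Int.cast_id
  lev_le β := Nat.lt_succ_iff.1 β.1.1.2
  mem_V β := by
    have h1 := β.1.2.2
    have h2 := β.2
    simp only [openGrid, Set.mem_Icc]
    omega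
  mem_congr p q h hp := by
    rw [Int.cast_id, Int.cast_id] at h
    rwa [← h]
  exists_label p j hj hp hpj := by
    rw [Set.mem_Icc] at hp hpj
    refine ⟨⟨(⟨j, by omega⟩, ⟨(p - 1).toNat, by omega⟩), by simp only; omega⟩, rfl, ?_⟩
    simp only [openGrid, Int.cast_id]
    omega
  label_inj β γ h1 h2 := by
    simp only [openGrid, add_left_inj, Nat.cast_inj] at h1 h2
    exact Subtype.ext (Prod.ext (Fin.ext h1) (Fin.ext h2))
  interval p q r hp hr h1 h2 := ⟨hp.1.trans h1, h2.trans hr.2⟩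

variable {N m}

/-- Extension of a matrix with rows and columns `1, …, N` by zero. -/
def openExt (X : Matrix (Fin N) (Fin N) ℝ) (p q : ℤ) : ℝ :=
  ∑ i : Fin N, ∑ j : Fin N, if ((i : ℕ) : ℤ) + 1 = p ∧ ((j : ℕ) : ℤ) + 1 = q then X i j else 0

theorem openExt_apply (X : Matrix (Fin N) (Fin N) ℝ) (i j : Fin N) :
    openExt X (((i : ℕ) : ℤ) + 1) (((j : ℕ) : ℤ) + 1) = X i j := by
  rw [openExt, Finset.sum_eq_single i, Finset.sum_eq_single j, if_pos ⟨rfl, rfl⟩]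
  · intro k _ hk
    exact if_neg fun h => hk (Fin.ext (by omega))
  · simp
  · intro k _ hk
    exact Finset.sum_eq_zero fun l _ => if_neg fun h => hk (Fin.ext (by omega))
  · simp

theorem openExt_row (X : Matrix (Fin N) (Fin N) ℝ) {p : ℤ} (q : ℤ) (h : p ∉ Set.Icc 1 (N : ℤ)) :
    openExt X p q = 0 :=
  Finset.sum_eq_zero fun i _ => Finset.sum_eq_zero fun j _ => if_neg fun h' => h (by
    rw [Set.mem_Icc]
    omega)

theorem openExt_col (X : Matrix (Fin N) (Fin N) ℝ) (p : ℤ) {q : ℤ} (h : q ∉ Set.Icc 1 (N : ℤ)) :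
    openExt X p q = 0 :=
  Finset.sum_eq_zero fun i _ => Finset.sum_eq_zero fun j _ => if_neg fun h' => h (by
    rw [Set.mem_Icc]
    omega)

theorem exists_fin_of_mem {p : ℤ} (h : p ∈ Set.Icc 1 (N : ℤ)) :
    ∃ i : Fin N, p = ((i : ℕ) : ℤ) + 1 := by
  rw [Set.mem_Icc] at h
  exact ⟨⟨(p - 1).toNat, by omega⟩, by simp only; omega⟩

/-- Two functions on `ℤ × ℤ` supported on `{1, …, N}²` agree if they agree there. -/
theorem eq_of_openSupport {f g : ℤ → ℤ → ℝ}
    (hf : ∀ p q, p ∉ Set.Icc 1 (N : ℤ) ∨ q ∉ Set.Icc 1 (N : ℤ) → f p q = 0)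
    (hg : ∀ p q, p ∉ Set.Icc 1 (N : ℤ) ∨ q ∉ Set.Icc 1 (N : ℤ) → g p q = 0)
    (h : ∀ i j : Fin N, f (((i : ℕ) : ℤ) + 1) (((j : ℕ) : ℤ) + 1)
      = g (((i : ℕ) : ℤ) + 1) (((j : ℕ) : ℤ) + 1)) : f = g := by
  funext p q
  by_cases hp : p ∈ Set.Icc 1 (N : ℤ)
  · by_cases hq : q ∈ Set.Icc 1 (N : ℤ)
    · obtain ⟨i, rfl⟩ := exists_fin_of_mem hp
      obtain ⟨j, rfl⟩ := exists_fin_of_mem hq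
      exact h i j
    · rw [hf p q (Or.inr hq), hg p q (Or.inr hq)]
  · rw [hf p q (Or.inl hp), hg p q (Or.inl hp)]

theorem openExt_support (X : Matrix (Fin N) (Fin N) ℝ) (p q : ℤ)
    (h : p ∉ Set.Icc 1 (N : ℤ) ∨ q ∉ Set.Icc 1 (N : ℤ)) : openExt X p q = 0 :=
  h.elim (openExt_row X q) (openExt_col X p)

theorem openExt_mul (X Y : Matrix (Fin N) (Fin N) ℝ) (p q : ℤ) :
    openExt (X * Y) p q = ∑ᶠ r, openExt X p r * openExt Y r q := by
  have h : ∀ p q, ∑ᶠ r, openExt X p r * openExt Y r q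
      = ∑ i : Fin N, openExt X p (((i : ℕ) : ℤ) + 1) * openExt Y (((i : ℕ) : ℤ) + 1) q := by
    intro p q
    rw [finsum_eq_sum_of_support_subset (s := Finset.univ.image fun i : Fin N => ((i : ℕ) : ℤ) + 1),
      Finset.sum_image]
    · intro i _ j _ hij
      exact Fin.ext (by simpa using hij)
    · intro r hr
      by_contra h'
      refine hr ?_
      beta_reduce
      rw [openExt_col, zero_mul]
      intro hr'
      obtain ⟨i, rfl⟩ := exists_fin_of_mem hr'
      exact h' (by simp)
  rw [h]
  refine congrFun₂ (eq_of_openSupport (openExt_support (X * Y)) (g := fun p q =>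
    ∑ i : Fin N, openExt X p (((i : ℕ) : ℤ) + 1) * openExt Y (((i : ℕ) : ℤ) + 1) q) ?_ ?_) p q
  · rintro p q (h | h)
    · exact Finset.sum_eq_zero fun i _ => by rw [openExt_row _ _ h, zero_mul]
    · exact Finset.sum_eq_zero fun i _ => by rw [openExt_col _ _ h, mul_zero]
  · intro i j
    simp only [openExt_apply, Matrix.mul_apply]

theorem openExt_openGen (β : OpenIdx N m) : openExt (openGen β) = (openGrid N m).genMat β := by
  refine eq_of_openSupport (N := N) (openExt_support _) ?_ ?_
  · intro p q h
    have h1 := β.1.2.2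
    have h2 := β.2
    refine if_neg fun h' => ?_
    simp only [openGrid, Int.cast_id, Set.mem_Icc] at h' h
    omega
  · intro i j
    rw [openExt_apply, openGen, Matrix.single_apply, Grid.genMat]
    refine if_congr ?_ rfl rfl
    simp only [openGrid, Int.cast_id, Fin.ext_iff]
    omega

theorem openExt_openDual (β : OpenIdx N m) (p q : ℤ) :
    openExt (openDual β) p q = (openGrid N m).genMat β q p := by
  refine congrFun₂ (eq_of_openSupport (N := N) (openExt_support _)
    (g := fun p q => (openGrid N m).genMat β q p) ?_ ?_) p q
  · intro p q h
    have h1 := β.1.2.2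
    have h2 := β.2
    refine if_neg fun h' => ?_
    simp only [openGrid, Int.cast_id, Set.mem_Icc] at h' h
    omega
  · intro i j
    rw [openExt_apply, openDual, Matrix.single_apply, Grid.genMat]
    refine if_congr ?_ rfl rfl
    simp only [openGrid, Int.cast_id, Fin.ext_iff]
    omega

variable (N m)

/-- The realization of `gl(N)`. -/
def openModel : Model (openLattice N m) (Matrix (Fin N) (Fin N) ℝ) where
  U :=
    { toFun := openExt
      map_add' X Y := eq_of_openSupport (N := N) (openExt_support _)
        (fun p q h => by simp [openExt_support _ p q h])
        fun i j => by simp [openExt_apply]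
      map_smul' c X := eq_of_openSupport (N := N) (openExt_support _)
        (fun p q h => by simp [openExt_support _ p q h])
        fun i j => by simp [openExt_apply] }
  inj X Y h := by
    ext i j
    rw [← openExt_apply X, ← openExt_apply Y]
    exact congrFun₂ h _ _
  -- Finite matrices have degrees bounded on both sides; the sign -1 makes the results on upper
  -- triangular inverses applicable.
  τ := -1
  sign := Or.inr rfl
  off_row X p q h := openExt_row X q h
  off_col X p q h := openExt_col X p h
  shift X p q n h := by
    rw [Int.cast_id] at h
    rw [h, add_zero, add_zero]
  bdd X := by
    refine ⟨N, fun p q h => openExt_support X p q ?_⟩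
    by_contra h'
    simp only [Set.mem_Icc] at h'
    omega
  one := by
    classical
    refine eq_of_openSupport (N := N) (openExt_support _) ?_ ?_
    · intro p q h
      rw [diagMat]
      refine if_neg fun h' => ?_
      rw [h'.2] at h
      exact h.elim (fun h => h h'.1) fun h => h h'.1
    · intro i j
      have hi : (((i : ℕ) : ℤ) + 1) ∈ (openLattice N m).V := by
        have := i.2
        simp only [openLattice, Set.mem_Icc]
        omega
      simp only [LinearMap.coe_mk, AddHom.coe_mk]
      rw [openExt_apply, Matrix.one_apply, diagMat]
      refine if_congr ?_ rfl rfl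
      rw [Fin.ext_iff]
      constructor
      · intro h
        exact ⟨hi, by omega⟩
      · intro h
        omega
  mul X Y p q := openExt_mul X Y p q
  realize g h1 _ _ := by
    refine ⟨Matrix.of fun i j => g (((i : ℕ) : ℤ) + 1) (((j : ℕ) : ℤ) + 1), ?_⟩
    refine eq_of_openSupport (N := N) (openExt_support _) h1 fun i j => ?_
    exact openExt_apply _ i j
  reps := Finset.Icc 1 (N : ℤ)
  reps_unique p hp := by
    refine ⟨p, ⟨Finset.mem_Icc.2 hp, rfl⟩, fun k hk => ?_⟩
    simpa using hk.2
  pair := openPair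
  pair_eq X Y := by
    rw [openPair, Matrix.trace]
    refine Finset.sum_bij (fun (i : Fin N) _ => ((i : ℕ) : ℤ) + 1) ?_ ?_ ?_ ?_
    · intro i _
      have := i.2
      rw [Finset.mem_Icc]
      omega
    · intro i _ j _ h
      exact Fin.ext (by simpa using h)
    · intro p hp
      obtain ⟨i, hi⟩ := exists_fin_of_mem (Finset.mem_Icc.1 hp)
      exact ⟨i, Finset.mem_univ _, hi.symm⟩
    · intro i _
      exact (openExt_apply _ i i).symm
  pair_comm X Y := Matrix.trace_mul_comm X Y
  E := openE N
  U_E := by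
    classical
    refine eq_of_openSupport (N := N) (openExt_support _) ?_ ?_
    · intro p q h
      rw [subDiag]
      refine if_neg fun h' => ?_
      exact h.elim (fun h => h h'.1) fun h => h h'.2.1
    · intro i j
      have hi : ∀ i : Fin N, (((i : ℕ) : ℤ) + 1) ∈ (openLattice N m).V := fun i => by
        have := i.2
        simp only [openLattice, Set.mem_Icc]
        omega
      simp only [LinearMap.coe_mk, AddHom.coe_mk]
      rw [openExt_apply, openE, Matrix.of_apply, subDiag]
      refine if_congr ?_ rfl rfl
      constructor
      · intro h
        exact ⟨hi i, hi j, by omega⟩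
      · intro h
        omega
  gen := openGen
  U_gen := openExt_openGen
  R := openR
  U_R X p q := by
    refine congrFun₂ (eq_of_openSupport (N := N) (openExt_support (openR X))
      (g := fun p q => if q ≤ p then openExt X p q else - openExt X p q) ?_ ?_) p q
    · intro p q h
      simp [openExt_support X p q h]
    · intro i j
      simp only [openExt_apply, openR, Matrix.of_apply]
      refine if_congr ?_ rfl rfl
      rw [Fin.le_def]
      omega

theorem isUnit_openF (α : ℝ) : IsUnit (openF N α) := by
  rw [Matrix.isUnit_iff_isUnit_det, Matrix.det_of_isLowerTriangular]
  · rw [Finset.prod_eq_one]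
    · exact isUnit_one
    · intro i _
      simp [openF, openE]
  · intro i j h
    have h' : i < j := h
    have : ¬ (i : ℕ) = j + 1 := by
      rw [Fin.lt_def] at h'
      omega
    simp [openF, openE, this, h'.ne]

end OpenModel

end

/-! ### The periodic case: the twisted loop algebra. -/

section

section LoopModel

variable (N m : ℕ) [NeZero N]

/-- The periodic lattice, unrolled. -/
def perLattice : Lattice (perGrid N m) m where
  V := Set.univ
  row β := (β.2.val : ℤ)
  row_cast β := by simp [perGrid]
  lev_le β := Nat.lt_succ_iff.1 β.1.2
  mem_V β := ⟨trivial, trivial⟩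
  mem_congr _ _ _ _ := trivial
  exists_label p j hj _ _ := ⟨(⟨j, by omega⟩, (p : ZMod N)), rfl, rfl⟩
  label_inj β γ h1 h2 := Prod.ext (Fin.ext h1) h2
  interval _ _ _ _ _ _ _ := trivial

variable {N m} (σ : ℤˣ)

theorem units_mul_mul (σ : ℤˣ) (n : ℤ) : (σ : ℤ) * ((σ : ℤ) * n) = n := by
  rw [← mul_assoc, ← Units.val_mul, Int.units_mul_self, Units.val_one, one_mul]

/-- The entry `(p, q)` of the unrolled loop. -/
def loopExt (X : loopAlg N σ) (p q : ℤ) : ℝ :=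
  (X.1 (p : ZMod N) (q : ZMod N)).coeff ((σ : ℤ) * (p - q))

variable {σ}

theorem loop_coeff_eq_zero (X : loopAlg N σ) {j k : ZMod N} {n : ℤ}
    (h : (((σ : ℤ) * n : ℤ) : ZMod N) ≠ j - k) : (X.1 j k).coeff n = 0 :=
  by_contra fun h' => h (X.2 n j k h')

theorem loop_coeff (X : loopAlg N σ) (p n : ℤ) :
    (X.1 (p : ZMod N) ((p - (σ : ℤ) * n : ℤ) : ZMod N)).coeff n = loopExt σ X p (p - σ * n) := by
  rw [loopExt, sub_sub_cancel, units_mul_mul]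

/-- The congruence between exponent and indices makes a triple (j, k, exponent) the same as a
position (p, q) up to common translation by N. All other coefficients vanish. -/
theorem loopExt_injective : Function.Injective (loopExt (N := N) σ) := by
  intro X Y h
  refine Subtype.ext (Matrix.ext fun j k => HahnSeries.ext (funext fun n => ?_))
  by_cases hn : (((σ : ℤ) * n : ℤ) : ZMod N) = j - k
  · obtain ⟨p, rfl⟩ := ZMod.intCast_surjective j
    have hk : k = ((p - (σ : ℤ) * n : ℤ) : ZMod N) := by
      rw [Int.cast_sub, hn]
      ring
    rw [hk, loop_coeff, loop_coeff, h]
  · rw [loop_coeff_eq_zero X hn, loop_coeff_eq_zero Y hn]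

theorem exists_loop_bound (X : loopAlg N σ) :
    ∃ d : ℤ, ∀ j k n, n < -d → (X.1 j k).coeff n = 0 := by
  obtain ⟨d, hd⟩ := (Set.finite_range fun i : ZMod N × ZMod N => -(X.1 i.1 i.2).order).bddAbove
  refine ⟨d, fun j k n hn => HahnSeries.coeff_eq_zero_of_lt_order ?_⟩
  have := hd ⟨(j, k), rfl⟩
  simp only at this
  omega

theorem laurent_coeff_mul {f g : LaurentSeries ℝ} {d e : ℤ} (hf : ∀ n < -d, f.coeff n = 0)
    (hg : ∀ n < -e, g.coeff n = 0) (n : ℤ) :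
    (f * g).coeff n = ∑ i ∈ Finset.Icc (-d) (n + e), f.coeff i * g.coeff (n - i) := by
  rw [HahnSeries.coeff_mul]
  refine Finset.sum_bij_ne_zero (fun a _ _ => a.1) ?_ ?_ ?_ ?_
  · rintro ⟨i, j⟩ h hne
    have h1 : i + j = n := (Finset.mem_antidiagonal.mp h).2.2
    have h2 : ¬ i < -d := fun h' => left_ne_zero_of_mul hne (hf i h')
    have h3 : ¬ j < -e := fun h' => right_ne_zero_of_mul hne (hg j h')
    simp only [Finset.mem_Icc]
    omega
  · rintro ⟨i, j⟩ h _ ⟨i', j'⟩ h' _ hi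
    have h1 : i + j = n := (Finset.mem_antidiagonal.mp h).2.2
    have h2 : i' + j' = n := (Finset.mem_antidiagonal.mp h').2.2
    simp only at hi
    exact Prod.ext hi (by simp only; omega)
  · intro i _ hne
    exact ⟨(i, n - i), Finset.mem_antidiagonal.2 ⟨left_ne_zero_of_mul hne,
      right_ne_zero_of_mul hne, by ring⟩, hne, rfl⟩
  · rintro ⟨i, j⟩ h _
    have h1 : i + j = n := (Finset.mem_antidiagonal.mp h).2.2
    rw [← h1, add_sub_cancel_left]

/-- Once p and the exponent i of the first factor are fixed, only one residue contributes to the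
matrix product. The double sum over exponents and residues is therefore a single sum over r = p - σi
in ℤ. -/
theorem loopExt_mul (X Y : loopAlg N σ) (p q : ℤ) :
    loopExt σ (X * Y) p q = ∑ᶠ r, loopExt σ X p r * loopExt σ Y r q := by
  obtain ⟨d, hd⟩ := exists_loop_bound X
  obtain ⟨e, he⟩ := exists_loop_bound Y
  have h1 : loopExt σ (X * Y) p q = ∑ i ∈ Finset.Icc (-d) ((σ : ℤ) * (p - q) + e),
      loopExt σ X p (p - σ * i) * loopExt σ Y (p - σ * i) q := by
    rw [loopExt, Subalgebra.coe_mul, Matrix.mul_apply, HahnSeries.coeff_sum]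
    simp only [laurent_coeff_mul (hd _ _) (he _ _)]
    rw [Finset.sum_comm]
    refine Finset.sum_congr rfl fun i _ => ?_
    rw [Finset.sum_eq_single ((p - (σ : ℤ) * i : ℤ) : ZMod N), loop_coeff]
    · congr 1
      rw [loopExt, sub_right_comm, mul_sub (σ : ℤ) (p - q), units_mul_mul]
    · intro l _ hl
      rw [loop_coeff_eq_zero X, zero_mul]
      intro h
      refine hl ?_
      rw [Int.cast_sub, h]
      ring
    · simp
  have h2 : Function.Injective fun i : ℤ => p - (σ : ℤ) * i := fun i j h => by
    have h' : (σ : ℤ) * i = σ * j := sub_right_injective h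
    rw [← units_mul_mul σ i, h', units_mul_mul]
  rw [h1, finsum_eq_sum_of_support_subset (s := (Finset.Icc (-d) ((σ : ℤ) * (p - q) + e)).image
    fun i : ℤ => p - (σ : ℤ) * i), Finset.sum_image fun i _ j _ h => h2 h]
  intro r hr
  rw [Finset.coe_image, Set.mem_image]
  refine ⟨(σ : ℤ) * (p - r), ?_, by rw [units_mul_mul]; ring⟩
  have h3 : ¬ (σ : ℤ) * (p - r) < -d := fun h => left_ne_zero_of_mul hr (hd _ _ _ h)
  have h4 : ¬ (σ : ℤ) * (r - q) < -e := fun h => right_ne_zero_of_mul hr (he _ _ _ h)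
  rw [Finset.mem_coe, Finset.mem_Icc]
  have h5 : (σ : ℤ) * (p - q) = σ * (p - r) + σ * (r - q) := by ring
  omega

theorem exists_loop {g : ℤ → ℤ → ℝ}
    (h1 : ∀ p q (n : ℤ), (n : ZMod N) = 0 → g (p + n) (q + n) = g p q)
    (h2 : ∃ d : ℤ, ∀ p q, (σ : ℤ) * (p - q) < -d → g p q = 0) :
    ∃ X : loopAlg N σ, loopExt σ X = g := by
  obtain ⟨d, hd⟩ := h2
  let c : ZMod N → ZMod N → ℤ → ℝ := fun j k n =>
    if (((σ : ℤ) * n : ℤ) : ZMod N) = j - k then g j.val (j.val - σ * n) else 0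
  have hc : ∀ j k, BddBelow (Function.support (c j k)) := by
    intro j k
    refine ⟨-d, fun n hn => ?_⟩
    by_contra h
    refine hn ?_
    simp only [c]
    split_ifs
    · refine hd _ _ ?_
      rw [sub_sub_cancel, units_mul_mul]
      omega
    · rfl
  refine ⟨⟨Matrix.of fun j k => HahnSeries.ofSuppBddBelow (c j k) (hc j k), ?_⟩, ?_⟩
  · intro n j k h
    by_contra h'
    refine h ?_
    simp only [Matrix.of_apply, HahnSeries.ofSuppBddBelow, c]
    exact if_neg h'
  · funext p q
    simp only [loopExt, Matrix.of_apply, HahnSeries.ofSuppBddBelow, c]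
    rw [units_mul_mul, if_pos (by push_cast; rfl)]
    have hz : ((((p : ZMod N).val : ℤ) - p : ℤ) : ZMod N) = 0 := by
      push_cast
      rw [ZMod.natCast_zmod_val, sub_self]
    rw [← h1 p q _ hz]
    congr 1 <;> ring

theorem loopExt_loopUnit (d : ℤ) (j k : ZMod N) (h : (d : ZMod N) = j - k) (p q : ℤ) :
    loopExt σ (loopUnit σ d j k h) p q = if j = (p : ZMod N) ∧ p - q = d then 1 else 0 := by
  change (Matrix.single j k (HahnSeries.single ((σ : ℤ) * d) (1 : ℝ)) (p : ZMod N)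
    (q : ZMod N)).coeff ((σ : ℤ) * (p - q)) = _
  rw [Matrix.single_apply]
  by_cases h1 : p - q = d
  · have h2 : j = (p : ZMod N) → k = (q : ZMod N) := by
      rintro rfl
      have : (q : ZMod N) = p - (d : ZMod N) := by
        rw [← h1]
        push_cast
        ring
      rw [this, h]
      ring
    by_cases h3 : j = (p : ZMod N)
    · rw [if_pos ⟨h3, h2 h3⟩, if_pos ⟨h3, h1⟩, h1, HahnSeries.coeff_single_same]
    · rw [if_neg fun h' => h3 h'.1, if_neg fun h' => h3 h'.1, HahnSeries.coeff_zero]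
  · rw [if_neg fun h' : j = (p : ZMod N) ∧ p - q = d => h1 h'.2]
    split_ifs
    · refine HahnSeries.coeff_single_of_ne fun h' => h1 ?_
      rw [← units_mul_mul σ (p - q), h', units_mul_mul]
    · exact HahnSeries.coeff_zero

theorem loopExt_loopGen (β : PerIdx N m) : loopExt σ (loopGen σ β) = (perGrid N m).genMat β := by
  funext p q
  rw [loopGen, loopExt_loopUnit, Grid.genMat]
  refine if_congr (and_congr Iff.rfl ?_) rfl rfl
  simp only [perGrid]
  omega

theorem loopExt_loopDual (β : PerIdx N m) (p q : ℤ) :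
    loopExt σ (loopDual σ β) p q = (perGrid N m).genMat β q p := by
  rw [loopDual, loopExt_loopUnit]
  change _ = if β.2 = (q : ZMod N) ∧ p = q + (β.1.val : ℤ) then 1 else 0
  by_cases h : p - q = (β.1.val : ℤ)
  · have h' : p = q + (β.1.val : ℤ) := by omega
    refine if_congr (and_congr ?_ ⟨fun _ => h', fun _ => h⟩) rfl rfl
    rw [h']
    push_cast
    exact add_left_inj _
  · rw [if_neg fun h' => h h'.2, if_neg fun h' => h (by omega)]

variable (N m σ)

/-- `loopExt` as a linear map. -/
def loopExtLinear : loopAlg N σ →ₗ[ℝ] (ℤ → ℤ → ℝ) where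
  toFun := loopExt σ
  map_add' X Y := by
    funext p q
    simp [loopExt]
  map_smul' c X := by
    funext p q
    simp [loopExt]

theorem loopExt_sum {κ : Type*} (s : Finset κ) (f : κ → loopAlg N σ) (p q : ℤ) :
    loopExt σ (∑ i ∈ s, f i) p q = ∑ i ∈ s, loopExt σ (f i) p q := by
  have := congrFun₂ (map_sum (loopExtLinear N σ) f s) p q
  rwa [Finset.sum_apply, Finset.sum_apply] at this

/-- The realization of the twisted loop algebra. -/
def loopModel : Model (perLattice N m) (loopAlg N σ) where
  U := loopExtLinear N σ
  inj := loopExt_injective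
  τ := σ
  sign := by
    rcases Int.units_eq_one_or σ with h | h <;> simp [h]
  off_row X p q h := absurd trivial h
  off_col X p q h := absurd trivial h
  shift X p q n h := by
    change loopExt σ X _ _ = loopExt σ X _ _
    rw [loopExt, loopExt, add_sub_add_right_eq_sub]
    push_cast
    rw [h, add_zero, add_zero]
  bdd X := by
    obtain ⟨d, hd⟩ := exists_loop_bound X
    exact ⟨d, fun p q h => hd _ _ _ h⟩
  one := by
    funext p q
    change loopExt σ 1 p q = _
    rw [loopExt, Subalgebra.coe_one, Matrix.one_apply, diagMat]
    by_cases h : q = p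
    · subst h
      rw [if_pos rfl, if_pos ⟨trivial, rfl⟩, sub_self, mul_zero, HahnSeries.coeff_one, if_pos rfl]
    · rw [if_neg fun h' : p ∈ (perLattice N m).V ∧ q = p => h h'.2]
      split_ifs
      · rw [HahnSeries.coeff_one, if_neg]
        rcases Int.units_eq_one_or σ with h | h <;> rw [h] <;> simp <;> omega
      · exact HahnSeries.coeff_zero
  mul X Y p q := loopExt_mul X Y p q
  realize g _ h1 h2 := exists_loop h1 h2
  reps := Finset.Ico 0 (N : ℤ)
  reps_unique p _ := by
    have hN : (0 : ℤ) < N := by exact_mod_cast NeZero.pos N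
    refine ⟨p % N, ⟨Finset.mem_Ico.2 ⟨Int.emod_nonneg _ hN.ne', Int.emod_lt_of_pos _ hN⟩, ?_⟩, ?_⟩
    · rw [ZMod.intCast_eq_intCast_iff', Int.emod_emod_of_dvd _ dvd_rfl]
    · rintro k ⟨hk, hkp⟩
      rw [Finset.mem_Ico] at hk
      rw [ZMod.intCast_eq_intCast_iff', Int.emod_eq_of_lt hk.1 hk.2] at hkp
      exact hkp
  pair := loopPair σ
  pair_eq X Y := by
    change _ = ∑ k ∈ Finset.Ico 0 (N : ℤ), loopExt σ (X * Y) k k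
    rw [loopPair, Matrix.trace, HahnSeries.coeff_sum]
    refine Finset.sum_bij (fun (i : ZMod N) _ => (i.val : ℤ)) ?_ ?_ ?_ ?_
    · intro i _
      have := ZMod.val_lt i
      rw [Finset.mem_Ico]
      omega
    · intro i _ j _ h
      exact ZMod.val_injective N (by exact_mod_cast h)
    · intro p hp
      rw [Finset.mem_Ico] at hp
      refine ⟨(p : ZMod N), Finset.mem_univ _, ?_⟩
      rw [ZMod.val_intCast, Int.emod_eq_of_lt hp.1 hp.2]
    · intro i _
      rw [loopExt, sub_self, mul_zero, Int.cast_natCast, ZMod.natCast_zmod_val]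
      rfl
  pair_comm X Y := by
    rw [loopPair, loopPair, Subalgebra.coe_mul, Matrix.trace_mul_comm, Subalgebra.coe_mul]
  E := loopE N σ
  U_E := by
    funext p q
    change loopExt σ (loopE N σ) p q = _
    rw [loopE, loopExt_sum, subDiag, Finset.sum_eq_single ((p : ZMod N) - 1), loopExt_loopUnit]
    · rw [sub_add_cancel]
      by_cases h : q = p - 1
      · rw [if_pos ⟨rfl, by omega⟩, if_pos ⟨trivial, trivial, h⟩]
      · rw [if_neg fun h' => h (by omega), if_neg fun h' => h h'.2.2]
    · intro k _ hk
      rw [loopExt_loopUnit, if_neg]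
      rintro ⟨h, -⟩
      exact hk (by rw [← h, add_sub_cancel_right])
    · simp
  gen := loopGen σ
  U_gen := loopExt_loopGen
  R := loopR σ
  U_R X p q := by
    change loopExt σ (loopR σ X) p q = if _ then loopExt σ X p q else - loopExt σ X p q
    rw [loopExt, loopExt, loopR]
    simp only [Matrix.of_apply, flipNeg, units_mul_mul]
    exact if_congr sub_nonneg rfl rfl

theorem isUnit_loopF {α : ℝ} (hα : α ≠ 0) : IsUnit (loopF N σ α) := by
  let M := loopModel N 0 σ
  -- These are the coefficients of 1/(1 - αλ), expanded at λ = 0 for σ = 1 and at λ = ∞ for σ = -1;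
  -- the second expansion requires α ≠ 0.
  obtain ⟨w, ⟨d, hd⟩, hw⟩ : ∃ w : ℤ → ℝ, (∃ d : ℤ, ∀ n, (σ : ℤ) * n < -d → w n = 0) ∧
      ∀ n, w n - α * w (n - 1) = if n = 0 then 1 else 0 := by
    rcases Int.units_eq_one_or σ with h | h
    · refine ⟨fun n => if 0 ≤ n then α ^ n else 0, ⟨0, fun n hn => if_neg ?_⟩, fun n => ?_⟩
      · rw [h, Units.val_one] at hn
        omega
      · beta_reduce
        rcases lt_trichotomy n 0 with h0 | h0 | h0
        · rw [if_neg (by omega), if_neg (by omega), if_neg (by omega)]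
          ring
        · subst h0
          simp
        · rw [if_pos (by omega), if_pos (by omega), if_neg (by omega), zpow_sub_one₀ hα]
          field_simp
          ring
    · refine ⟨fun n => if 0 ≤ n then 0 else - α ^ n, ⟨0, fun n hn => if_pos ?_⟩, fun n => ?_⟩
      · rw [h, Units.val_neg, Units.val_one] at hn
        omega
      · beta_reduce
        rcases lt_trichotomy n 0 with h0 | h0 | h0
        · rw [if_neg (by omega), if_neg (by omega), if_neg (by omega), zpow_sub_one₀ hα]
          field_simp
          ring
        · subst h0
          rw [if_pos le_rfl, if_neg (by omega), if_pos rfl, zero_sub,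
            zero_sub, zpow_neg_one]
          field_simp
        · rw [if_pos (by omega), if_pos (by omega), if_neg (by omega)]
          ring
  obtain ⟨W, hW⟩ := M.realize (fun p q => w (p - q)) (fun p q h => by
      rcases h with h | h <;> exact absurd trivial h)
    (fun p q n _ => by rw [add_sub_add_right_eq_sub]) ⟨d, fun p q h => hd _ h⟩
  have h1 : ∀ p q : ℤ, w (p - q) - α * w (p - q - 1) = M.U 1 p q := fun p q => by
    rw [hw, M.one, diagMat]
    by_cases h : q = p
    · rw [if_pos (by omega), if_pos ⟨trivial, h⟩]
    · rw [if_neg (by omega), if_neg fun h' => h h'.2]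
  have e1 : M.F α * W = 1 := M.ext fun p q => by
    rw [M.U_F_mul α W trivial, hW, ← h1, sub_right_comm]
  have e2 : W * M.F α = 1 := M.ext fun p q => by
    rw [M.U_mul_F α W p trivial, hW, ← h1, sub_sub]
  exact ⟨⟨M.F α, W, e1, e2⟩, rfl⟩

/-- Unrolled, λ^{qN} is the translation by qN, which commutes with every matrix invariant under
translation by N. -/
theorem isShift_loopShift (q : ℤ) : (loopModel N m σ).IsShift (loopShift N σ q) (q * N) := by
  let M := loopModel N m σ
  have hU : ∀ a b, M.U (loopShift N σ q) a b = if a - b = q * N then 1 else 0 := fun a b => by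
    change loopExt σ (loopShift N σ q) a b = _
    rw [loopShift, loopExt_sum, Finset.sum_eq_single (a : ZMod N), loopExt_loopUnit]
    · exact if_congr ⟨fun h => h.2, fun h => ⟨rfl, h⟩⟩ rfl rfl
    · intro k _ hk
      rw [loopExt_loopUnit, if_neg fun h => hk h.1]
    · simp
  refine ⟨fun X => M.ext fun a b => ?_, fun a b h => ?_, fun h => M.ext fun a b => ?_⟩
  · rw [M.mul_sum {a - q * N}, M.mul_sum {b + q * N}, Finset.sum_singleton, Finset.sum_singleton,
      hU, hU, if_pos (by ring), if_pos (by ring), one_mul, mul_one,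
      ← M.shift X (a - q * N) b (q * N) (by simp), sub_add_cancel]
    · intro r hr
      rw [Finset.mem_singleton] at hr
      rw [hU, if_neg (by omega), mul_zero]
    · intro r hr
      rw [Finset.mem_singleton] at hr
      rw [hU, if_neg (by omega), zero_mul]
  · rw [hU] at h
    by_contra h'
    exact h (if_neg h')
  · rw [hU, h, M.one, diagMat]
    by_cases h : b = a
    · rw [if_pos (by omega), if_pos ⟨trivial, h⟩]
    · rw [if_neg (by omega), if_neg fun h' => h h'.2]

end LoopModel

end

end

end RTL

/-! ### Assembly of the periodic and the open-end case. -/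

theorem mainTheorem2 (N m : ℕ) [NeZero N] (α : ℝ) (hα : α ≠ 0) :
    -- periodic case
    ( -- the linear bracket is the one induced by `PB₁(R; F)`
      (∀ (σ : ℤˣ) (β γ : RTL.PerIdx N m) (x : RTL.PerIdx N m → ℝ),
        (RTL.perGrid N m).lin m α β γ x =
          RTL.rLin (RTL.loopPair σ) (RTL.loopR σ) (RTL.loopF N σ α)
            (RTL.loopDual σ β) (RTL.loopDual σ γ) (RTL.loopT σ x)) ∧
      -- the two brackets are Poisson and compatible
      RTL.AreCompatible (RTL.bracket ((RTL.perGrid N m).lin m α))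
        (RTL.bracket ((RTL.perGrid N m).quad m)) ∧
      -- the flow attached to an arbitrary Ad-invariant function is Hamiltonian
      (∀ (σ : ℤˣ) (U : Set (RTL.loopAlg N σ)) (φ : RTL.loopAlg N σ → ℝ)
        (grad : RTL.loopAlg N σ → RTL.loopAlg N σ),
        RTL.IsAdInvariant (RTL.loopPair σ) U φ grad →
        RTL.IsHamiltonianLaxOn ((RTL.perGrid N m).quad m) (RTL.loopGen σ)
          {x | RTL.loopT σ x * Ring.inverse (RTL.loopF N σ α) ∈ U}
          (fun x => φ (RTL.loopT σ x * Ring.inverse (RTL.loopF N σ α)))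
          (fun x => RTL.relLax (RTL.loopR σ) (RTL.loopF N σ α)
            (fun X => X * grad X) (RTL.loopT σ x))) ∧
      -- the polynomial flows of the hierarchy
      (∀ (σ : ℤˣ) (q : ℤ) (n : ℕ), ∃ H : (RTL.PerIdx N m → ℝ) → ℝ,
        RTL.IsHamiltonianLaxOn ((RTL.perGrid N m).quad m) (RTL.loopGen σ) Set.univ H
          (fun x => RTL.relLax (RTL.loopR σ) (RTL.loopF N σ α)
            (fun X => RTL.loopShift N σ q * (1 + α • X) ^ n) (RTL.loopT σ x))) ∧
      -- the rational flows of the hierarchy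
      (∀ (q : ℤ) (n : ℕ), ∃ H : (RTL.PerIdx N m → ℝ) → ℝ,
        RTL.IsHamiltonianLaxOn ((RTL.perGrid N m).quad m) (RTL.loopGen (-1))
          ((RTL.perGrid N m).regular α) H
          (fun x => RTL.relLax (RTL.loopR (-1)) (RTL.loopF N (-1) α)
            (fun X => RTL.loopShift N (-1) q * Ring.inverse (1 + α • X) ^ n)
            (RTL.loopT (-1) x))) ∧
      -- the "minus first" flow: it belongs to the hierarchy and has Hamiltonian `-α H₀`
      (∀ x ∈ (RTL.perGrid N m).regular α,
        RTL.relLax (RTL.loopR (-1)) (RTL.loopF N (-1) α)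
            (fun X => (-α⁻¹) • Ring.inverse (1 + α • X)) (RTL.loopT (-1) x) =
          ∑ β, (RTL.perGrid N m).minusFirst α x β • RTL.loopGen (-1) β) ∧
      RTL.IsHamiltonianOn ((RTL.perGrid N m).quad m) ((RTL.perGrid N m).regular α)
        ((RTL.perGrid N m).logHam α) ((RTL.perGrid N m).minusFirst α)) ∧
    -- open-end case
    ((∀ (β γ : RTL.OpenIdx N m) (x : RTL.OpenIdx N m → ℝ),
        (RTL.openGrid N m).lin m α β γ x =
          RTL.rLin RTL.openPair RTL.openR (RTL.openF N α)
            (RTL.openDual β) (RTL.openDual γ) (RTL.openT x)) ∧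
      RTL.AreCompatible (RTL.bracket ((RTL.openGrid N m).lin m α))
        (RTL.bracket ((RTL.openGrid N m).quad m)) ∧
      (∀ (U : Set (Matrix (Fin N) (Fin N) ℝ)) (φ : Matrix (Fin N) (Fin N) ℝ → ℝ)
        (grad : Matrix (Fin N) (Fin N) ℝ → Matrix (Fin N) (Fin N) ℝ),
        RTL.IsAdInvariant RTL.openPair U φ grad →
        RTL.IsHamiltonianLaxOn ((RTL.openGrid N m).quad m) RTL.openGen
          {x | RTL.openT x * Ring.inverse (RTL.openF N α) ∈ U}
          (fun x => φ (RTL.openT x * Ring.inverse (RTL.openF N α)))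
          (fun x => RTL.relLax RTL.openR (RTL.openF N α)
            (fun X => X * grad X) (RTL.openT x))) ∧
      (∀ n : ℕ, ∃ H : (RTL.OpenIdx N m → ℝ) → ℝ,
        RTL.IsHamiltonianLaxOn ((RTL.openGrid N m).quad m) RTL.openGen Set.univ H
          (fun x => RTL.relLax RTL.openR (RTL.openF N α)
            (fun X => (1 + α • X) ^ n) (RTL.openT x))) ∧
      (∀ n : ℕ, ∃ H : (RTL.OpenIdx N m → ℝ) → ℝ,
        RTL.IsHamiltonianLaxOn ((RTL.openGrid N m).quad m) RTL.openGen
          ((RTL.openGrid N m).regular α) H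
          (fun x => RTL.relLax RTL.openR (RTL.openF N α)
            (fun X => Ring.inverse (1 + α • X) ^ n) (RTL.openT x))) ∧
      (∀ x ∈ (RTL.openGrid N m).regular α,
        RTL.relLax RTL.openR (RTL.openF N α)
            (fun X => (-α⁻¹) • Ring.inverse (1 + α • X)) (RTL.openT x) =
          ∑ β, (RTL.openGrid N m).minusFirst α x β • RTL.openGen β) ∧
      RTL.IsHamiltonianOn ((RTL.openGrid N m).quad m) ((RTL.openGrid N m).regular α)
        ((RTL.openGrid N m).logHam α) ((RTL.openGrid N m).minusFirst α)) := by
  refine ⟨⟨fun σ β γ x => ?_, ?_, fun σ U φ grad h => ?_, fun σ q n => ?_, fun q n => ?_,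
    fun x hx => ?_, ?_⟩, fun β γ x => ?_, ?_, fun U φ grad h => ?_, fun n => ?_, fun n => ?_,
    fun x hx => ?_, ?_⟩
  · exact (RTL.loopModel N m σ).lin_eq_rLin RTL.loopExt_loopDual α β γ x
  · exact (RTL.perLattice N m).areCompatible α
  · exact (RTL.loopModel N m σ).isHamiltonianLaxOn_adInvariant (RTL.isUnit_loopF N σ hα) h
  · exact (RTL.loopModel N m σ).exists_hamiltonian_pow (RTL.isUnit_loopF N σ hα)
      (RTL.isShift_loopShift N m σ q) n
  · exact (RTL.loopModel N m (-1)).exists_hamiltonian_inverse_pow hα rfl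
      (RTL.isUnit_loopF N (-1) hα) (RTL.isShift_loopShift N m (-1) q) n
  · exact (RTL.loopModel N m (-1)).relLax_minusFirst hα rfl (RTL.isUnit_loopF N (-1) hα) hx
  · exact ⟨(RTL.perLattice N m).isOpen_regular α, (RTL.perLattice N m).contDiffOn_logHam α,
      fun x hx β => ((RTL.perLattice N m).bracket_logHam hα hx β).symm⟩
  · exact (RTL.openModel N m).lin_eq_rLin RTL.openExt_openDual α β γ x
  · exact (RTL.openLattice N m).areCompatible α
  · exact (RTL.openModel N m).isHamiltonianLaxOn_adInvariant (RTL.isUnit_openF N α) h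
  -- In the open-end case q = 0, so the shift is the identity in degree 0.
  · have h := (RTL.openModel N m).exists_hamiltonian_pow (RTL.isUnit_openF N α)
      (RTL.openModel N m).isShift_one n
    simp only [one_mul] at h
    exact h
  · have h := (RTL.openModel N m).exists_hamiltonian_inverse_pow hα rfl
      (RTL.isUnit_openF N α) (RTL.openModel N m).isShift_one n
    simp only [one_mul] at h
    exact h
  · exact (RTL.openModel N m).relLax_minusFirst hα rfl (RTL.isUnit_openF N α) hx
  · exact ⟨(RTL.openLattice N m).isOpen_regular α, (RTL.openLattice N m).contDiffOn_logHam α,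
      fun x hx β => ((RTL.openLattice N m).bracket_logHam hα hx β).symm⟩
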